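/- Let $\mathbb H,\mathbb U$ be (real or complex) Hilbert spaces, let $(S(t))_{t\in\mathbb R}$ be a strongly continuous group on $\mathbb H$ with infinitesimal generator $(A,\mathcal D(A))$ and adjoint $(A^*,\mathcal D(A^*))$, where $\mathcal D(A^*)$ carries the graph scalar product, and let $\mathcal D(A^*)'$ be its dual with respect to the pivot space $\mathbb H$, so that $\mathcal D(A^*)\subset\mathbb H\subset\mathcal D(A^*)'$. Let $B\in\mathcal L(\mathbb U,\mathcal D(A^*)')$ be an admissible control operator for the semigroup generated by $A$, i.e. for all $T>0$ and $u\in L^2(0,T;\mathbb U)$ the function $t\mapsto\int_0^tS(t-s)Bu(s)\,ds$ (integral in $\mathcal D(A^*)'$) belongs to $C([0,T];\mathbb H)$. Let $\lambda\in\mathbb R$, let $Q\in\mathcal L(\mathbb H)$ be symmetric, invertible and coercive ($\langle Qx,x\rangle\ge c\|x\|^2$ for some $c>0$), let $R\in\mathcal L(\mathbb H)$ and $W\in\mathcal L(\mathbb U)$ be symmetric and non-negative, and assume $AQ+QA^*-BWB^*+QRQ+2\lambda Q=0$ in the sense that, for all $x,z\in\mathcal D(A^*)$, $$\langle Qx,A^*z\rangle+\langle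 A^*x,Qz\rangle-\langle WB^*x,B^*z\rangle_{\mathbb U}+\langle RQx,Qz\rangle+2\lambda\langle Qx,z\rangle=0.$$ For $y_0\in\mathbb H$ consider the system on $(0,\infty)$ $$y'=Ay-BWB^*\widetilde y,\qquad \widetilde y'=-A^*\widetilde y-2\lambda\widetilde y-RQ\widetilde y,\qquad y(0)=y_0,\quad \widetilde y(0)=Q^{-1}y_0.$$ A weak solution is a pair $y,\widetilde y\in C([0,\infty);\mathbb H)$ which takes the initial values and satisfies, in the sense of distributions on $(0,T)$ for every $T>0$, $\frac{d}{dt}\langle y,\varphi\rangle=\langle y,A^*\varphi\rangle-\langle WB^*\widetilde y,B^*\varphi\rangle_{\mathbb U}$ for all $\varphi\in\mathcal D(A^*)$ and $\frac{d}{dt}\langle\widetilde y,\psi\rangle=-\langle\widetilde y,A\psi\rangle-\langle 2\lambda\widetilde y+RQ\widetilde y,\psi\rangle$ for all $\psi\in\mathcal D(A)$. Here $B^*\widetilde y\in L^2(0,T;\mathbb U)$ is defined by continuous extension: it is the limit in $L^2(0,T;\mathbb U)$ of $B^*z_n$, where $z_n\in C([0,T];\mathcal D(A^*))$ are weak solutions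 of $z_n'=-A^*z_n+g_n$ with $g_n\in C([0,T];\mathcal D(A^*))$, $z_n(0)\to\widetilde y(0)$ in $\mathbb H$ and $g_n\to-2\lambda\widetilde y-RQ\widetilde y$ in $L^1(0,T;\mathbb H)$. Then for every $y_0\in\mathbb H$ this system has a unique weak solution $(y,\widetilde y)$ and, setting $S^Q(t)y_0:=y(t)$ for $t\ge0$, the following hold. 1. $(S^Q(t))_{t\ge0}$ is a strongly continuous semigroup on $\mathbb H$, and there is $C>0$ such that $\|S^Q(t)\|\le Ce^{-\lambda t}$ for all $t\ge0$. 2. Its infinitesimal generator $(A^Q,\mathcal D(A^Q))$ satisfies $\mathcal D(A^Q)=Q\mathcal D(A^*)=\{Qx:x\in\mathcal D(A^*)\}$ and $A^Qz=-QA^*Q^{-1}z-2\lambda z-QRz$ for $z\in\mathcal D(A^Q)$. 3. If $BWB^*$ is bounded, i.e. $BWB^*:\mathcal D(A^*)\to\mathcal D(A^*)'$ is the restriction to $\mathcal D(A^*)$ of an operator in $\mathcal L(\mathbb H)$, still denoted $BWB^*$, then $\mathcal D(A^Q)=\mathcal D(A)$ and $A^Qx=Ax-BWB^*Q^{-1}x$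 for $x\in\mathcal D(A)$. 4. If $\mathcal D(A^Q)=\mathcal D(A)$, then for all $x\in\mathcal D(A^*)$ one has $Qx\in\mathcal D(A)$, $BWB^*x\in\mathbb H$ and $$\|BWB^*x\|_{\mathbb H}\le\|AQx\|_{\mathbb H}+C\big(\|A^*x\|_{\mathbb H}+\|x\|_{\mathbb H}\big)$$ for some constant $C>0$ independent of $x$. -/

import Mathlib

open MeasureTheory Filter Topology Set
open scoped NNReal ENNReal

noncomputable section

namespace StaticFeedback

variable {𝕜 : Type*} [RCLike 𝕜]
variable {H : Type*} [NormedAddCommGroup H] [InnerProductSpace 𝕜 H]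
variable {U : Type*} [NormedAddCommGroup U] [InnerProductSpace 𝕜 U]

/-! ### Strongly continuous semigroups and groups -/

variable (𝕜 H) in
/-- A strongly continuous semigroup `(S(t))_{t ≥ 0}` of bounded operators on `H`. -/
structure C0Semigroup where
  toFun : ℝ≥0 → H →L[𝕜] H
  map_zero : toFun 0 = ContinuousLinearMap.id 𝕜 H
  map_add : ∀ s t, toFun (s + t) = (toFun s).comp (toFun t)
  tendsto_zero : ∀ x, Tendsto (fun t => toFun t x) (𝓝 0) (𝓝 x)

variable (𝕜 H) in
/-- A strongly continuous group `(S(t))_{t ∈ ℝ}` of bounded operators on `H`. -/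
structure C0Group where
  toFun : ℝ → H →L[𝕜] H
  map_zero : toFun 0 = ContinuousLinearMap.id 𝕜 H
  map_add : ∀ s t, toFun (s + t) = (toFun s).comp (toFun t)
  tendsto_zero : ∀ x, Tendsto (fun t => toFun t x) (𝓝 0) (𝓝 x)

/-- `y` is the limit of `(S(t) x - x) / t` as `t → 0+`. -/
def C0Semigroup.HasGenerator (S : C0Semigroup 𝕜 H) (x y : H) : Prop :=
  Tendsto (fun t : ℝ≥0 => (((t : ℝ) : 𝕜))⁻¹ • (S.toFun t x - x)) (𝓝[>] 0) (𝓝 y)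

theorem C0Semigroup.HasGenerator.unique {S : C0Semigroup 𝕜 H} {x y y' : H}
    (h : S.HasGenerator x y) (h' : S.HasGenerator x y') : y = y' :=
  tendsto_nhds_unique h h'

theorem C0Semigroup.HasGenerator.add {S : C0Semigroup 𝕜 H} {x x' y y' : H}
    (h : S.HasGenerator x y) (h' : S.HasGenerator x' y') :
    S.HasGenerator (x + x') (y + y') := by
  refine (Tendsto.add h h').congr fun t => ?_
  rw [← smul_add, _root_.map_add]
  congr 1
  abel

theorem C0Semigroup.HasGenerator.smul {S : C0Semigroup 𝕜 H} {x y : H}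
    (c : 𝕜) (h : S.HasGenerator x y) : S.HasGenerator (c • x) (c • y) := by
  refine (Tendsto.const_smul h c).congr fun t => ?_
  rw [smul_comm, smul_sub, map_smul]

/-- The infinitesimal generator of a strongly continuous semigroup: its domain is the set of `x`
for which `lim_{t → 0+} (S(t) x - x) / t` exists, and its value at `x` is this limit. -/
def C0Semigroup.generator (S : C0Semigroup 𝕜 H) : H →ₗ.[𝕜] H where
  domain :=
    { carrier := {x | ∃ y, S.HasGenerator x y}
      add_mem' := fun ⟨_, h⟩ ⟨_, h'⟩ => ⟨_, h.add h'⟩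
      zero_mem' := ⟨0, by simp [C0Semigroup.HasGenerator]⟩
      smul_mem' := fun c _ ⟨_, h⟩ => ⟨_, h.smul c⟩ }
  toFun :=
    { toFun := fun x => x.2.choose
      map_add' := fun x x' =>
        (x + x').2.choose_spec.unique (x.2.choose_spec.add x'.2.choose_spec)
      map_smul' := fun c x => (c • x).2.choose_spec.unique (x.2.choose_spec.smul c) }

theorem C0Semigroup.generator_spec (S : C0Semigroup 𝕜 H) (x : S.generator.domain) :
    S.HasGenerator (x : H) (S.generator x) :=
  x.2.choose_spec

/-- The semigroup `(S(t))_{t ≥ 0}` contained in a group. -/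
def C0Group.toC0Semigroup (S : C0Group 𝕜 H) : C0Semigroup 𝕜 H where
  toFun := fun t => S.toFun t
  map_zero := by simpa using S.map_zero
  map_add := fun s t => by simpa using S.map_add s t
  tendsto_zero := fun x => (S.tendsto_zero x).comp
    (NNReal.continuous_coe.tendsto' 0 0 NNReal.coe_zero)

/-- The infinitesimal generator `A` of a strongly continuous group. -/
def C0Group.generator (S : C0Group 𝕜 H) : H →ₗ.[𝕜] H := S.toC0Semigroup.generator

theorem C0Group.hasGenerator_map (S : C0Group 𝕜 H) (t : ℝ) (x : S.generator.domain) :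
    S.toC0Semigroup.HasGenerator (S.toFun t x) (S.toFun t (S.generator x)) := by
  have h := ((S.toFun t).continuous.tendsto _).comp (S.toC0Semigroup.generator_spec x)
  refine h.congr fun r => ?_
  have hc : S.toFun t (S.toFun r (x : H)) = S.toFun r (S.toFun t (x : H)) := by
    have h1 := S.map_add t r
    rw [add_comm, S.map_add] at h1
    exact (DFunLike.congr_fun h1 (x : H)).symm
  simp only [Function.comp_apply, map_smul, map_sub, C0Group.toC0Semigroup, hc]

/-! ### The adjoint generator, its domain with the graph norm, and the dual of that domain -/

/-- The domain of a partially defined operator `T`, realised as the graph of `T` inside the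
Hilbert sum `H ⊕ H`; thus it carries the scalar product `⟨x, y⟩ + ⟨T x, T y⟩`. -/
def graphSpace (T : H →ₗ.[𝕜] H) : Submodule 𝕜 (WithLp 2 (H × H)) :=
  T.graph.comap (WithLp.linearEquiv 2 𝕜 (H × H)).toLinearMap

/-- `x ∈ D(T)` seen as an element of the domain with its graph scalar product. -/
def toGraph (T : H →ₗ.[𝕜] H) (x : T.domain) : graphSpace T :=
  ⟨WithLp.toLp 2 ((x : H), T x), T.mem_graph x⟩

/-- The inclusion of `D(T)`, with its graph norm, into `H`. -/
def graphInclusion (T : H →ₗ.[𝕜] H) : graphSpace T →L[𝕜] H :=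
  ((ContinuousLinearMap.fst 𝕜 H H).comp
    (WithLp.prodContinuousLinearEquiv 2 𝕜 H H).toContinuousLinearMap).comp (graphSpace T).subtypeL

theorem graphInclusion_toGraph (T : H →ₗ.[𝕜] H) (x : T.domain) :
    graphInclusion T (toGraph T x) = x := rfl

theorem toGraph_surjective (T : H →ₗ.[𝕜] H) : Function.Surjective (toGraph T) := by
  rintro ⟨z, hz⟩
  obtain ⟨x, hx⟩ := (T.mem_graph_iff (x := z.ofLp)).1 hz
  exact ⟨x, Subtype.ext (congrArg (WithLp.toLp 2) (Prod.ext hx.1 hx.2))⟩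

theorem inner_toGraph (T : H →ₗ.[𝕜] H) (x y : T.domain) :
    inner 𝕜 (toGraph T x) (toGraph T y) = inner 𝕜 (x : H) (y : H) + inner 𝕜 (T x) (T y) := rfl

/-- The space `D(T)'` of bounded antilinear functionals on `D(T)` with its graph norm. -/
abbrev GraphDual (T : H →ₗ.[𝕜] H) : Type _ := graphSpace T →L⋆[𝕜] 𝕜

/-- The embedding `H ⊂ D(T)'`; `h` acts on `x ∈ D(T)` as the scalar product of `h` and `x`. -/
def pivot (T : H →ₗ.[𝕜] H) (h : H) : GraphDual T :=
  ((innerSL 𝕜 (E := H)).flip h).comp (graphInclusion T)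

theorem pivot_apply (T : H →ₗ.[𝕜] H) (h : H) (x : T.domain) :
    pivot T h (toGraph T x) = inner 𝕜 (x : H) h := rfl

variable [CompleteSpace H]

/-- The adjoint `A*` of the generator `A`. -/
def C0Group.adjGen (S : C0Group 𝕜 H) : H →ₗ.[𝕜] H := S.generator.adjoint

theorem C0Group.adjoint_mem (S : C0Group 𝕜 H) (t : ℝ) (x : S.adjGen.domain) :
    ContinuousLinearMap.adjoint (S.toFun t) (x : H) ∈ S.adjGen.domain := by
  have hx := (LinearPMap.mem_adjoint_domain_iff S.generator (x : H)).1 x.2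
  refine (LinearPMap.mem_adjoint_domain_iff S.generator _).2 ?_
  have hz : ∀ z : S.generator.domain, S.toFun t z ∈ S.generator.domain :=
    fun z => ⟨_, S.hasGenerator_map t z⟩
  have h2 : Continuous fun z : S.generator.domain =>
      (⟨S.toFun t z, hz z⟩ : S.generator.domain) :=
    ((S.toFun t).continuous.comp continuous_subtype_val).subtype_mk _
  refine (hx.comp h2).congr fun z => ?_
  have h1 : S.generator ⟨S.toFun t z, hz z⟩ = S.toFun t (S.generator z) :=
    (S.toC0Semigroup.generator_spec ⟨S.toFun t z, hz z⟩).unique (S.hasGenerator_map t z)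
  change inner 𝕜 (x : H) (S.generator ⟨S.toFun t z, hz z⟩) =
    inner 𝕜 (ContinuousLinearMap.adjoint (S.toFun t) (x : H)) (S.generator z)
  rw [h1, ContinuousLinearMap.adjoint_inner_left]

/-- The restriction of `S(t)*` to `D(A*)`. -/
def C0Group.adjMap (S : C0Group 𝕜 H) (t : ℝ) (x : S.adjGen.domain) : S.adjGen.domain :=
  ⟨ContinuousLinearMap.adjoint (S.toFun t) (x : H), S.adjoint_mem t x⟩

/-! ### Control operators -/

/-- A control operator `B ∈ L(U, D(A*)')`. -/
abbrev ControlOp (S : C0Group 𝕜 H) (U : Type*) [NormedAddCommGroup U] [InnerProductSpace 𝕜 U] :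
    Type _ :=
  U →L[𝕜] GraphDual S.adjGen

/-- The operator `B* : D(A*) → U`, i.e. `⟨B u, x⟩ = ⟨u, B* x⟩_U` for `u ∈ U` and `x ∈ D(A*)`. -/
def ControlOp.star [CompleteSpace U] {S : C0Group 𝕜 H} (B : ControlOp S U)
    (x : S.adjGen.domain) : U :=
  (InnerProductSpace.toDual 𝕜 U).symm (ContinuousLinearMap.flip B (toGraph S.adjGen x))

theorem ControlOp.inner_star [CompleteSpace U] {S : C0Group 𝕜 H} (B : ControlOp S U)
    (x : S.adjGen.domain) (u : U) : inner 𝕜 (B.star x) u = B u (toGraph S.adjGen x) := by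
  simp [ControlOp.star]

/-- The operator `B W B* : D(A*) → D(A*)'`. -/
def ControlOp.gram [CompleteSpace U] {S : C0Group 𝕜 H} (B : ControlOp S U) (W : U →L[𝕜] U)
    (x : S.adjGen.domain) : GraphDual S.adjGen :=
  B (W (B.star x))

/-- Admissibility of `B` for the semigroup generated by `A`: for all `T > 0` and
`u ∈ L²(0, T; U)`, the function `φ(t) = ∫₀ᵗ S(t - s) B u(s) ds` belongs to `C([0, T]; H)`. The
integral is understood in `D(A*)'`, where `⟨S(r) B u, x⟩ = ⟨B u, S(r)* x⟩`. -/
def ControlOp.IsAdmissible {S : C0Group 𝕜 H} (B : ControlOp S U) : Prop :=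
  ∀ T : ℝ, 0 < T → ∀ u : ℝ → U, MemLp u 2 (volume.restrict (Ioo 0 T)) →
    ∃ φ : ℝ → H, ContinuousOn φ (Icc 0 T) ∧ ∀ t ∈ Icc 0 T, ∀ x : S.adjGen.domain,
      pivot S.adjGen (φ t) (toGraph S.adjGen x) =
        ∫ s in (0 : ℝ)..t, B (u s) (toGraph S.adjGen (S.adjMap (t - s) x))

/-! ### The operator identity -/

/-- A symmetric bounded operator which is positive in the sense of coercivity. -/
def IsCoercivePositive (Q : H →L[𝕜] H) : Prop :=
  Q.toLinearMap.IsSymmetric ∧ ∃ c : ℝ, 0 < c ∧ ∀ x, c * ‖x‖ ^ 2 ≤ RCLike.re (inner 𝕜 (Q x) x)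

/-- The identity `A Q + Q A* - B W B* + Q R Q + 2 λ Q = 0`, tested on `D(A*) × D(A*)`. The
product `⟨a, b⟩`, linear in `a`, is written `inner 𝕜 b a`. -/
def RiccatiIdentity [CompleteSpace U] {S : C0Group 𝕜 H} (B : ControlOp S U) (Q R : H →L[𝕜] H)
    (W : U →L[𝕜] U) (lam : ℝ) : Prop :=
  ∀ x y : S.adjGen.domain,
    inner 𝕜 (S.adjGen y) (Q x) + inner 𝕜 (Q y) (S.adjGen x) - inner 𝕜 (B.star y) (W (B.star x))
      + inner 𝕜 (Q y) (R (Q x)) + 2 * (lam : 𝕜) * inner 𝕜 (y : H) (Q x) = 0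

/-! ### Weak solutions -/

/-- `f' = g` in the sense of distributions on `(0, T)`. -/
def DistribDeriv (T : ℝ) (f g : ℝ → 𝕜) : Prop :=
  LocallyIntegrableOn f (Ioo 0 T) ∧ LocallyIntegrableOn g (Ioo 0 T) ∧
  ∀ η : ℝ → ℝ, ContDiff ℝ ((⊤ : ℕ∞) : WithTop ℕ∞) η → HasCompactSupport η →
    tsupport η ⊆ Ioo 0 T →
    ∫ t in Ioo 0 T, ((deriv η t : ℝ) : 𝕜) * f t = - ∫ t in Ioo 0 T, ((η t : ℝ) : 𝕜) * g t

/-- `z ∈ C([0, T]; H)` is a weak solution of `z' = -A* z + g` in `(0, T)`. The test vectors range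
over `D((-A*)*) = D(A)`. -/
def IsWeakSolAdj (S : C0Group 𝕜 H) (T : ℝ) (z g : ℝ → H) : Prop :=
  ContinuousOn z (Icc 0 T) ∧ ∀ φ : S.generator.domain,
    DistribDeriv T (fun t => inner 𝕜 (φ : H) (z t))
      (fun t => - inner 𝕜 (S.generator φ) (z t) + inner 𝕜 (φ : H) (g t))

/-- For a weak solution `z` of `z' = -A* z + g` in `(0, T)`, `v` is the function
`B* z ∈ L²(0, T; U)`. Since `z(t)` is only in `H`, it is defined by continuous extension: `v` is the
limit in `L²(0, T; U)` of `B* zₙ`, where `zₙ ∈ C([0, T]; D(A*))` solves `zₙ' = -A* zₙ + gₙ` with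
`gₙ ∈ C([0, T]; D(A*))`, `zₙ(0) → z(0)` in `H` and `gₙ → g` in `L¹(0, T; H)`. -/
def IsObservation [CompleteSpace U] {S : C0Group 𝕜 H} (B : ControlOp S U) (T : ℝ) (z g : ℝ → H)
    (v : ℝ → U) : Prop :=
  MemLp v 2 (volume.restrict (Ioo 0 T)) ∧
  ∃ zn gn : ℕ → ℝ → S.adjGen.domain,
    (∀ n, ContinuousOn (fun t => toGraph S.adjGen (zn n t)) (Icc 0 T)) ∧
    (∀ n, ContinuousOn (fun t => toGraph S.adjGen (gn n t)) (Icc 0 T)) ∧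
    (∀ n, IsWeakSolAdj S T (fun t => (zn n t : H)) (fun t => (gn n t : H))) ∧
    Tendsto (fun n => (zn n 0 : H)) atTop (𝓝 (z 0)) ∧
    Tendsto (fun n => eLpNorm (fun t => (gn n t : H) - g t) 1 (volume.restrict (Ioo 0 T)))
      atTop (𝓝 0) ∧
    Tendsto (fun n => eLpNorm (fun t => B.star (zn n t) - v t) 2 (volume.restrict (Ioo 0 T)))
      atTop (𝓝 0)

/-- `(y, ỹ)` is a weak solution on `[0, T]` of
`y' = A y - B W B* ỹ`, `ỹ' = - A* ỹ - 2 λ ỹ - R Q ỹ`, `y(0) = y₀`, `ỹ(0) = ỹ₀`. -/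
def IsWeakSolOn [CompleteSpace U] {S : C0Group 𝕜 H} (B : ControlOp S U) (Q R : H →L[𝕜] H)
    (W : U →L[𝕜] U) (lam : ℝ) (y₀ yt₀ : H) (T : ℝ) (y yt : ℝ → H) : Prop :=
  ContinuousOn y (Icc 0 T) ∧ y 0 = y₀ ∧ yt 0 = yt₀ ∧
  IsWeakSolAdj S T yt (fun t => -((2 * (lam : 𝕜)) • yt t) - R (Q (yt t))) ∧
  ∃ v : ℝ → U, IsObservation B T yt (fun t => -((2 * (lam : 𝕜)) • yt t) - R (Q (yt t))) v ∧
    ∀ φ : S.adjGen.domain,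
      DistribDeriv T (fun t => inner 𝕜 (φ : H) (y t))
        (fun t => inner 𝕜 (S.adjGen φ) (y t) - inner 𝕜 (B.star φ) (W (v t)))

/-- `(y, ỹ)` is a weak solution on `[0, ∞)` of the closed-loop system
`y' = A y - B W B* ỹ`, `ỹ' = - A* ỹ - 2 λ ỹ - R Q ỹ`, `y(0) = y₀`, `ỹ(0) = Q⁻¹ y₀`. -/
def IsClosedLoopSol [CompleteSpace U] {S : C0Group 𝕜 H} (B : ControlOp S U) (Q : H ≃L[𝕜] H)
    (R : H →L[𝕜] H) (W : U →L[𝕜] U) (lam : ℝ) (y₀ : H) (y yt : ℝ → H) : Prop :=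
  ∀ T : ℝ, 0 < T → IsWeakSolOn B (Q : H →L[𝕜] H) R W lam y₀ (Q.symm y₀) T y yt

end StaticFeedback

end

open StaticFeedback

/-! The identity says, formally, that `A Q - B W B* = Q (-A* + P)` with the bounded operator `P =
-2λ - R Q` (`perturbation`). The second equation of the closed loop, `ỹ' = (-A* + P) ỹ`, does not
involve `y`, and once it is solved, `y = Q ỹ` solves the first: `Q ỹ' = A Q ỹ - B W B* ỹ`. Hence
everything reduces to the semigroup `V` generated by `-A* + P`, and `S^Q(t) = Q V(t) Q⁻¹`
(`C0Semigroup.conj`).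

Since `S` is a group, `-A*` generates the group `S(-t)*` (`C0Group.adjGroup`), and a bounded
perturbation of it gives `V` by solving a Volterra equation (`C0Group.exists_perturbation`). Weak
solutions satisfy Duhamel's formula, so `ỹ` is determined by its initial value.

The delicate point is `B* ỹ`, because `ỹ(t)` is only in `H`. By duality and uniform boundedness,
admissibility bounds `B*` along adjoint orbits in `L²` by the norm of `H`
(`ControlOp.IsAdmissible.exists_eLpNorm_le`). Averaging over the adjoint group then produces regular
approximations whose observations are Cauchy (`ControlOp.IsAdmissible.exists_isObservation`). On
regular approximations the identity may be applied pointwise in time, and the limit shows that `Q ỹ`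
solves the first equation for every admissible choice of the observation `v`
(`IsObservation.distribDeriv`). Uniqueness of `y` follows: `y - Q ỹ` solves the homogeneous
equation, since the same `v` drives both.

Decay is a Lyapunov argument. Along `V`, the derivative of `⟨Q ỹ, ỹ⟩` is `-2λ⟨Q ỹ, ỹ⟩` minus the two
non-negative terms in `W` and `R` (`two_mul_re_inner_le`), and coercivity of `Q` turns this into a
norm bound (`exists_norm_perturbed_le`). The generator of `S^Q` is the conjugate of `-A* + P`
(`hasGenerator_conj_iff`). If `B W B*` is a bounded operator `K`, the flow also satisfies Duhamel's
formula for `S` with source `-K ỹ`, so the generators differ by a bounded operator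
(`hasGenerator_conj_iff_of_bounded`). If the domains agree, the identity can be solved for `B W B*
x` (`gram_eq_pivot`). -/

noncomputable section

namespace StaticFeedback

/-! ### Strongly continuous groups, their generators and the adjoint group -/

section Groups

variable {𝕜 : Type*} [RCLike 𝕜]
variable {H : Type*} [NormedAddCommGroup H] [InnerProductSpace 𝕜 H]

theorem tendsto_nnreal_iff_tendsto_real {α : Type*} {f : ℝ → α} {l : Filter α} :
    Tendsto (fun t : ℝ≥0 => f t) (𝓝[>] 0) l ↔ Tendsto f (𝓝[>] 0) l := by
  constructor
  · intro h
    have h1 : Tendsto Real.toNNReal (𝓝[>] 0) (𝓝[>] 0) := by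
      refine tendsto_nhdsWithin_iff.2 ⟨?_, ?_⟩
      · have := (continuous_real_toNNReal.tendsto (0 : ℝ)).mono_left
          (nhdsWithin_le_nhds (s := Ioi 0))
        simpa using this
      · filter_upwards [self_mem_nhdsWithin] with t ht
        simpa using ht
    refine (h.comp h1).congr' ?_
    filter_upwards [self_mem_nhdsWithin] with t ht
    simp [Real.coe_toNNReal t (le_of_lt ht)]
  · intro h
    refine h.comp (tendsto_nhdsWithin_iff.2 ⟨?_, ?_⟩)
    · exact (NNReal.continuous_coe.tendsto' 0 0 NNReal.coe_zero).mono_left nhdsWithin_le_nhds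
    · filter_upwards [self_mem_nhdsWithin] with t ht
      simpa using ht

theorem C0Semigroup.hasGenerator_iff [NormedSpace ℝ H] [IsScalarTower ℝ 𝕜 H]
    (S : C0Semigroup 𝕜 H) (x y : H) :
    S.HasGenerator x y ↔
      HasDerivWithinAt (fun t : ℝ => S.toFun t.toNNReal x) y (Ioi 0) 0 := by
  rw [hasDerivWithinAt_iff_tendsto_slope' (by simp), ← tendsto_nnreal_iff_tendsto_real]
  unfold C0Semigroup.HasGenerator
  refine tendsto_congr fun t => ?_
  simp only [slope_def_module, sub_zero, Real.toNNReal_coe, Real.toNNReal_zero, S.map_zero,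
    ContinuousLinearMap.id_apply]
  rw [← RCLike.ofReal_inv, RCLike.real_smul_eq_coe_smul (K := 𝕜)]

theorem C0Semigroup.HasGenerator.mem {S : C0Semigroup 𝕜 H} {x y : H}
    (h : S.HasGenerator x y) : x ∈ S.generator.domain := ⟨y, h⟩

theorem C0Semigroup.HasGenerator.generator_eq {S : C0Semigroup 𝕜 H} {x y : H}
    (h : S.HasGenerator x y) (hx : x ∈ S.generator.domain) : S.generator ⟨x, hx⟩ = y :=
  (S.generator_spec ⟨x, hx⟩).unique h

theorem intervalIntegral_inner [CompleteSpace H] [NormedSpace ℝ H] {f : ℝ → H} {a b : ℝ} (φ : H)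
    (hf : IntervalIntegrable f volume a b) :
    ∫ s in a..b, inner 𝕜 φ (f s) = inner 𝕜 φ (∫ s in a..b, f s) :=
  ContinuousLinearMap.intervalIntegral_comp_comm (innerSL 𝕜 φ) hf

namespace C0Group

variable (S : C0Group 𝕜 H)

theorem hasGenerator_generator (x : S.generator.domain) :
    S.toC0Semigroup.HasGenerator (x : H) (S.generator x) :=
  S.toC0Semigroup.generator_spec x

theorem apply_add (s t : ℝ) (x : H) : S.toFun (s + t) x = S.toFun s (S.toFun t x) := by
  rw [S.map_add]; rfl

theorem apply_apply_neg (t : ℝ) (x : H) : S.toFun t (S.toFun (-t) x) = x := by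
  rw [← S.apply_add]; simp [S.map_zero]

theorem continuous_orbit (x : H) : Continuous fun t => S.toFun t x := by
  refine continuous_iff_continuousAt.2 fun t => ?_
  have h1 : Tendsto (fun s : ℝ => s - t) (𝓝 t) (𝓝 0) := by
    have : Continuous fun s : ℝ => s - t := by fun_prop
    simpa using this.tendsto t
  have h2 := ((S.toFun t).continuous.tendsto _).comp ((S.tendsto_zero x).comp h1)
  refine h2.congr fun s => ?_
  simp only [Function.comp_apply]
  rw [← S.apply_add]; congr 2; ring

variable [CompleteSpace H]

theorem exists_bound (T : ℝ) : ∃ M : ℝ, 0 < M ∧ ∀ t ∈ Icc (-T) T, ‖S.toFun t‖ ≤ M := by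
  obtain ⟨C, hC⟩ := banach_steinhaus (g := fun t : Icc (-T) T => S.toFun t) fun x => by
    obtain ⟨C, hC⟩ := isCompact_Icc.exists_bound_of_continuousOn (s := Icc (-T) T)
      (S.continuous_orbit x).continuousOn
    exact ⟨C, fun i => hC i i.2⟩
  exact ⟨max C 1, by positivity, fun t ht => (hC ⟨t, ht⟩).trans (le_max_left _ _)⟩

/-- Strong continuity becomes joint continuity because the operators are uniformly bounded on
compact time intervals. -/
theorem continuous_apply : Continuous fun p : ℝ × H => S.toFun p.1 p.2 := by
  refine continuous_iff_continuousAt.2 fun ⟨t, x⟩ => ?_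
  obtain ⟨M, hM, hb⟩ := S.exists_bound (|t| + 1)
  have h1 : Tendsto (fun p : ℝ × H => S.toFun p.1 x) (𝓝 (t, x)) (𝓝 (S.toFun t x)) :=
    ((S.continuous_orbit x).comp continuous_fst).tendsto (t, x)
  have h2 : Tendsto (fun p : ℝ × H => S.toFun p.1 (p.2 - x)) (𝓝 (t, x)) (𝓝 0) := by
    have h3 : Tendsto (fun p : ℝ × H => M * ‖p.2 - x‖) (𝓝 (t, x)) (𝓝 0) := by
      have : Continuous fun p : ℝ × H => M * ‖p.2 - x‖ := by fun_prop
      simpa using this.tendsto (t, x)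
    refine squeeze_zero_norm' ?_ h3
    have h4 : ∀ᶠ p : ℝ × H in 𝓝 (t, x), |p.1| < |t| + 1 :=
      (continuous_abs.comp continuous_fst).tendsto (t, x) |>.eventually
        (gt_mem_nhds (by simp))
    filter_upwards [h4] with p hp
    exact (ContinuousLinearMap.le_opNorm _ _).trans (mul_le_mul_of_nonneg_right
      (hb _ (abs_le.1 hp.le)) (norm_nonneg _))
  have h5 := h1.add h2
  simpa [ContinuousAt] using h5

theorem continuous_comp {X : Type*} [TopologicalSpace X] {f : X → ℝ} {g : X → H}
    (hf : Continuous f) (hg : Continuous g) : Continuous fun x => S.toFun (f x) (g x) :=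
  S.continuous_apply.comp (hf.prodMk hg)

theorem continuousOn_comp {X : Type*} [TopologicalSpace X] {f : X → ℝ} {g : X → H} {s : Set X}
    (hf : ContinuousOn f s) (hg : ContinuousOn g s) :
    ContinuousOn (fun x => S.toFun (f x) (g x)) s :=
  S.continuous_apply.comp_continuousOn (hf.prodMk hg)

theorem exists_growth : ∃ M ω : ℝ, 0 < M ∧ 0 ≤ ω ∧
    ∀ t, 0 ≤ t → ‖S.toFun t‖ ≤ M * Real.exp (ω * t) := by
  obtain ⟨M₀, hM₀, hb₀⟩ := S.exists_bound 1
  set M := max M₀ 1 with hMdef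
  have hM1 : 1 ≤ M := le_max_right _ _
  have hb : ∀ t ∈ Icc (-1 : ℝ) 1, ‖S.toFun t‖ ≤ M := fun t ht => (hb₀ t ht).trans (le_max_left _ _)
  -- A time `t ≥ 0` is written as `n + r` with `r ∈ [0, 1]`. Each unit of time costs a factor `M ≥
  -- 1`, whence the growth rate `log M`.
  have key : ∀ n : ℕ, ∀ r ∈ Icc (0 : ℝ) 1, ‖S.toFun (n + r)‖ ≤ M * M ^ n := by
    intro n r hr
    induction n with
    | zero => simpa using hb r ⟨by linarith [hr.1], hr.2⟩
    | succ n ih =>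
      have : S.toFun (((n + 1 : ℕ) : ℝ) + r) = (S.toFun 1).comp (S.toFun (n + r)) := by
        rw [← S.map_add]; congr 1; push_cast; ring
      rw [this]
      refine (ContinuousLinearMap.opNorm_comp_le _ _).trans ?_
      calc ‖S.toFun 1‖ * ‖S.toFun (n + r)‖ ≤ M * (M * M ^ n) :=
            mul_le_mul (hb 1 (by simp)) ih (norm_nonneg _) (by positivity)
        _ = M * M ^ (n + 1) := by ring
  refine ⟨M, Real.log M, by positivity, Real.log_nonneg hM1, fun t ht => ?_⟩
  have h1 := key ⌊t⌋₊ (t - ⌊t⌋₊) ⟨by linarith [Nat.floor_le ht],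
    by linarith [Nat.lt_floor_add_one t]⟩
  rw [add_sub_cancel] at h1
  refine h1.trans (mul_le_mul_of_nonneg_left ?_ (by positivity))
  rw [← Real.exp_log (show 0 < M ^ ⌊t⌋₊ by positivity), Real.log_pow]
  refine Real.exp_le_exp.2 ?_
  rw [mul_comm]
  exact mul_le_mul_of_nonneg_left (Nat.floor_le ht) (Real.log_nonneg hM1)

variable [NormedSpace ℝ H] [IsScalarTower ℝ 𝕜 H]

/-- For a group, the one-sided limit that defines the generator is automatically two-sided. -/
theorem hasGenerator_iff (x y : H) :
    S.toC0Semigroup.HasGenerator x y ↔ HasDerivAt (fun t => S.toFun t x) y 0 := by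
  have h0 : HasDerivWithinAt (fun t : ℝ => S.toC0Semigroup.toFun t.toNNReal x) y (Ioi 0) 0 ↔
      HasDerivWithinAt (fun t : ℝ => S.toFun t x) y (Ioi 0) 0 := by
    have h1 : ∀ t ∈ Ici (0 : ℝ), S.toC0Semigroup.toFun t.toNNReal x = S.toFun t x := by
      intro t ht
      simp [C0Group.toC0Semigroup, Real.coe_toNNReal t ht]
    exact ⟨fun h => h.congr (fun t ht => (h1 t (mem_Ici.2 (le_of_lt ht))).symm)
      (h1 0 (by simp)).symm,
      fun h => h.congr (fun t ht => h1 t (mem_Ici.2 (le_of_lt ht))) (h1 0 (by simp))⟩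
  rw [C0Semigroup.hasGenerator_iff, h0]
  refine ⟨fun h => ?_, fun h => h.hasDerivWithinAt⟩
  rw [hasDerivAt_iff_tendsto_slope_left_right]
  rw [hasDerivWithinAt_iff_tendsto_slope' (by simp)] at h
  refine ⟨?_, h⟩
  -- For `t < 0` the difference quotient at `t` is `S(t)` applied to the one at `-t > 0`; joint
  -- continuity passes to the limit.
  have hneg : Tendsto (fun t : ℝ => -t) (𝓝[<] 0) (𝓝[>] 0) := by
    simpa using tendsto_neg_nhdsLT (a := (0 : ℝ))
  have h2 : Tendsto (fun t : ℝ => (t, slope (fun s => S.toFun s x) 0 (-t))) (𝓝[<] 0)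
      (𝓝 (0, y)) :=
    Tendsto.prodMk_nhds (tendsto_id.mono_left nhdsWithin_le_nhds) (h.comp hneg)
  have h3 := (S.continuous_apply.tendsto (0, y)).comp h2
  simp only [S.map_zero, ContinuousLinearMap.id_apply] at h3
  refine h3.congr fun t => ?_
  simp only [Function.comp_apply, slope_def_module, sub_zero, S.map_zero,
    ContinuousLinearMap.id_apply]
  rw [RCLike.real_smul_eq_coe_smul (K := 𝕜), map_smul, map_sub, S.apply_apply_neg,
    RCLike.real_smul_eq_coe_smul (K := 𝕜), inv_neg, RCLike.ofReal_neg, neg_smul, ← smul_neg,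
    neg_sub]

theorem hasDerivAt_orbit {x y : H} (h : S.toC0Semigroup.HasGenerator x y) (t : ℝ) :
    HasDerivAt (fun s => S.toFun s x) (S.toFun t y) t := by
  rw [hasGenerator_iff] at h
  have h1 : HasDerivAt (fun s => S.toFun (s - t) x) y t := by
    have := HasDerivAt.comp_sub_const t t (f := fun s => S.toFun s x) (f' := y) (by simpa using h)
    exact this
  have h2 : HasDerivAt (fun s => ((S.toFun t).restrictScalars ℝ) (S.toFun (s - t) x))
      (((S.toFun t).restrictScalars ℝ) y) t :=
    ((S.toFun t).restrictScalars ℝ).hasFDerivAt.comp_hasDerivAt t h1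
  refine h2.congr_of_eventuallyEq (Eventually.of_forall fun s => ?_)
  change S.toFun s x = S.toFun t (S.toFun (s - t) x)
  rw [← S.apply_add]; congr 2; ring

/-- Applying `S(t)` to `∫₀ᵃ S(s) x ds` shifts the interval of integration to `[t, a + t]`, and only
the endpoints contribute to the derivative. This makes the means smoothing operators. -/
theorem hasGenerator_integral (x : H) (a : ℝ) :
    S.toC0Semigroup.HasGenerator (∫ s in (0 : ℝ)..a, S.toFun s x) (S.toFun a x - x) := by
  rw [hasGenerator_iff]
  have hc := S.continuous_orbit x
  have h1 : ∀ t, S.toFun t (∫ s in (0 : ℝ)..a, S.toFun s x) =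
      (∫ s in (0 : ℝ)..(a + t), S.toFun s x) - ∫ s in (0 : ℝ)..t, S.toFun s x := by
    intro t
    rw [← ContinuousLinearMap.intervalIntegral_comp_comm _ (hc.intervalIntegrable _ _)]
    simp_rw [← S.apply_add]
    rw [intervalIntegral.integral_interval_sub_left (hc.intervalIntegrable _ _)
      (hc.intervalIntegrable _ _)]
    rw [intervalIntegral.integral_comp_add_left (fun s => S.toFun s x), add_zero, add_comm]
  have hd : ∀ b, HasDerivAt (fun u => ∫ s in (0 : ℝ)..u, S.toFun s x) (S.toFun b x) b :=
    fun b => intervalIntegral.integral_hasDerivAt_right (hc.intervalIntegrable _ _)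
      (hc.stronglyMeasurableAtFilter _ _) hc.continuousAt
  have h2 : HasDerivAt (fun t => ∫ s in (0 : ℝ)..(a + t), S.toFun s x) (S.toFun a x) 0 := by
    have := HasDerivAt.comp_const_add a 0 (f := fun u => ∫ s in (0 : ℝ)..u, S.toFun s x)
      (f' := S.toFun a x) (by simpa using hd a)
    exact this
  have h3 := h2.sub (hd 0)
  simp only [S.map_zero, ContinuousLinearMap.id_apply] at h3
  exact h3.congr_of_eventuallyEq (Eventually.of_forall h1)

/-- The mean `ε⁻¹ ∫₀^ε S(s) ds`. -/
def mean (ε : ℝ) : H →L[𝕜] H :=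
  LinearMap.mkContinuous
    { toFun := fun x => ε⁻¹ • ∫ s in (0 : ℝ)..ε, S.toFun s x
      map_add' := fun x y => by
        simp only [_root_.map_add]
        rw [intervalIntegral.integral_add ((S.continuous_orbit x).intervalIntegrable _ _)
          ((S.continuous_orbit y).intervalIntegrable _ _), smul_add]
      map_smul' := fun c x => by
        simp only [map_smul, RingHom.id_apply]
        rw [intervalIntegral.integral_smul, smul_comm] }
    (S.exists_bound |ε|).choose fun x => by
      obtain ⟨hM, hb⟩ := (S.exists_bound |ε|).choose_spec
      set M := (S.exists_bound |ε|).choose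
      change ‖ε⁻¹ • ∫ s in (0 : ℝ)..ε, S.toFun s x‖ ≤ _
      have h1 : ‖∫ s in (0 : ℝ)..ε, S.toFun s x‖ ≤ M * ‖x‖ * |ε - 0| := by
        refine intervalIntegral.norm_integral_le_of_norm_le_const fun s hs => ?_
        refine (ContinuousLinearMap.le_opNorm _ _).trans (mul_le_mul_of_nonneg_right
          (hb _ ?_) (norm_nonneg _))
        rcases le_total 0 ε with h | h
        · rw [uIoc_of_le h] at hs
          rw [abs_of_nonneg h]; constructor <;> linarith [hs.1, hs.2]
        · rw [uIoc_of_ge h] at hs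
          rw [abs_of_nonpos h]; constructor <;> linarith [hs.1, hs.2]
      rw [norm_smul, norm_inv, Real.norm_eq_abs]
      rw [sub_zero] at h1
      rcases eq_or_ne ε 0 with h | h
      · subst h; simp; positivity
      · calc |ε|⁻¹ * ‖∫ s in (0 : ℝ)..ε, S.toFun s x‖ ≤ |ε|⁻¹ * (M * ‖x‖ * |ε|) := by gcongr
          _ = M * ‖x‖ := by
            have : |ε| ≠ 0 := abs_ne_zero.2 h
            field_simp

theorem mean_apply (ε : ℝ) (x : H) : S.mean ε x = ε⁻¹ • ∫ s in (0 : ℝ)..ε, S.toFun s x := rfl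

theorem hasGenerator_mean (ε : ℝ) (x : H) :
    S.toC0Semigroup.HasGenerator (S.mean ε x) (ε⁻¹ • (S.toFun ε x - x)) := by
  have := (S.hasGenerator_integral x ε).smul ((ε⁻¹ : ℝ) : 𝕜)
  rwa [← RCLike.real_smul_eq_coe_smul, ← RCLike.real_smul_eq_coe_smul] at this

theorem mean_comm (ε t : ℝ) (x : H) : S.mean ε (S.toFun t x) = S.toFun t (S.mean ε x) := by
  rw [mean_apply, mean_apply, RCLike.real_smul_eq_coe_smul (K := 𝕜),
    RCLike.real_smul_eq_coe_smul (K := 𝕜), map_smul,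
    ← ContinuousLinearMap.intervalIntegral_comp_comm _
      ((S.continuous_orbit x).intervalIntegrable _ _)]
  simp_rw [← S.apply_add, add_comm t]

theorem tendsto_mean (x : H) : Tendsto (fun ε => S.mean ε x) (𝓝[≠] 0) (𝓝 x) := by
  have hc := S.continuous_orbit x
  have hd : HasDerivAt (fun u => ∫ s in (0 : ℝ)..u, S.toFun s x) (S.toFun 0 x) 0 :=
    intervalIntegral.integral_hasDerivAt_right (hc.intervalIntegrable _ _)
      (hc.stronglyMeasurableAtFilter _ _) hc.continuousAt
  rw [hasDerivAt_iff_tendsto_slope, S.map_zero] at hd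
  refine hd.congr fun ε => ?_
  simp [slope_def_module, mean_apply]

theorem norm_mean_le {T M : ℝ} (hM : ∀ t ∈ Icc (-T) T, ‖S.toFun t‖ ≤ M) {ε : ℝ} (h0 : 0 < ε)
    (hT : ε ≤ T) (x : H) : ‖S.mean ε x‖ ≤ M * ‖x‖ := by
  have h1 : ‖∫ s in (0 : ℝ)..ε, S.toFun s x‖ ≤ M * ‖x‖ * |ε - 0| := by
    refine intervalIntegral.norm_integral_le_of_norm_le_const fun s hs => ?_
    rw [uIoc_of_le h0.le] at hs
    exact (ContinuousLinearMap.le_opNorm _ _).trans (mul_le_mul_of_nonneg_right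
      (hM _ ⟨by linarith [hs.1], by linarith [hs.2]⟩) (norm_nonneg _))
  rw [sub_zero, abs_of_pos h0] at h1
  rw [mean_apply, norm_smul, norm_inv, Real.norm_of_nonneg h0.le]
  calc ε⁻¹ * ‖∫ s in (0 : ℝ)..ε, S.toFun s x‖ ≤ ε⁻¹ * (M * ‖x‖ * ε) := by gcongr
    _ = M * ‖x‖ := by field_simp

theorem dense_domain : Dense (S.generator.domain : Set H) := by
  intro x
  refine mem_closure_of_tendsto (S.tendsto_mean x) (Eventually.of_forall fun ε => ?_)
  exact (S.hasGenerator_mean ε x).mem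

theorem apply_sub_eq_integral {x y : H} (h : S.toC0Semigroup.HasGenerator x y) (t : ℝ) :
    S.toFun t x - x = ∫ s in (0 : ℝ)..t, S.toFun s y := by
  rw [intervalIntegral.integral_eq_sub_of_hasDerivAt (f := fun s => S.toFun s x)
    (fun s _ => S.hasDerivAt_orbit h s) ((S.continuous_orbit y).intervalIntegrable _ _)]
  simp [S.map_zero]

/-- The orbit increment of the adjoint, tested against the domain of the generator. -/
theorem inner_adjoint_apply_sub {x y : H}
    (h : ∀ φ ψ : H, S.toC0Semigroup.HasGenerator φ ψ → inner 𝕜 ψ x = -inner 𝕜 φ y) (t : ℝ)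
    (φ : H) :
    inner 𝕜 (S.toFun (-t) φ) x - inner 𝕜 φ x = ∫ s in (0 : ℝ)..t, inner 𝕜 (S.toFun (-s) φ) y := by
  have hcc : ∀ z : H, Continuous fun p : ℝ × H => inner 𝕜 (S.toFun (-p.1) p.2) z := fun z =>
    (S.continuous_comp (continuous_fst.neg) continuous_snd).inner continuous_const
  have hclosed : IsClosed {φ : H | inner 𝕜 (S.toFun (-t) φ) x - inner 𝕜 φ x =
      ∫ s in (0 : ℝ)..t, inner 𝕜 (S.toFun (-s) φ) y} := by
    refine isClosed_eq ?_ ?_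
    · exact ((S.toFun (-t)).continuous.inner continuous_const).sub
        (continuous_id.inner continuous_const)
    · exact intervalIntegral.continuous_parametric_intervalIntegral_of_continuous'
        (f := fun φ s => inner 𝕜 (S.toFun (-s) φ) y)
        ((hcc y).comp continuous_swap) 0 t
  -- Both sides are continuous in `φ`, so it is enough to test with the dense domain of `A`, where
  -- the orbit can be differentiated.
  suffices hsub : (S.generator.domain : Set H) ⊆ {φ : H | inner 𝕜 (S.toFun (-t) φ) x -
      inner 𝕜 φ x = ∫ s in (0 : ℝ)..t, inner 𝕜 (S.toFun (-s) φ) y} from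
    hclosed.closure_subset_iff.2 hsub (S.dense_domain φ)
  · rintro φ ⟨ψ, hφ⟩
    have hd : ∀ s ∈ uIcc 0 t, HasDerivAt (fun s => inner 𝕜 (S.toFun (-s) φ) x)
        (inner 𝕜 (S.toFun (-s) φ) y) s := by
      intro s _
      have h1 : HasDerivAt (fun s => S.toFun (-s) φ) (-S.toFun (-s) ψ) s := by
        have := (S.hasDerivAt_orbit hφ (-s)).scomp s (hasDerivAt_neg s)
        rwa [neg_one_smul] at this
      have h2 := h1.inner 𝕜 (hasDerivAt_const s x)
      simp only [inner_zero_right, zero_add, inner_neg_left] at h2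
      rw [h _ _ (S.hasGenerator_map (-s) ⟨φ, ⟨ψ, hφ⟩⟩ |> fun h' => by
        rwa [show S.generator ⟨φ, ⟨ψ, hφ⟩⟩ = ψ from hφ.generator_eq _] at h'), neg_neg] at h2
      exact h2
    have := intervalIntegral.integral_eq_sub_of_hasDerivAt hd
      (((hcc y).comp (continuous_id.prodMk continuous_const)).intervalIntegrable _ _)
    simp only [neg_zero, S.map_zero, ContinuousLinearMap.id_apply] at this
    exact this.symm

/-- The set of `x` in the domain of the adjoint of the generator is dense. -/
theorem dense_adjoint : Dense {x : H | ∃ y, ∀ φ ψ : H, S.toC0Semigroup.HasGenerator φ ψ →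
    inner 𝕜 ψ x = -inner 𝕜 φ y} := by
  let D : Submodule 𝕜 H :=
    { carrier := {x : H | ∃ y, ∀ φ ψ : H, S.toC0Semigroup.HasGenerator φ ψ →
        inner 𝕜 ψ x = -inner 𝕜 φ y}
      zero_mem' := ⟨0, by simp⟩
      add_mem' := by
        rintro a b ⟨y, hy⟩ ⟨z, hz⟩
        refine ⟨y + z, fun φ ψ h => ?_⟩
        rw [inner_add_right, inner_add_right, hy φ ψ h, hz φ ψ h]; ring
      smul_mem' := by
        rintro c a ⟨y, hy⟩
        refine ⟨c • y, fun φ ψ h => ?_⟩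
        rw [inner_smul_right, inner_smul_right, hy φ ψ h]; ring }
  change Dense (D : Set H)
  rw [Submodule.dense_iff_topologicalClosure_eq_top, Submodule.topologicalClosure_eq_top_iff,
    Submodule.eq_bot_iff]
  intro w hw
  -- The adjoint of a mean maps `H` into `D(A*)`, because `A` composed with the mean is bounded. A
  -- vector orthogonal to `D(A*)` is therefore killed by every mean, hence by their limit, the
  -- identity.
  have h1 : ∀ ε, S.mean ε w = 0 := by
    intro ε
    have h2 : ∀ x, inner 𝕜 (S.mean ε w) x = 0 := by
      intro x
      rw [← ContinuousLinearMap.adjoint_inner_right]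
      refine Submodule.inner_left_of_mem_orthogonal (K := D) ?_ hw
      refine ⟨-ContinuousLinearMap.adjoint (((ε⁻¹ : ℝ) : 𝕜) • (S.toFun ε -
        ContinuousLinearMap.id 𝕜 H)) x, fun φ ψ h => ?_⟩
      rw [inner_neg_right, neg_neg, ContinuousLinearMap.adjoint_inner_right,
        ContinuousLinearMap.adjoint_inner_right]
      congr 1
      rw [mean_apply, ← S.apply_sub_eq_integral h]
      simp [RCLike.real_smul_eq_coe_smul (K := 𝕜)]
    have := h2 (S.mean ε w)
    rwa [inner_self_eq_zero] at this
  have h3 := S.tendsto_mean w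
  simp only [h1] at h3
  exact (tendsto_nhds_unique h3 tendsto_const_nhds)

/-- For `x ∈ D(A*)`, pairing the increment `z` of the adjoint orbit with itself gives `‖z‖² ≤ M ‖z‖
‖A* x‖ |t|`, a Lipschitz bound. Density of `D(A*)` and the local bound on the operators extend
continuity to all of `H`. -/
theorem continuous_adjoint (x : H) :
    Tendsto (fun t => ContinuousLinearMap.adjoint (S.toFun (-t)) x) (𝓝 0) (𝓝 x) := by
  obtain ⟨M, hM, hb⟩ := S.exists_bound 1
  have hb' : ∀ t ∈ Icc (-1 : ℝ) 1, ‖ContinuousLinearMap.adjoint (S.toFun (-t))‖ ≤ M := by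
    intro t ht
    rw [LinearIsometryEquiv.norm_map]
    exact hb _ ⟨by linarith [ht.2], by linarith [ht.1]⟩
  have hnhds : ∀ᶠ t : ℝ in 𝓝 0, t ∈ Icc (-1 : ℝ) 1 := Icc_mem_nhds (by norm_num) (by norm_num)
  have hdom : ∀ x ∈ {x : H | ∃ y, ∀ φ ψ : H, S.toC0Semigroup.HasGenerator φ ψ →
      inner 𝕜 ψ x = -inner 𝕜 φ y},
      Tendsto (fun t => ContinuousLinearMap.adjoint (S.toFun (-t)) x) (𝓝 0) (𝓝 x) := by
    rintro x ⟨y, hy⟩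
    rw [tendsto_iff_norm_sub_tendsto_zero]
    have h3 : Tendsto (fun t : ℝ => M * ‖y‖ * |t|) (𝓝 0) (𝓝 0) := by
      have : Continuous fun t : ℝ => M * ‖y‖ * |t| := by fun_prop
      simpa using this.tendsto 0
    refine squeeze_zero' (Eventually.of_forall fun t => norm_nonneg _) ?_ h3
    filter_upwards [hnhds] with t ht
    set z := ContinuousLinearMap.adjoint (S.toFun (-t)) x - x with hz
    have h4 : inner 𝕜 z z = ∫ s in (0 : ℝ)..t, inner 𝕜 (S.toFun (-s) z) y := by
      rw [← S.inner_adjoint_apply_sub hy t z, ← ContinuousLinearMap.adjoint_inner_right,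
        ← inner_sub_right]
    have h5 : ‖∫ s in (0 : ℝ)..t, inner 𝕜 (S.toFun (-s) z) y‖ ≤ M * ‖z‖ * ‖y‖ * |t - 0| := by
      refine intervalIntegral.norm_integral_le_of_norm_le_const fun s hs => ?_
      refine (norm_inner_le_norm _ _).trans (mul_le_mul_of_nonneg_right
        ((ContinuousLinearMap.le_opNorm _ _).trans (mul_le_mul_of_nonneg_right
          (hb _ ?_) (norm_nonneg _))) (norm_nonneg _))
      rcases le_total 0 t with h | h
      · rw [uIoc_of_le h] at hs
        constructor <;> linarith [hs.1, hs.2, ht.2]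
      · rw [uIoc_of_ge h] at hs
        constructor <;> linarith [hs.1, hs.2, ht.1]
    rw [← h4, inner_self_eq_norm_sq_to_K, norm_pow, RCLike.norm_ofReal, abs_norm, sub_zero] at h5
    by_cases h0 : ‖z‖ = 0
    · rw [h0]; positivity
    · have h6 : 0 < ‖z‖ := lt_of_le_of_ne (norm_nonneg _) (Ne.symm h0)
      refine le_of_mul_le_mul_left ?_ h6
      linarith [h5]
  rw [Metric.tendsto_nhds]
  intro ε hε
  obtain ⟨x', hx', hd⟩ := Metric.mem_closure_iff.1 (S.dense_adjoint x) (ε / (2 * (M + 1)))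
    (by positivity)
  have h7 := (Metric.tendsto_nhds.1 (hdom x' hx')) (ε / 2) (by positivity)
  filter_upwards [h7, hnhds] with t ht ht'
  rw [dist_eq_norm] at hd ht ⊢
  have h8 : ContinuousLinearMap.adjoint (S.toFun (-t)) x - x =
      ContinuousLinearMap.adjoint (S.toFun (-t)) (x - x') +
      (ContinuousLinearMap.adjoint (S.toFun (-t)) x' - x') - (x - x') := by
    rw [map_sub]; abel
  have h9 : ‖ContinuousLinearMap.adjoint (S.toFun (-t)) (x - x')‖ ≤ M * ‖x - x'‖ :=
    (ContinuousLinearMap.le_opNorm _ _).trans (mul_le_mul_of_nonneg_right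
      (hb' t ht') (norm_nonneg _))
  have h10 : (M + 1) * ‖x - x'‖ < ε / 2 := by
    rw [lt_div_iff₀ (by positivity)] at hd
    linarith
  rw [h8]
  refine (norm_sub_le _ _).trans_lt ?_
  have := norm_add_le (ContinuousLinearMap.adjoint (S.toFun (-t)) (x - x'))
    (ContinuousLinearMap.adjoint (S.toFun (-t)) x' - x')
  linarith

end C0Group

variable [CompleteSpace H] [NormedSpace ℝ H] [IsScalarTower ℝ 𝕜 H]

namespace C0Group

/-- The group `(S(-t)*)_{t ∈ ℝ}`, whose generator is `-A*`. -/
def adjGroup (S : C0Group 𝕜 H) : C0Group 𝕜 H where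
  toFun t := ContinuousLinearMap.adjoint (S.toFun (-t))
  map_zero := by
    rw [neg_zero, S.map_zero]
    exact ContinuousLinearMap.adjoint_id
  map_add s t := by
    rw [← ContinuousLinearMap.adjoint_comp, ← S.map_add, neg_add_rev]
  tendsto_zero x := S.continuous_adjoint x

variable (S : C0Group 𝕜 H)

theorem adjGroup_toFun (t : ℝ) :
    S.adjGroup.toFun t = ContinuousLinearMap.adjoint (S.toFun (-t)) := rfl

theorem adjGroup_inner_right (t : ℝ) (x y : H) :
    inner 𝕜 x (S.adjGroup.toFun t y) = inner 𝕜 (S.toFun (-t) x) y :=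
  ContinuousLinearMap.adjoint_inner_right _ _ _

theorem adjGroup_adjGroup : S.adjGroup.adjGroup = S := by
  have : S.adjGroup.adjGroup.toFun = S.toFun := by
    funext t
    simp [adjGroup_toFun]
  cases h : S.adjGroup.adjGroup
  cases S
  simp_all

/-- The generator of the adjoint group is `-A*`, characterised by duality. In the harder direction,
the weak identity integrates to `S(-t)* x = x + ∫₀ᵗ S(-s)* y ds`, which is then differentiated
strongly at zero. Applied to the adjoint group itself, it gives the membership test for `D(A) =
D(A**)` used below. -/
theorem hasGenerator_adjGroup_iff (x y : H) :
    S.adjGroup.toC0Semigroup.HasGenerator x y ↔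
      ∀ φ ψ : H, S.toC0Semigroup.HasGenerator φ ψ → inner 𝕜 ψ x = -inner 𝕜 φ y := by
  constructor
  · intro h φ ψ hφ
    have h1 : HasDerivAt (fun t => inner 𝕜 (S.toFun (-t) φ) x) (-inner 𝕜 ψ x) 0 := by
      have h2 := (S.hasDerivAt_orbit hφ (-0)).scomp (0 : ℝ) (hasDerivAt_neg (0 : ℝ))
      have h3 := HasDerivAt.inner 𝕜 h2 (hasDerivAt_const (0 : ℝ) x)
      simpa [S.map_zero] using h3
    have h2 : HasDerivAt (fun t => inner 𝕜 φ (S.adjGroup.toFun t x)) (inner 𝕜 φ y) 0 := by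
      have h3 := HasDerivAt.inner 𝕜 (hasDerivAt_const (0 : ℝ) φ)
        ((S.adjGroup.hasGenerator_iff x y).1 h)
      simpa using h3
    simp only [adjGroup_inner_right] at h2
    rw [← h1.unique h2, neg_neg]
  · intro h
    rw [hasGenerator_iff]
    have hc := S.adjGroup.continuous_orbit y
    have h1 : ∀ t, S.adjGroup.toFun t x = x + ∫ s in (0 : ℝ)..t, S.adjGroup.toFun s y := by
      intro t
      refine ext_inner_left 𝕜 fun φ => ?_
      have h2 := S.inner_adjoint_apply_sub h t φ
      rw [inner_add_right, ← intervalIntegral_inner φ (hc.intervalIntegrable _ _)]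
      simp only [adjGroup_inner_right]
      rw [← h2]; ring
    have hd : HasDerivAt (fun u => ∫ s in (0 : ℝ)..u, S.adjGroup.toFun s y)
        (S.adjGroup.toFun 0 y) 0 :=
      intervalIntegral.integral_hasDerivAt_right (hc.intervalIntegrable _ _)
        (hc.stronglyMeasurableAtFilter _ _) hc.continuousAt
    rw [S.adjGroup.map_zero] at hd
    exact (hd.const_add x).congr_of_eventuallyEq (Eventually.of_forall h1)

theorem hasGenerator_of_adjGroup {x y : H}
    (h : ∀ φ ψ : H, S.adjGroup.toC0Semigroup.HasGenerator φ ψ → inner 𝕜 ψ x = -inner 𝕜 φ y) :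
    S.toC0Semigroup.HasGenerator x y := by
  have := (S.adjGroup.hasGenerator_adjGroup_iff x y).2 h
  rwa [adjGroup_adjGroup] at this

/-- This and the next lemma identify the generator of the adjoint group with minus the adjoint of
`A` as a partially defined operator. -/
theorem hasGenerator_adjGen (x : S.adjGen.domain) :
    S.adjGroup.toC0Semigroup.HasGenerator (x : H) (-S.adjGen x) := by
  rw [hasGenerator_adjGroup_iff]
  rintro φ ψ hφ
  have h1 := LinearPMap.adjoint_isFormalAdjoint (T := S.generator) S.dense_domain x ⟨φ, hφ.mem⟩
  have h2 : S.generator ⟨φ, hφ.mem⟩ = ψ := hφ.generator_eq _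
  rw [h2] at h1
  have h3 := congrArg (starRingEnd 𝕜) h1
  rw [inner_conj_symm, inner_conj_symm] at h3
  rw [inner_neg_right, neg_neg]
  exact h3.symm

theorem adjGen_of_hasGenerator {x y : H} (h : S.adjGroup.toC0Semigroup.HasGenerator x y) :
    ∃ hx : x ∈ S.adjGen.domain, S.adjGen ⟨x, hx⟩ = -y := by
  rw [hasGenerator_adjGroup_iff] at h
  have h1 : ∀ z : S.generator.domain, inner 𝕜 (-y) (z : H) = inner 𝕜 x (S.generator z) := by
    intro z
    have h2 := congrArg (starRingEnd 𝕜) (h _ _ (S.hasGenerator_generator z))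
    rw [map_neg, inner_conj_symm, inner_conj_symm] at h2
    rw [inner_neg_left, h2]
  have hx : x ∈ S.adjGen.domain := LinearPMap.mem_adjoint_domain_of_exists x ⟨-y, h1⟩
  exact ⟨hx, LinearPMap.adjoint_apply_eq S.dense_domain ⟨x, hx⟩ h1⟩

theorem dense_adjGen_domain : Dense (S.adjGen.domain : Set H) := by
  refine S.adjGroup.dense_domain.mono fun x hx => ?_
  obtain ⟨y, hy⟩ := hx
  exact (S.adjGen_of_hasGenerator hy).1

end C0Group

end Groups

/-! ### Distributional derivatives on an interval -/

section Distributions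

variable {𝕜 : Type*} [RCLike 𝕜]

theorem integrableOn_testFunction_mul {T : ℝ} {h : ℝ → ℝ} {g : ℝ → 𝕜} (hc : Continuous h)
    (hs : HasCompactSupport h) (hT : tsupport h ⊆ Ioo 0 T) (hg : LocallyIntegrableOn g (Ioo 0 T)) :
    IntegrableOn (fun t => ((h t : ℝ) : 𝕜) * g t) (Ioo 0 T) := by
  have h1 : IntegrableOn g (tsupport h) := hg.integrableOn_compact_subset hT hs
  have h2 : IntegrableOn (fun t => ((h t : ℝ) : 𝕜) * g t) (tsupport h) :=
    h1.continuousOn_mul (RCLike.continuous_ofReal.comp hc).continuousOn hs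
  rw [integrableOn_iff_integrable_of_support_subset] at h2
  · exact h2.integrableOn
  · intro t ht
    refine subset_tsupport h ?_
    intro h0
    exact ht (by simp [h0])

/-- The function `(η f)' = η' f + η g` extends by zero to the line and has integral zero there. -/
theorem distribDeriv_of_hasDerivAt {T : ℝ} {f g : ℝ → 𝕜}
    (hf : ∀ t ∈ Ioo 0 T, HasDerivAt f (g t) t) (hg : ContinuousOn g (Ioo 0 T)) :
    DistribDeriv T f g := by
  have hfc : ContinuousOn f (Ioo 0 T) := fun t ht => (hf t ht).continuousAt.continuousWithinAt
  have hfl := hfc.locallyIntegrableOn (μ := volume) measurableSet_Ioo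
  have hgl := hg.locallyIntegrableOn (μ := volume) measurableSet_Ioo
  refine ⟨hfl, hgl, fun η hη hs hT => ?_⟩
  have hdη : Continuous (deriv η) := hη.continuous_deriv (by simp)
  have hds : HasCompactSupport (deriv η) := hs.deriv
  have hdT : tsupport (deriv η) ⊆ Ioo 0 T := (tsupport_deriv_subset).trans hT
  have i1 := integrableOn_testFunction_mul hdη hds hdT hfl
  have i2 := integrableOn_testFunction_mul hη.continuous hs hT hgl
  rw [eq_neg_iff_add_eq_zero, ← integral_add i1 i2]
  have hout : ∀ t, t ∉ Ioo 0 T → deriv η t = 0 ∧ η t = 0 := fun t ht =>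
    ⟨image_eq_zero_of_notMem_tsupport fun h => ht (hdT h),
      image_eq_zero_of_notMem_tsupport fun h => ht (hT h)⟩
  have hvan : ∀ t, t ∉ Ioo 0 T → ((deriv η t : ℝ) : 𝕜) * f t + ((η t : ℝ) : 𝕜) * g t = 0 := by
    intro t ht
    simp [(hout t ht).1, (hout t ht).2]
  rw [setIntegral_eq_integral_of_forall_compl_eq_zero hvan]
  have hint : Integrable fun t => ((deriv η t : ℝ) : 𝕜) * f t + ((η t : ℝ) : 𝕜) * g t := by
    rw [← integrableOn_iff_integrable_of_support_subset (s := Ioo 0 T)]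
    · exact i1.add i2
    · intro t ht
      by_contra h
      exact ht (hvan t h)
  have hvan' : ∀ t, t ∉ Ioo 0 T → ((η t : ℝ) : 𝕜) * f t = 0 := fun t ht => by
    simp [(hout t ht).2]
  have hintf : Integrable fun t => ((η t : ℝ) : 𝕜) * f t := by
    rw [← integrableOn_iff_integrable_of_support_subset (s := Ioo 0 T)]
    · exact integrableOn_testFunction_mul hη.continuous hs hT hfl
    · intro t ht
      by_contra h
      exact ht (hvan' t h)
  refine integral_eq_zero_of_hasDerivAt_of_integrable (f := fun t => ((η t : ℝ) : 𝕜) * f t)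
    (fun t => ?_) hint hintf
  by_cases ht : t ∈ tsupport η
  · have h1 : HasDerivAt (fun t => ((η t : ℝ) : 𝕜)) ((deriv η t : ℝ) : 𝕜) t :=
      (RCLike.ofRealCLM (K := 𝕜)).hasFDerivAt.comp_hasDerivAt t
        ((hη.differentiable (by simp)) t).hasDerivAt
    exact h1.mul (hf t (hT ht))
  · have h1 : ∀ᶠ s in 𝓝 t, s ∉ tsupport η := (isClosed_tsupport η).isOpen_compl.mem_nhds ht
    have h0 : ((deriv η t : ℝ) : 𝕜) * f t + ((η t : ℝ) : 𝕜) * g t = 0 := by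
      have h2 : t ∉ tsupport (deriv η) := fun h => ht (tsupport_deriv_subset h)
      simp [image_eq_zero_of_notMem_tsupport ht, image_eq_zero_of_notMem_tsupport h2]
    rw [h0]
    refine (hasDerivAt_const t (0 : 𝕜)).congr_of_eventuallyEq ?_
    filter_upwards [h1] with s hs'
    simp [image_eq_zero_of_notMem_tsupport hs']

theorem DistribDeriv.sub {T : ℝ} {f g f' g' : ℝ → 𝕜} (h : DistribDeriv T f g)
    (h' : DistribDeriv T f' g') :
    DistribDeriv T (fun t => f t - f' t) (fun t => g t - g' t) := by
  obtain ⟨h1, h2, h3⟩ := h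
  obtain ⟨h1', h2', h3'⟩ := h'
  refine ⟨h1.sub h1', h2.sub h2', fun η hη hs hT => ?_⟩
  have hdη : Continuous (deriv η) := hη.continuous_deriv (by simp)
  have hdT : tsupport (deriv η) ⊆ Ioo 0 T := (tsupport_deriv_subset).trans hT
  simp only [mul_sub]
  rw [integral_sub (integrableOn_testFunction_mul hdη hs.deriv hdT h1)
    (integrableOn_testFunction_mul hdη hs.deriv hdT h1'),
    integral_sub (integrableOn_testFunction_mul hη.continuous hs hT h2)
    (integrableOn_testFunction_mul hη.continuous hs hT h2'), h3 η hη hs hT, h3' η hη hs hT]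
  ring

/-- A smooth step of width `ε` starting at `c`. -/
def smoothStep (c ε t : ℝ) : ℝ := Real.smoothTransition ((t - c) / ε)

theorem contDiff_smoothStep (c ε : ℝ) (n : ℕ∞) : ContDiff ℝ n (smoothStep c ε) :=
  Real.smoothTransition.contDiff.comp ((contDiff_id.sub contDiff_const).div_const _)

theorem smoothStep_of_le {c ε t : ℝ} (hε : 0 < ε) (h : t ≤ c) : smoothStep c ε t = 0 :=
  Real.smoothTransition.zero_of_nonpos (div_nonpos_of_nonpos_of_nonneg (by linarith) hε.le)

theorem smoothStep_of_ge {c ε t : ℝ} (hε : 0 < ε) (h : c + ε ≤ t) : smoothStep c ε t = 1 :=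
  Real.smoothTransition.one_of_one_le ((one_le_div hε).2 (by linarith))

theorem deriv_smoothStep_nonneg {c ε : ℝ} (hε : 0 < ε) (t : ℝ) : 0 ≤ deriv (smoothStep c ε) t := by
  have : Monotone (smoothStep c ε) := fun s t hst =>
    Real.smoothTransition.monotone (by gcongr)
  exact this.deriv_nonneg

theorem deriv_smoothStep_eq_zero {c ε t : ℝ} (hε : 0 < ε) (h : t ∉ Icc c (c + ε)) :
    deriv (smoothStep c ε) t = 0 := by
  by_cases h1 : t < c
  · have : smoothStep c ε =ᶠ[𝓝 t] fun _ => 0 := by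
      filter_upwards [gt_mem_nhds h1] with s hs
      exact smoothStep_of_le hε hs.le
    rw [this.deriv_eq]; simp
  · have h2 : c + ε < t := by
      by_contra h3
      exact h ⟨not_lt.1 h1, not_lt.1 h3⟩
    have : smoothStep c ε =ᶠ[𝓝 t] fun _ => 1 := by
      filter_upwards [lt_mem_nhds h2] with s hs
      exact smoothStep_of_ge hε hs.le
    rw [this.deriv_eq]; simp

theorem continuous_deriv_smoothStep (c ε : ℝ) : Continuous (deriv (smoothStep c ε)) :=
  (contDiff_smoothStep c ε ⊤).continuous_deriv (by simp)

theorem integral_deriv_smoothStep {c ε : ℝ} (hε : 0 < ε) :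
    ∫ t in c..(c + ε), deriv (smoothStep c ε) t = 1 := by
  rw [intervalIntegral.integral_deriv_eq_sub
    (fun t _ => ((contDiff_smoothStep c ε ⊤).differentiable (by simp)) t)
    ((continuous_deriv_smoothStep c ε).intervalIntegrable _ _),
    smoothStep_of_ge hε le_rfl, smoothStep_of_le hε le_rfl, sub_zero]

/-- The derivative of a smooth step is a non-negative bump of mass one on `[c, c + ε]`, so it
averages `F` over values close to `F c`. -/
theorem norm_integral_deriv_smoothStep_sub_le {T c ε δ : ℝ} {F : ℝ → 𝕜}
    (hF : ContinuousOn F (Ioo 0 T)) (hε : 0 < ε) (hc : Icc c (c + ε) ⊆ Ioo 0 T)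
    (hδ : ∀ t ∈ Icc c (c + ε), ‖F t - F c‖ ≤ δ) :
    ‖(∫ t in Ioo 0 T, ((deriv (smoothStep c ε) t : ℝ) : 𝕜) * F t) - F c‖ ≤ δ := by
  have hle : c ≤ c + ε := by linarith
  have h1 : ∫ t in Ioo 0 T, ((deriv (smoothStep c ε) t : ℝ) : 𝕜) * F t =
      ∫ t in c..(c + ε), ((deriv (smoothStep c ε) t : ℝ) : 𝕜) * F t := by
    rw [intervalIntegral.integral_of_le hle, ← integral_Icc_eq_integral_Ioc]
    refine setIntegral_eq_of_subset_of_forall_sdiff_eq_zero measurableSet_Ioo hc fun t ht => ?_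
    rw [deriv_smoothStep_eq_zero hε ht.2]; simp
  have hcr : Continuous fun t => ((deriv (smoothStep c ε) t : ℝ) : 𝕜) :=
    RCLike.continuous_ofReal.comp (continuous_deriv_smoothStep c ε)
  have h2 : F c = ∫ t in c..(c + ε), ((deriv (smoothStep c ε) t : ℝ) : 𝕜) * F c := by
    have h3 : ∫ t in c..(c + ε), ((deriv (smoothStep c ε) t : ℝ) : 𝕜) =
        ((∫ t in c..(c + ε), deriv (smoothStep c ε) t : ℝ) : 𝕜) :=
      (RCLike.ofRealCLM (K := 𝕜)).intervalIntegral_comp_comm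
        ((continuous_deriv_smoothStep c ε).intervalIntegrable _ _)
    rw [intervalIntegral.integral_mul_const, h3, integral_deriv_smoothStep hε]
    simp
  have hFc : ContinuousOn F (uIcc c (c + ε)) := by
    rw [uIcc_of_le hle]; exact hF.mono hc
  have i1 : IntervalIntegrable (fun t => ((deriv (smoothStep c ε) t : ℝ) : 𝕜) * F t) volume c
      (c + ε) := (hcr.continuousOn.mul hFc).intervalIntegrable
  have i2 : IntervalIntegrable (fun t => ((deriv (smoothStep c ε) t : ℝ) : 𝕜) * F c) volume c
      (c + ε) := (hcr.mul continuous_const).intervalIntegrable _ _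
  have h4 : (∫ t in Ioo 0 T, ((deriv (smoothStep c ε) t : ℝ) : 𝕜) * F t) - F c =
      ∫ t in c..(c + ε), (((deriv (smoothStep c ε) t : ℝ) : 𝕜) * F t -
        ((deriv (smoothStep c ε) t : ℝ) : 𝕜) * F c) := by
    rw [intervalIntegral.integral_sub i1 i2, ← h1, ← h2]
  rw [h4]
  have h3 : ∫ t in c..(c + ε), deriv (smoothStep c ε) t * δ = δ := by
    rw [intervalIntegral.integral_mul_const, integral_deriv_smoothStep hε, one_mul]
  rw [← h3]
  refine intervalIntegral.norm_integral_le_of_norm_le hle ?_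
    (((continuous_deriv_smoothStep c ε).mul continuous_const).intervalIntegrable _ _)
  refine Eventually.of_forall fun t ht => ?_
  rw [← mul_sub, norm_mul, RCLike.norm_ofReal, abs_of_nonneg (deriv_smoothStep_nonneg hε t)]
  exact mul_le_mul_of_nonneg_left (hδ t (Ioc_subset_Icc_self ht)) (deriv_smoothStep_nonneg hε t)

/-- The test function is a smooth step up at `a` followed by a smooth step down at `b`. Its
derivative is the difference of two approximate point masses, so its vanishing pairing with `F`
compares `F a` with `F b`. -/
theorem eq_of_distribDeriv_zero {T : ℝ} {F : ℝ → 𝕜} (hF : ContinuousOn F (Ioo 0 T))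
    (h : DistribDeriv T F fun _ => 0) {a b : ℝ} (ha : a ∈ Ioo 0 T) (hb : b ∈ Ioo 0 T)
    (hab : a < b) : F a = F b := by
  refine eq_of_forall_dist_le fun δ hδ => ?_
  have key : ∀ c ∈ Ioo 0 T, ∀ᶠ ε in 𝓝[>] (0 : ℝ), Icc c (c + ε) ⊆ Ioo 0 T ∧
      ∀ t ∈ Icc c (c + ε), ‖F t - F c‖ ≤ δ / 2 := by
    intro c hc
    have h1 : ∀ᶠ t in 𝓝 c, t ∈ Ioo 0 T ∧ ‖F t - F c‖ ≤ δ / 2 := by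
      refine Filter.Eventually.and (Ioo_mem_nhds hc.1 hc.2) ?_
      have h0 : ContinuousAt (fun t => ‖F t - F c‖) c :=
        ((hF.continuousAt (Ioo_mem_nhds hc.1 hc.2)).sub continuousAt_const).norm
      have h2 : Tendsto (fun t => ‖F t - F c‖) (𝓝 c) (𝓝 0) := by
        simpa [ContinuousAt] using h0
      exact (h2.eventually (gt_mem_nhds (half_pos hδ))).mono fun _ h => h.le
    obtain ⟨r, hr, hr'⟩ := Metric.eventually_nhds_iff.1 h1
    filter_upwards [Ioo_mem_nhdsGT hr] with ε hε
    have h3 : ∀ t ∈ Icc c (c + ε), t ∈ Ioo 0 T ∧ ‖F t - F c‖ ≤ δ / 2 := fun t ht => by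
      refine hr' ?_
      rw [Real.dist_eq, abs_of_nonneg (by linarith [ht.1])]
      linarith [ht.2, hε.2]
    exact ⟨fun t ht => (h3 t ht).1, fun t ht => (h3 t ht).2⟩
  obtain ⟨ε, ⟨⟨ha1, ha2⟩, hb1, hb2⟩, hε⟩ :=
    (((key a ha).and (key b hb)).and self_mem_nhdsWithin).exists
  have hε : 0 < ε := hε
  have e1 := norm_integral_deriv_smoothStep_sub_le hF hε ha1 ha2
  have e2 := norm_integral_deriv_smoothStep_sub_le hF hε hb1 hb2
  set η : ℝ → ℝ := fun t => smoothStep a ε t - smoothStep b ε t with hη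
  have hsub : tsupport η ⊆ Icc a (b + ε) := by
    refine closure_minimal (fun t ht => ?_) isClosed_Icc
    by_contra hcon
    refine ht ?_
    by_cases h1 : t < a
    · simp [hη, smoothStep_of_le hε h1.le, smoothStep_of_le hε (h1.trans hab).le]
    · have h2 : b + ε < t := by
        by_contra h3
        exact hcon ⟨not_lt.1 h1, not_lt.1 h3⟩
      simp [hη, smoothStep_of_ge hε h2.le, smoothStep_of_ge hε (c := a) (t := t) (by linarith)]
  have hT : Icc a (b + ε) ⊆ Ioo 0 T := fun t ht =>
    ⟨ha.1.trans_le ht.1, ht.2.trans_lt (hb1 (right_mem_Icc.2 (by linarith))).2⟩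
  have hcd : ContDiff ℝ ((⊤ : ℕ∞) : WithTop ℕ∞) η :=
    (contDiff_smoothStep a ε ⊤).sub (contDiff_smoothStep b ε ⊤)
  have h0 := h.2.2 η hcd (HasCompactSupport.of_support_subset_isCompact isCompact_Icc
    ((subset_tsupport _).trans hsub)) (hsub.trans hT)
  have hd : ∀ t, deriv η t = deriv (smoothStep a ε) t - deriv (smoothStep b ε) t := fun t =>
    deriv_fun_sub (((contDiff_smoothStep a ε ⊤).differentiable (by simp)) t)
      (((contDiff_smoothStep b ε ⊤).differentiable (by simp)) t)
  have hint : ∀ c, Icc c (c + ε) ⊆ Ioo 0 T → IntegrableOn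
      (fun t => ((deriv (smoothStep c ε) t : ℝ) : 𝕜) * F t) (Ioo 0 T) := by
    intro c hc
    have hs : tsupport (deriv (smoothStep c ε)) ⊆ Icc c (c + ε) :=
      closure_minimal (fun t ht => by
        by_contra hcon
        exact ht (deriv_smoothStep_eq_zero hε hcon)) isClosed_Icc
    exact integrableOn_testFunction_mul (continuous_deriv_smoothStep c ε)
      (HasCompactSupport.of_support_subset_isCompact isCompact_Icc
        ((subset_tsupport _).trans hs)) (hs.trans hc) h.1
  simp only [hd, RCLike.ofReal_sub, sub_mul, mul_zero, integral_zero, neg_zero] at h0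
  rw [integral_sub (hint a ha1) (hint b hb1), sub_eq_zero] at h0
  rw [h0] at e1
  rw [dist_eq_norm]
  calc ‖F a - F b‖ = ‖((∫ t in Ioo 0 T, ((deriv (smoothStep b ε) t : ℝ) : 𝕜) * F t) - F b) -
        ((∫ t in Ioo 0 T, ((deriv (smoothStep b ε) t : ℝ) : 𝕜) * F t) - F a)‖ := by congr 1; ring
    _ ≤ δ / 2 + δ / 2 := (norm_sub_le _ _).trans (add_le_add e2 e1)
    _ = δ := by ring

/-- After subtraction of a primitive of `g`, the distributional derivative is zero and the
continuous remainder is constant. Weak equations with continuous data thereby become pointwise ones.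
-/
theorem DistribDeriv.hasDerivAt {T : ℝ} {f g : ℝ → 𝕜} (h : DistribDeriv T f g)
    (hf : ContinuousOn f (Ioo 0 T)) (hg : ContinuousOn g (Ioo 0 T)) {t : ℝ} (ht : t ∈ Ioo 0 T) :
    HasDerivAt f (g t) t := by
  set G : ℝ → 𝕜 := fun s => ∫ r in (T / 2)..s, g r with hG
  have hT : 0 < T := ht.1.trans ht.2
  have hGd : ∀ s ∈ Ioo 0 T, HasDerivAt G (g s) s := by
    intro s hs
    have hsub : uIcc (T / 2) s ⊆ Ioo 0 T :=
      ordConnected_Ioo.uIcc_subset ⟨by linarith, by linarith⟩ hs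
    exact intervalIntegral.integral_hasDerivAt_right (hg.mono hsub).intervalIntegrable
      (hg.stronglyMeasurableAtFilter isOpen_Ioo s hs) (hg.continuousAt (Ioo_mem_nhds hs.1 hs.2))
  have h1 := h.sub (distribDeriv_of_hasDerivAt hGd hg)
  simp only [sub_self] at h1
  have hGc : ContinuousOn G (Ioo 0 T) := fun s hs => (hGd s hs).continuousAt.continuousWithinAt
  have h2 : ∀ s ∈ Ioo 0 T, f s - G s = f t - G t := by
    intro s hs
    rcases lt_trichotomy s t with hst | hst | hst
    · exact eq_of_distribDeriv_zero (hf.sub hGc) h1 hs ht hst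
    · rw [hst]
    · exact (eq_of_distribDeriv_zero (hf.sub hGc) h1 ht hs hst).symm
  refine ((hGd t ht).add_const (f t - G t)).congr_of_eventuallyEq ?_
  filter_upwards [Ioo_mem_nhds ht.1 ht.2] with s hs
  rw [← h2 s hs]; ring

end Distributions

/-! ### Weak solutions and Duhamel's formula -/

section Mild

variable {𝕜 : Type*} [RCLike 𝕜]
variable {H : Type*} [NormedAddCommGroup H] [InnerProductSpace 𝕜 H]
variable [NormedSpace ℝ H] [IsScalarTower ℝ 𝕜 H]

/-- The product rule for a differentiable curve and a weakly differentiable curve. -/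
theorem hasDerivAt_inner_of_weak {ψ z : ℝ → H} {ψ' : H} {d : 𝕜} {s : ℝ}
    (hψ : HasDerivAt ψ ψ' s) (hz : ContinuousAt z s)
    (hd : HasDerivAt (fun r => inner 𝕜 (ψ s) (z r)) d s) :
    HasDerivAt (fun r => inner 𝕜 (ψ r) (z r)) (inner 𝕜 ψ' (z s) + d) s := by
  -- The curve `z` is merely continuous, so the increment of `ψ` is split off first; its difference
  -- quotient converges in norm and is paired with `z r → z s`.
  have h1 : HasDerivAt (fun r => inner 𝕜 (ψ r - ψ s) (z r)) (inner 𝕜 ψ' (z s)) s := by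
    rw [hasDerivAt_iff_tendsto_slope] at hψ ⊢
    have h2 := Tendsto.inner (𝕜 := 𝕜) hψ (hz.tendsto.mono_left nhdsWithin_le_nhds)
    refine h2.congr fun r => ?_
    simp only [slope_def_module, sub_self, inner_zero_left, sub_zero]
    rw [RCLike.real_smul_eq_coe_smul (K := 𝕜), RCLike.real_smul_eq_coe_mul (K := 𝕜),
      inner_smul_left, RCLike.conj_ofReal]
  refine (h1.add hd).congr_of_eventuallyEq (Eventually.of_forall fun r => ?_)
  simp only [Pi.add_apply]
  rw [← inner_add_left]; congr 1; abel

variable [CompleteSpace H]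

/-- A weak solution of `z' = A z + g` is given by Duhamel's formula. -/
theorem C0Group.duhamel_of_weak (S : C0Group 𝕜 H) {T : ℝ} {z g : ℝ → H}
    (hz : ContinuousOn z (Icc 0 T)) (hg : ContinuousOn g (Icc 0 T))
    (hw : ∀ φ ψ : H, S.adjGroup.toC0Semigroup.HasGenerator φ ψ → ∀ t ∈ Ioo 0 T,
      HasDerivAt (fun t => inner 𝕜 φ (z t)) (-inner 𝕜 ψ (z t) + inner 𝕜 φ (g t)) t)
    {t : ℝ} (ht : t ∈ Icc 0 T) :
    z t = S.toFun t (z 0 + ∫ s in (0 : ℝ)..t, S.toFun (-s) (g s)) := by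
  have hsub : Icc 0 t ⊆ Icc 0 T := Icc_subset_Icc_right ht.2
  have hgc : ContinuousOn (fun s => S.toFun (-s) (g s)) (Icc 0 t) :=
    S.continuousOn_comp continuous_neg.continuousOn (hg.mono hsub)
  have hgi : IntervalIntegrable (fun s => S.toFun (-s) (g s)) volume 0 t := by
    refine ContinuousOn.intervalIntegrable ?_
    rwa [uIcc_of_le ht.1]
  suffices h : S.toFun (-t) (z t) - z 0 = ∫ s in (0 : ℝ)..t, S.toFun (-s) (g s) by
    rw [← h, add_sub_cancel, S.apply_apply_neg]
  refine S.dense_adjGen_domain.eq_of_inner_right 𝕜 fun φ hφ => ?_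
  have hgen := S.hasGenerator_adjGen ⟨φ, hφ⟩
  set ψ := -S.adjGen ⟨φ, hφ⟩
  have hadj : ∀ s x, inner 𝕜 (S.adjGroup.toFun s φ) x = inner 𝕜 φ (S.toFun (-s) x) := by
    intro s x
    rw [C0Group.adjGroup_toFun, ContinuousLinearMap.adjoint_inner_left]
  -- The test vector is moved along the adjoint orbit `S(-s)* φ`, which stays in `D(A*)`. The two
  -- terms containing the generator cancel, and only the source survives.
  have hd : ∀ s ∈ Ioo 0 t, HasDerivAt (fun s => inner 𝕜 φ (S.toFun (-s) (z s)))
      (inner 𝕜 φ (S.toFun (-s) (g s))) s := by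
    intro s hs
    have hsT : s ∈ Ioo 0 T := ⟨hs.1, hs.2.trans_le ht.2⟩
    have hmap := S.adjGroup.hasGenerator_map s ⟨φ, hgen.mem⟩
    have hval : S.adjGroup.generator ⟨φ, hgen.mem⟩ = ψ := hgen.generator_eq _
    rw [hval] at hmap
    have h1 := hasDerivAt_inner_of_weak (𝕜 := 𝕜) (S.adjGroup.hasDerivAt_orbit hgen s)
      (hz.continuousAt (Icc_mem_nhds hsT.1 hsT.2)) (hw _ _ hmap s hsT)
    simp only [hadj, ← add_assoc, add_neg_cancel, zero_add] at h1
    exact h1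
  have hcont : ContinuousOn (fun s => inner 𝕜 φ (S.toFun (-s) (z s))) (Icc 0 t) :=
    continuousOn_const.inner (S.continuousOn_comp continuous_neg.continuousOn (hz.mono hsub))
  have hint : IntervalIntegrable (fun s => inner 𝕜 φ (S.toFun (-s) (g s))) volume 0 t := by
    refine ContinuousOn.intervalIntegrable ?_
    rw [uIcc_of_le ht.1]
    exact continuousOn_const.inner hgc
  have h2 := intervalIntegral.integral_eq_sub_of_hasDerivAt_of_le ht.1 hcont hd hint
  rw [intervalIntegral_inner φ hgi] at h2
  rw [h2, inner_sub_right]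
  simp [S.map_zero]

/-- A function given by Duhamel's formula is a weak solution of `z' = A z + g`. -/
theorem C0Group.weak_of_duhamel (S : C0Group 𝕜 H) {g : ℝ → H} (hg : Continuous g) (x : H)
    {φ ψ : H} (hφ : S.adjGroup.toC0Semigroup.HasGenerator φ ψ) (t : ℝ) :
    HasDerivAt (fun t => inner 𝕜 φ (S.toFun t (x + ∫ s in (0 : ℝ)..t, S.toFun (-s) (g s))))
      (-inner 𝕜 ψ (S.toFun t (x + ∫ s in (0 : ℝ)..t, S.toFun (-s) (g s))) + inner 𝕜 φ (g t)) t := by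
  have hgc : Continuous fun s => S.toFun (-s) (g s) := S.continuous_comp continuous_neg hg
  have h1 : HasDerivAt (fun t => x + ∫ s in (0 : ℝ)..t, S.toFun (-s) (g s))
      (S.toFun (-t) (g t)) t :=
    (intervalIntegral.integral_hasDerivAt_right (hgc.intervalIntegrable _ _)
      (hgc.stronglyMeasurableAtFilter _ _) hgc.continuousAt).const_add x
  have h2 : HasDerivAt (fun s => S.adjGroup.toFun (-s) φ) (-S.adjGroup.toFun (-t) ψ) t := by
    have := (S.adjGroup.hasDerivAt_orbit hφ (-t)).scomp t (hasDerivAt_neg t)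
    rwa [neg_one_smul] at this
  have hadj : ∀ s x y, inner 𝕜 (S.adjGroup.toFun (-s) x) y = inner 𝕜 x (S.toFun s y) := by
    intro s x y
    rw [C0Group.adjGroup_toFun, ContinuousLinearMap.adjoint_inner_left, neg_neg]
  have h3 := HasDerivAt.inner 𝕜 h2 h1
  simp only [inner_neg_left, hadj, S.apply_apply_neg] at h3
  rwa [add_comm] at h3

end Mild

/-! ### Bounded perturbations of the generator of a group -/

section Perturbation

open scoped BoundedContinuousFunction

variable {𝕜 : Type*} [RCLike 𝕜]
variable {H : Type*} [NormedAddCommGroup H] [InnerProductSpace 𝕜 H]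

theorem integral_exp_neg_le {a t : ℝ} (ha : 0 < a) :
    ∫ s in (0 : ℝ)..t, Real.exp (-(a * (t - s))) ≤ 1 / a := by
  have hd : ∀ s ∈ uIcc 0 t, HasDerivAt (fun s => Real.exp (-(a * (t - s))) / a)
      (Real.exp (-(a * (t - s)))) s := by
    intro s _
    have h1 : HasDerivAt (fun s => -(a * (t - s))) a s := by
      have := (((hasDerivAt_id' s).const_sub t).const_mul a).fun_neg
      simpa using this
    have h2 := h1.exp.div_const a
    rwa [mul_div_assoc, div_self ha.ne', mul_one] at h2
  have hc : Continuous fun s => Real.exp (-(a * (t - s))) := by fun_prop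
  rw [intervalIntegral.integral_eq_sub_of_hasDerivAt hd (hc.intervalIntegrable _ _)]
  simp only [sub_self, mul_zero, neg_zero, Real.exp_zero]
  have : 0 ≤ Real.exp (-(a * (t - 0))) / a := by positivity
  linarith

theorem C0Semigroup.hasGenerator_map (V : C0Semigroup 𝕜 H) {x w : H} (h : V.HasGenerator x w)
    (t : ℝ≥0) : V.HasGenerator (V.toFun t x) (V.toFun t w) := by
  refine (((V.toFun t).continuous.tendsto _).comp h).congr fun r => ?_
  have hc : V.toFun t (V.toFun r x) = V.toFun r (V.toFun t x) := by
    have h1 := V.map_add t r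
    rw [add_comm, V.map_add] at h1
    exact (DFunLike.congr_fun h1 x).symm
  simp only [Function.comp_apply, map_smul, map_sub, hc]

/-- The right derivative of an orbit of a semigroup starting in the domain of the generator. -/
theorem C0Semigroup.hasDerivWithinAt_orbit [NormedSpace ℝ H] [IsScalarTower ℝ 𝕜 H]
    (V : C0Semigroup 𝕜 H) {x w : H}
    (h : V.HasGenerator x w) {t : ℝ} (ht : 0 ≤ t) :
    HasDerivWithinAt (fun s : ℝ => V.toFun s.toNNReal x) (V.toFun t.toNNReal w) (Ici t) t := by
  have h1 := (V.hasGenerator_iff _ _).1 (V.hasGenerator_map h t.toNNReal)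
  rw [← hasDerivWithinAt_Ioi_iff_Ici]
  have h2 : HasDerivWithinAt (fun s : ℝ => V.toFun (s - t).toNNReal (V.toFun t.toNNReal x))
      (V.toFun t.toNNReal w) (Ioi t) t := by
    have hd : HasDerivWithinAt (fun s : ℝ => s - t) 1 (Ioi t) t :=
      ((hasDerivAt_id t).sub_const t).hasDerivWithinAt
    have := HasDerivWithinAt.scomp (t' := Ioi (0 : ℝ)) t
      (g₁ := fun s : ℝ => V.toFun s.toNNReal (V.toFun t.toNNReal x))
      (g₁' := V.toFun t.toNNReal w) (h := fun s : ℝ => s - t) (by simpa using h1) hd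
      (fun s hs => by simpa using hs)
    simpa [Function.comp_def] using this
  have hval : ∀ s ∈ Ici t, V.toFun s.toNNReal x =
      V.toFun (s - t).toNNReal (V.toFun t.toNNReal x) := by
    intro s hs
    have h3 := V.map_add (s - t).toNNReal t.toNNReal
    rw [← Real.toNNReal_add (sub_nonneg.2 hs) ht, sub_add_cancel] at h3
    rw [h3]; rfl
  exact h2.congr (fun s hs => hval s (mem_Ici.2 (le_of_lt hs))) (hval t (mem_Ici.2 le_rfl))

variable [CompleteSpace H] [NormedSpace ℝ H]

namespace C0Group

variable (S : C0Group 𝕜 H)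

/-- Uniqueness for the Volterra equation of a bounded perturbation. -/
theorem volterra_eq_zero (P : H →L[𝕜] H) {T : ℝ} {d : ℝ → H} (hd : ContinuousOn d (Icc 0 T))
    (h : ∀ t ∈ Icc 0 T, d t = S.toFun t (∫ s in (0 : ℝ)..t, S.toFun (-s) (P (d s)))) :
    ∀ t ∈ Icc 0 T, d t = 0 := by
  intro t₀ ht₀
  have hT : 0 ≤ T := ht₀.1.trans ht₀.2
  obtain ⟨M, hM, hb⟩ := S.exists_bound T
  -- Extending `d` by constants outside `[0, T]` makes `∫₀ᵗ ‖e‖` differentiable everywhere, so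
  -- Grönwall's inequality applies up to the endpoints.
  set e : ℝ → H := IccExtend hT (domRestrict (Icc 0 T) d) with he
  have hec : Continuous e := hd.domRestrict.Icc_extend'
  have heq : ∀ t ∈ Icc 0 T, e t = d t := fun t ht => by
    rw [he, IccExtend_of_mem hT _ ht]; rfl
  set m : ℝ → ℝ := fun t => ∫ s in (0 : ℝ)..t, ‖e s‖ with hm
  have hmd : ∀ t, HasDerivAt m ‖e t‖ t := fun t =>
    intervalIntegral.integral_hasDerivAt_right (hec.norm.intervalIntegrable _ _)
      (hec.norm.stronglyMeasurableAtFilter _ _) hec.norm.continuousAt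
  have hbound : ∀ t ∈ Icc 0 T, ‖e t‖ ≤ (M * M * ‖P‖) * m t := by
    intro t ht
    have h1 : ‖∫ s in (0 : ℝ)..t, S.toFun (-s) (P (d s))‖ ≤
        ∫ s in (0 : ℝ)..t, M * ‖P‖ * ‖e s‖ := by
      refine intervalIntegral.norm_integral_le_of_norm_le ht.1 (Eventually.of_forall fun s hs => ?_)
        ((hec.norm.const_mul _).intervalIntegrable _ _)
      have hsT : s ∈ Icc 0 T := ⟨hs.1.le, hs.2.trans ht.2⟩
      rw [heq s hsT, mul_assoc]
      refine (ContinuousLinearMap.le_opNorm _ _).trans ?_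
      exact mul_le_mul (hb _ ⟨by linarith [hsT.2], by linarith [hs.1]⟩)
        (ContinuousLinearMap.le_opNorm _ _) (norm_nonneg _) hM.le
    rw [intervalIntegral.integral_const_mul] at h1
    rw [heq t ht, h t ht]
    refine (ContinuousLinearMap.le_opNorm _ _).trans ?_
    calc _ ≤ M * (M * ‖P‖ * m t) := mul_le_mul (hb t ⟨by linarith [ht.1], ht.2⟩) h1
          (norm_nonneg _) hM.le
      _ = _ := by ring
  have hm0 : ∀ t, 0 ≤ t → 0 ≤ m t := fun t ht =>
    intervalIntegral.integral_nonneg ht fun s _ => norm_nonneg _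
  have hg := norm_le_gronwallBound_of_norm_deriv_right_le (f := m) (f' := fun t => ‖e t‖)
    (δ := 0) (K := M * M * ‖P‖) (ε := 0) (a := 0) (b := T)
    (fun t _ => (hmd t).continuousAt.continuousWithinAt)
    (fun t _ => (hmd t).hasDerivWithinAt) (by simp [hm])
    (fun t ht => by
      rw [norm_norm, add_zero, Real.norm_of_nonneg (hm0 t ht.1)]
      exact hbound t ⟨ht.1, ht.2.le⟩) t₀ ht₀
  rw [gronwallBound_ε0, zero_mul] at hg
  have hm1 : m t₀ = 0 := norm_le_zero_iff.1 hg
  have := hbound t₀ ht₀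
  rw [hm1, mul_zero, heq t₀ ht₀] at this
  exact norm_le_zero_iff.1 this

/-- The Volterra operator of a bounded perturbation, with the weight `exp (-k t)`. -/
def volterra (P : H →L[𝕜] H) (k : ℝ) (u : ℝ → H) (t : ℝ) : H :=
  Real.exp (-(k * t)) • S.toFun t (∫ s in (0 : ℝ)..t, S.toFun (-s) (Real.exp (k * s) • P (u s)))

theorem continuous_volterra_integrand (P : H →L[𝕜] H) (k : ℝ) {u : ℝ → H} (hu : Continuous u) :
    Continuous fun s => S.toFun (-s) (Real.exp (k * s) • P (u s)) :=
  S.continuous_comp continuous_neg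
    ((Real.continuous_exp.comp (continuous_const.mul continuous_id)).smul (P.continuous.comp hu))

theorem continuous_volterra (P : H →L[𝕜] H) (k : ℝ) {u : ℝ → H} (hu : Continuous u) :
    Continuous (S.volterra P k u) := by
  have h1 := S.continuous_volterra_integrand P k hu
  exact (Real.continuous_exp.comp (continuous_const.mul continuous_id).neg).smul
    (S.continuous_comp continuous_id
      (intervalIntegral.continuous_primitive (fun a b => h1.intervalIntegrable a b) 0))

variable [IsScalarTower ℝ 𝕜 H]

/-- The weight turns the kernel into `exp (-k (t - s)) S(t - s)`, whose norm is at most `M exp (-(k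
- ω)(t - s))`. The integral of this exponential is at most `1 / (k - ω)`, uniformly in `t`. -/
theorem norm_volterra_le (P : H →L[𝕜] H) {M ω k C : ℝ} (hM : 0 < M) (hk : ω < k)
    (hb : ∀ t, 0 ≤ t → ‖S.toFun t‖ ≤ M * Real.exp (ω * t)) {u : ℝ → H} (hu : Continuous u)
    (hC : ∀ t, ‖u t‖ ≤ C) {t : ℝ} (ht : 0 ≤ t) :
    ‖S.volterra P k u t‖ ≤ M * ‖P‖ / (k - ω) * C := by
  have h1 := S.continuous_volterra_integrand P k hu
  have h2 : S.volterra P k u t =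
      ∫ s in (0 : ℝ)..t, Real.exp (-(k * (t - s))) • S.toFun (t - s) (P (u s)) := by
    rw [volterra, ← ContinuousLinearMap.intervalIntegral_comp_comm _ (h1.intervalIntegrable _ _),
      ← intervalIntegral.integral_smul]
    refine intervalIntegral.integral_congr fun s _ => ?_
    rw [← S.apply_add, ContinuousLinearMap.map_smul_of_tower, smul_smul, ← Real.exp_add]
    congr 2
    ring
  have hC0 : 0 ≤ C := (norm_nonneg _).trans (hC 0)
  have hc : Continuous fun s => Real.exp (-((k - ω) * (t - s))) := by fun_prop
  rw [h2]
  have h3 : ‖∫ s in (0 : ℝ)..t, Real.exp (-(k * (t - s))) • S.toFun (t - s) (P (u s))‖ ≤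
      ∫ s in (0 : ℝ)..t, M * ‖P‖ * C * Real.exp (-((k - ω) * (t - s))) := by
    refine intervalIntegral.norm_integral_le_of_norm_le ht (Eventually.of_forall fun s hs => ?_)
      ((continuous_const.mul hc).intervalIntegrable _ _)
    rw [norm_smul, Real.norm_of_nonneg (Real.exp_nonneg _)]
    have h4 : ‖S.toFun (t - s) (P (u s))‖ ≤ M * Real.exp (ω * (t - s)) * (‖P‖ * C) :=
      (ContinuousLinearMap.le_opNorm _ _).trans (mul_le_mul (hb _ (by linarith [hs.2]))
        ((ContinuousLinearMap.le_opNorm _ _).trans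
          (mul_le_mul_of_nonneg_left (hC s) (norm_nonneg _))) (norm_nonneg _) (by positivity))
    calc _ ≤ Real.exp (-(k * (t - s))) * (M * Real.exp (ω * (t - s)) * (‖P‖ * C)) := by gcongr
      _ = M * ‖P‖ * C * (Real.exp (-(k * (t - s))) * Real.exp (ω * (t - s))) := by ring
      _ = _ := by
        rw [← Real.exp_add]; congr 2; ring
  refine h3.trans ?_
  rw [intervalIntegral.integral_const_mul]
  have h5 := integral_exp_neg_le (t := t) (sub_pos.2 hk)
  calc _ ≤ M * ‖P‖ * C * (1 / (k - ω)) := by gcongr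
    _ = _ := by ring

/-- The solution operators of a bounded perturbation of a group. -/
theorem exists_solutionOperator (P : H →L[𝕜] H) : ∃ F : ℝ≥0 → H →L[𝕜] H,
    (∀ x, Continuous fun t : ℝ => F t.toNNReal x) ∧ ∀ (x : H) (t : ℝ), 0 ≤ t →
      F t.toNNReal x =
        S.toFun t (x + ∫ s in (0 : ℝ)..t, S.toFun (-s) (P (F s.toNNReal x))) := by
  obtain ⟨M, ω, hM, hω, hb⟩ := S.exists_growth
  -- With this weight the Volterra operator has norm at most `M ‖P‖ / (2 M ‖P‖ + 1) ≤ 1/2` on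
  -- bounded continuous functions on `[0, ∞)`. The summand `1` keeps `k > ω` when `P = 0`.
  set k : ℝ := ω + (2 * (M * ‖P‖) + 1) with hk
  have hMP : 0 ≤ M * ‖P‖ := by positivity
  have hωk : ω < k := by rw [hk]; linarith
  have hext : ∀ u : ℝ≥0 →ᵇ H, Continuous fun s : ℝ => u s.toNNReal := fun u =>
    u.continuous.comp continuous_real_toNNReal
  have hbd : ∀ (u : ℝ≥0 →ᵇ H) (t : ℝ≥0),
      ‖S.volterra P k (fun s => u s.toNNReal) t‖ ≤ 1 / 2 * ‖u‖ := by
    intro u t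
    refine (S.norm_volterra_le P hM hωk hb (hext u) (fun s => u.norm_coe_le_norm _) t.2).trans ?_
    refine mul_le_mul_of_nonneg_right ?_ (norm_nonneg _)
    rw [hk, add_sub_cancel_left, div_le_div_iff₀ (by positivity) (by norm_num)]
    linarith
  let L : (ℝ≥0 →ᵇ H) →L[𝕜] (ℝ≥0 →ᵇ H) := LinearMap.mkContinuous
    { toFun := fun u => BoundedContinuousFunction.ofNormedAddCommGroup
        (fun t : ℝ≥0 => S.volterra P k (fun s => u s.toNNReal) t)
        ((S.continuous_volterra P k (hext u)).comp NNReal.continuous_coe) (1 / 2 * ‖u‖) (hbd u)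
      map_add' := fun u v => by
        ext t
        simp only [BoundedContinuousFunction.coe_ofNormedAddCommGroup,
          BoundedContinuousFunction.add_apply, volterra, _root_.map_add, smul_add]
        rw [intervalIntegral.integral_add
          ((S.continuous_volterra_integrand P k (hext u)).intervalIntegrable _ _)
          ((S.continuous_volterra_integrand P k (hext v)).intervalIntegrable _ _),
          _root_.map_add, smul_add]
      map_smul' := fun c u => by
        ext t
        simp only [BoundedContinuousFunction.coe_ofNormedAddCommGroup,
          BoundedContinuousFunction.smul_apply, volterra, map_smul, RingHom.id_apply]
        simp only [smul_comm (_ : ℝ) c, map_smul]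
        rw [intervalIntegral.integral_smul, map_smul, smul_comm] } (1 / 2) fun u =>
    BoundedContinuousFunction.norm_ofNormedAddCommGroup_le _ (by positivity) (hbd u)
  have hL : ‖L‖ < 1 := (LinearMap.mkContinuous_norm_le _ (by norm_num) _).trans_lt (by norm_num)
  have hιb : ∀ (x : H) (t : ℝ≥0), ‖Real.exp (-(k * t)) • S.toFun t x‖ ≤ M * ‖x‖ := by
    intro x t
    rw [norm_smul, Real.norm_of_nonneg (Real.exp_nonneg _)]
    have h4 : ‖S.toFun t x‖ ≤ M * Real.exp (ω * t) * ‖x‖ :=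
      (ContinuousLinearMap.le_opNorm _ _).trans
        (mul_le_mul_of_nonneg_right (hb t t.2) (norm_nonneg _))
    have h5 : Real.exp (-(k * t)) * Real.exp (ω * t) ≤ 1 := by
      rw [← Real.exp_add, Real.exp_le_one_iff]
      have : ω * t ≤ k * t := mul_le_mul_of_nonneg_right hωk.le t.2
      linarith
    calc _ ≤ Real.exp (-(k * t)) * (M * Real.exp (ω * t) * ‖x‖) := by gcongr
      _ = (Real.exp (-(k * t)) * Real.exp (ω * t)) * (M * ‖x‖) := by ring
      _ ≤ 1 * (M * ‖x‖) := by gcongr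
      _ = M * ‖x‖ := one_mul _
  let ι : H →L[𝕜] (ℝ≥0 →ᵇ H) := LinearMap.mkContinuous
    { toFun := fun x => BoundedContinuousFunction.ofNormedAddCommGroup
        (fun t : ℝ≥0 => Real.exp (-(k * t)) • S.toFun t x)
        (((Real.continuous_exp.comp (continuous_const.mul continuous_id).neg).smul
          (S.continuous_orbit x)).comp NNReal.continuous_coe) (M * ‖x‖) (hιb x)
      map_add' := fun x y => by
        ext t
        change Real.exp (-(k * t)) • S.toFun t (x + y) =
          Real.exp (-(k * t)) • S.toFun t x + Real.exp (-(k * t)) • S.toFun t y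
        rw [_root_.map_add, smul_add]
      map_smul' := fun c x => by
        ext t
        change Real.exp (-(k * t)) • S.toFun t (c • x) = c • Real.exp (-(k * t)) • S.toFun t x
        rw [map_smul, smul_comm] } M fun x =>
    BoundedContinuousFunction.norm_ofNormedAddCommGroup_le _ (by positivity) (hιb x)
  -- The Neumann inverse of `1 - L` solves the weighted equation for all initial values at once, so
  -- linearity and boundedness in `x` come for free.
  set R : (ℝ≥0 →ᵇ H) →L[𝕜] (ℝ≥0 →ᵇ H) := ↑(Units.oneSub L hL)⁻¹ with hR
  have hRL : ∀ f, R f = f + L (R f) := by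
    intro f
    have h1 : (1 - L) * R = 1 := by
      have := (Units.oneSub L hL).mul_inv
      rwa [Units.val_oneSub] at this
    have h2 := congrArg (fun A : (ℝ≥0 →ᵇ H) →L[𝕜] (ℝ≥0 →ᵇ H) => A f) h1
    exact sub_eq_iff_eq_add.1 h2
  refine ⟨fun t => ((Real.exp (k * t) : ℝ) : 𝕜) •
    (BoundedContinuousFunction.evalCLM 𝕜 t).comp (R.comp ι), fun x => ?_, fun x t ht => ?_⟩
  · simp only [_root_.smul_apply, ContinuousLinearMap.comp_apply,
      BoundedContinuousFunction.evalCLM_apply]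
    refine Continuous.smul (RCLike.continuous_ofReal.comp (Real.continuous_exp.comp
      (continuous_const.mul ?_))) (hext _)
    exact NNReal.continuous_coe.comp continuous_real_toNNReal
  · have hval : ∀ s : ℝ, 0 ≤ s → (((Real.exp (k * s.toNNReal) : ℝ) : 𝕜) •
        (BoundedContinuousFunction.evalCLM 𝕜 s.toNNReal).comp (R.comp ι)) x =
        Real.exp (k * s) • R (ι x) s.toNNReal := by
      intro s hs
      rw [Real.coe_toNNReal s hs, _root_.smul_apply,
        ← RCLike.real_smul_eq_coe_smul]
      rfl
    rw [hval t ht]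
    have h3 : ∫ s in (0 : ℝ)..t, S.toFun (-s) (P ((((Real.exp (k * s.toNNReal) : ℝ) : 𝕜) •
        (BoundedContinuousFunction.evalCLM 𝕜 s.toNNReal).comp (R.comp ι)) x)) =
        ∫ s in (0 : ℝ)..t, S.toFun (-s) (Real.exp (k * s) • P (R (ι x) s.toNNReal)) := by
      refine intervalIntegral.integral_congr fun s hs => ?_
      rw [uIcc_of_le ht] at hs
      rw [hval s hs.1, ContinuousLinearMap.map_smul_of_tower]
    rw [h3]
    have h4 : R (ι x) t.toNNReal = Real.exp (-(k * t)) • S.toFun t x +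
        S.volterra P k (fun s => R (ι x) s.toNNReal) t := by
      conv_lhs => rw [hRL]
      rw [BoundedContinuousFunction.add_apply]
      change Real.exp (-(k * t.toNNReal)) • S.toFun t.toNNReal x +
        S.volterra P k (fun s => R (ι x) s.toNNReal) t.toNNReal = _
      rw [Real.coe_toNNReal t ht]
    rw [h4, volterra, ← smul_add, smul_smul, ← Real.exp_add, add_neg_cancel, Real.exp_zero,
      one_smul, _root_.map_add]

/-- A bounded perturbation of the generator of a group generates a semigroup. -/
theorem exists_perturbation (P : H →L[𝕜] H) : ∃ V : C0Semigroup 𝕜 H,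
    (∀ x, Continuous fun t : ℝ => V.toFun t.toNNReal x) ∧ ∀ (x : H) (t : ℝ), 0 ≤ t →
      V.toFun t.toNNReal x =
        S.toFun t (x + ∫ s in (0 : ℝ)..t, S.toFun (-s) (P (V.toFun s.toNNReal x))) := by
  obtain ⟨F, hFc, hF⟩ := S.exists_solutionOperator P
  have hint : ∀ x, Continuous fun s => S.toFun (-s) (P (F s.toNNReal x)) := fun x =>
    S.continuous_comp continuous_neg (P.continuous.comp (hFc x))
  have h0 : ∀ x, F 0 x = x := by
    intro x
    have := hF x 0 le_rfl
    simpa [S.map_zero] using this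
  have hadd : ∀ (s t : ℝ≥0) (x : H), F (s + t) x = F s (F t x) := by
    intro s t x
    have hcs : Continuous fun q : ℝ => S.toFun (-q) (P (F (q + t).toNNReal x)) :=
      S.continuous_comp continuous_neg
        (P.continuous.comp ((hFc x).comp (continuous_id.add continuous_const)))
    have hshift : Continuous fun r : ℝ => F (r + t).toNNReal x :=
      (hFc x).comp (continuous_id.add continuous_const)
    -- The semigroup law is a uniqueness statement: `r ↦ F(r + t) x - F(r) F(t) x` solves the
    -- homogeneous Volterra equation.
    have key := S.volterra_eq_zero P (T := s)
      (d := fun r => F (r + t).toNNReal x - F r.toNNReal (F t x))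
      (hshift.sub (hFc _)).continuousOn ?_ s ⟨s.2, le_rfl⟩
    · rw [sub_eq_zero, ← NNReal.coe_add, Real.toNNReal_coe, Real.toNNReal_coe] at key
      exact key
    · intro r hr
      have ht : (0 : ℝ) ≤ t := t.2
      have h1 := hF x (r + t) (add_nonneg hr.1 ht)
      have h2 := hF (F t x) r hr.1
      have h3 := hF x t ht
      rw [Real.toNNReal_coe] at h3
      -- The integral is split at `t` and its second part shifted, which restarts Duhamel's formula
      -- from `F(t) x`.
      have h4 : ∫ q in (0 : ℝ)..(r + t), S.toFun (-q) (P (F q.toNNReal x)) =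
          (∫ q in (0 : ℝ)..t, S.toFun (-q) (P (F q.toNNReal x))) +
          S.toFun (-t) (∫ q in (0 : ℝ)..r, S.toFun (-q) (P (F (q + t).toNNReal x))) := by
        rw [← intervalIntegral.integral_add_adjacent_intervals
          ((hint x).intervalIntegrable 0 t) ((hint x).intervalIntegrable t (r + t))]
        congr 1
        rw [← ContinuousLinearMap.intervalIntegral_comp_comm _
          (hcs.intervalIntegrable _ _)]
        have h5 := intervalIntegral.integral_comp_add_right (a := 0) (b := r)
          (fun q => S.toFun (-q) (P (F q.toNNReal x))) (t : ℝ)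
        rw [zero_add] at h5
        rw [← h5]
        refine intervalIntegral.integral_congr fun q _ => ?_
        rw [← S.apply_add]
        congr 2; ring
      have h6 : F (r + t).toNNReal x = S.toFun r (F t x) +
          S.toFun r (∫ q in (0 : ℝ)..r, S.toFun (-q) (P (F (q + t).toNNReal x))) := by
        rw [h1, h4, ← add_assoc, S.apply_add, _root_.map_add (S.toFun t), ← h3,
          S.apply_apply_neg, _root_.map_add]
      rw [h6]
      rw [h2, _root_.map_add, add_sub_add_left_eq_sub, ← map_sub,
        ← intervalIntegral.integral_sub
          (hcs.intervalIntegrable _ _)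
          ((hint _).intervalIntegrable _ _)]
      simp only [map_sub]
  refine ⟨⟨F, ContinuousLinearMap.ext h0, fun s t => ContinuousLinearMap.ext (hadd s t),
    fun x => ?_⟩, hFc, hF⟩
  have h1 := ((hFc x).comp NNReal.continuous_coe).tendsto 0
  simp only [Function.comp_def, Real.toNNReal_coe, h0] at h1
  exact h1

theorem hasDerivAt_apply_zero {q : ℝ → H} {y : H} (hq : HasDerivAt q y 0) (h0 : q 0 = 0) :
    HasDerivAt (fun t => S.toFun t (q t)) y 0 := by
  rw [hasDerivAt_iff_tendsto_slope] at hq ⊢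
  have h1 : Tendsto (fun t : ℝ => (t, slope q 0 t)) (𝓝[≠] 0) (𝓝 (0, y)) :=
    Tendsto.prodMk_nhds (tendsto_id.mono_left nhdsWithin_le_nhds) hq
  have h2 := (S.continuous_apply.tendsto (0, y)).comp h1
  simp only [S.map_zero, ContinuousLinearMap.id_apply] at h2
  refine h2.congr fun t => ?_
  simp [slope_def_module, h0, ContinuousLinearMap.map_smul_of_tower]

/-- The orbits of `V` and `S` through `x` differ by the Duhamel integral, whose derivative at zero
is `g 0`. One orbit is right differentiable at zero exactly when the other is. -/
theorem hasGenerator_of_duhamel (V : C0Semigroup 𝕜 H) {x : H} {g : ℝ → H} (hg : Continuous g)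
    (hV : ∀ t : ℝ, 0 ≤ t → V.toFun t.toNNReal x =
      S.toFun t (x + ∫ s in (0 : ℝ)..t, S.toFun (-s) (g s))) (w : H) :
    V.HasGenerator x w ↔ S.toC0Semigroup.HasGenerator x (w - g 0) := by
  have hgc : Continuous fun s => S.toFun (-s) (g s) := S.continuous_comp continuous_neg hg
  have h1 : HasDerivAt (fun t => ∫ s in (0 : ℝ)..t, S.toFun (-s) (g s)) (g 0) 0 := by
    have := intervalIntegral.integral_hasDerivAt_right (hgc.intervalIntegrable 0 0)
      (hgc.stronglyMeasurableAtFilter _ _) hgc.continuousAt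
    simpa [S.map_zero] using this
  have h2 := (S.hasDerivAt_apply_zero h1 (by simp)).hasDerivWithinAt (s := Ioi 0)
  have hS : ∀ t ∈ Ici (0 : ℝ), S.toC0Semigroup.toFun t.toNNReal x = S.toFun t x := by
    intro t ht
    simp [C0Group.toC0Semigroup, Real.coe_toNNReal t ht]
  have hVS : ∀ t ∈ Ici (0 : ℝ), V.toFun t.toNNReal x = S.toC0Semigroup.toFun t.toNNReal x +
      S.toFun t (∫ s in (0 : ℝ)..t, S.toFun (-s) (g s)) := by
    intro t ht
    rw [hS t ht, hV t ht, _root_.map_add]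
  rw [C0Semigroup.hasGenerator_iff, C0Semigroup.hasGenerator_iff]
  constructor
  · intro h
    refine (h.fun_sub h2).congr (fun t ht => ?_) ?_
    · rw [hVS t (mem_Ici.2 (le_of_lt ht)), add_sub_cancel_right]
    · rw [hVS 0 (by simp), add_sub_cancel_right]
  · intro h
    have h3 := h.add h2
    rw [sub_add_cancel] at h3
    exact h3.congr (fun t ht => hVS t (mem_Ici.2 (le_of_lt ht))) (hVS 0 (by simp))

end C0Group

end Perturbation

/-! ### Elementary integral estimates on bounded intervals -/

theorem eLpNorm_two_sq {α E : Type*} [MeasurableSpace α] [NormedAddCommGroup E] (μ : Measure α)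
    (f : α → E) : eLpNorm f 2 μ ^ 2 = ∫⁻ a, ‖f a‖ₑ ^ 2 ∂μ := by
  have := eLpNorm_nnreal_pow_eq_lintegral (μ := μ) (f := f) (p := 2) (by norm_num)
  simpa using this

theorem lintegral_sq_le {α : Type*} [MeasurableSpace α] (μ : Measure α) {f : α → ℝ≥0∞}
    (hf : AEMeasurable f μ) : (∫⁻ a, f a ∂μ) ^ 2 ≤ μ univ * ∫⁻ a, f a ^ 2 ∂μ := by
  have h := ENNReal.lintegral_mul_le_Lp_mul_Lq μ Real.HolderConjugate.two_two
    (f := fun _ => 1) (g := f) aemeasurable_const hf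
  simp only [Pi.mul_apply, one_mul, ENNReal.one_rpow, lintegral_const] at h
  have h2 := pow_le_pow_left' h 2
  rw [mul_pow, ← ENNReal.rpow_natCast, ← ENNReal.rpow_natCast, ← ENNReal.rpow_natCast,
    ← ENNReal.rpow_mul, ← ENNReal.rpow_mul] at h2
  simpa using h2

theorem memLp_of_continuous {E : Type*} [NormedAddCommGroup E] {f : ℝ → E} (hf : Continuous f)
    (p : ℝ≥0∞) (T : ℝ) : MemLp f p (volume.restrict (Ioo 0 T)) := by
  obtain ⟨C, hC⟩ := isCompact_Icc.exists_bound_of_continuousOn (s := Icc 0 T) hf.continuousOn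
  exact MemLp.of_bound hf.aestronglyMeasurable C
    (ae_restrict_of_forall_mem measurableSet_Ioo fun t ht => hC t (Ioo_subset_Icc_self ht))

theorem lintegral_Ioo_lt_top_of_continuous {f : ℝ → ℝ≥0} (hf : Continuous f) (T : ℝ) :
    ∫⁻ t in Ioo 0 T, (f t : ℝ≥0∞) < ∞ := by
  have h := (memLp_of_continuous (NNReal.continuous_coe.comp hf) 1 T).eLpNorm_lt_top
  rw [eLpNorm_one_eq_lintegral_enorm] at h
  refine lt_of_eq_of_lt (lintegral_congr fun t => ?_) h
  simp [enorm_eq_nnnorm]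

/-! ### From admissibility of `B` to observability of `B*` -/

section Observability

variable {𝕜 : Type*} [RCLike 𝕜]
variable {H : Type*} [NormedAddCommGroup H] [InnerProductSpace 𝕜 H]
variable {U : Type*} [NormedAddCommGroup U] [InnerProductSpace 𝕜 U] [CompleteSpace U]

theorem toGraph_sub (T : H →ₗ.[𝕜] H) (x y : T.domain) :
    toGraph T (x - y) = toGraph T x - toGraph T y := by
  refine Subtype.ext ?_
  simp only [toGraph, T.map_sub, AddSubgroupClass.coe_sub]
  rfl

variable [CompleteSpace H]

/-- `B*` as a bounded operator on `D(A*)` with its graph norm. -/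
def ControlOp.starCLM {S : C0Group 𝕜 H} (B : ControlOp S U) : graphSpace S.adjGen →L[𝕜] U :=
  ((InnerProductSpace.toDual 𝕜 U).symm.toContinuousLinearEquiv :
    (U →L[𝕜] 𝕜) →L⋆[𝕜] U).comp (ContinuousLinearMap.flip B)

theorem ControlOp.starCLM_toGraph {S : C0Group 𝕜 H} (B : ControlOp S U) (x : S.adjGen.domain) :
    B.starCLM (toGraph S.adjGen x) = B.star x := rfl

theorem ControlOp.star_sub {S : C0Group 𝕜 H} (B : ControlOp S U) (x y : S.adjGen.domain) :
    B.star (x - y) = B.star x - B.star y := by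
  simp only [← B.starCLM_toGraph, toGraph_sub, map_sub]

theorem C0Group.adjMap_sub (S : C0Group 𝕜 H) (t : ℝ) (x y : S.adjGen.domain) :
    S.adjMap t (x - y) = S.adjMap t x - S.adjMap t y :=
  Subtype.ext (by simp [C0Group.adjMap])

theorem C0Group.adjMap_add (S : C0Group 𝕜 H) (s t : ℝ) (x : S.adjGen.domain) :
    S.adjMap (s + t) x = S.adjMap s (S.adjMap t x) := by
  refine Subtype.ext ?_
  simp only [C0Group.adjMap]
  rw [add_comm, S.map_add, ContinuousLinearMap.adjoint_comp]
  rfl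

variable [NormedSpace ℝ H] [IsScalarTower ℝ 𝕜 H]

theorem C0Group.adjGen_adjMap (S : C0Group 𝕜 H) (t : ℝ) (x : S.adjGen.domain) :
    S.adjGen (S.adjMap t x) = S.adjGroup.toFun (-t) (S.adjGen x) := by
  have h := S.hasGenerator_adjGen x
  have h1 := S.adjGroup.hasGenerator_map (-t) ⟨x, h.mem⟩
  rw [show S.adjGroup.generator ⟨x, h.mem⟩ = -S.adjGen x from h.generator_eq _] at h1
  have h2 := S.hasGenerator_adjGen (S.adjMap t x)
  have h3 : ((S.adjMap t x : S.adjGen.domain) : H) = S.adjGroup.toFun (-t) (x : H) := by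
    simp [C0Group.adjMap, C0Group.adjGroup_toFun]
  rw [h3] at h2
  have h4 := h2.unique h1
  rw [map_neg] at h4
  exact neg_injective h4

theorem C0Group.continuous_toGraph_adjMap (S : C0Group 𝕜 H) (x : S.adjGen.domain) :
    Continuous fun t => toGraph S.adjGen (S.adjMap t x) := by
  refine Continuous.subtype_mk ?_ _
  refine (WithLp.prod_continuous_toLp 2 H H).comp (Continuous.prodMk ?_ ?_)
  · have h : ∀ t, ((S.adjMap t x : S.adjGen.domain) : H) = S.adjGroup.toFun (-t) (x : H) := by
      intro t
      simp [C0Group.adjMap, C0Group.adjGroup_toFun]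
    simp only [h]
    exact (S.adjGroup.continuous_orbit _).comp continuous_neg
  · simp only [S.adjGen_adjMap]
    exact (S.adjGroup.continuous_orbit _).comp continuous_neg

theorem ControlOp.continuous_star_adjMap {S : C0Group 𝕜 H} (B : ControlOp S U)
    (x : S.adjGen.domain) : Continuous fun t => B.star (S.adjMap t x) := by
  simp only [← B.starCLM_toGraph]
  exact B.starCLM.continuous.comp (S.continuous_toGraph_adjMap x)

/-- Admissibility of `B` is observability of `B*` along the adjoint orbits. -/
theorem ControlOp.IsAdmissible.exists_eLpNorm_le {S : C0Group 𝕜 H} {B : ControlOp S U}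
    (hB : B.IsAdmissible) {T : ℝ} (hT : 0 < T) : ∃ C : ℝ, ∀ x : S.adjGen.domain,
      eLpNorm (fun s => B.star (S.adjMap (T - s) x)) 2 (volume.restrict (Ioo 0 T)) ≤
        ENNReal.ofReal (C * ‖(x : H)‖) := by
  have hc : ∀ x : S.adjGen.domain, Continuous fun s => B.star (S.adjMap (T - s) x) := fun x =>
    (B.continuous_star_adjMap x).comp (continuous_const.sub continuous_id)
  have hmem : ∀ x : S.adjGen.domain,
      MemLp (fun s => B.star (S.adjMap (T - s) x)) 2 (volume.restrict (Ioo 0 T)) := fun x =>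
    memLp_of_continuous (hc x) 2 T
  set F : S.adjGen.domain → Lp U 2 (volume.restrict (Ioo 0 T)) := fun x => (hmem x).toLp _ with hF
  -- Admissibility at time `T` represents `x ↦ ⟨F x, u⟩` by a vector `h` of `H`. Its continuous
  -- dependence on `u` is not needed.
  have key : ∀ u : Lp U 2 (volume.restrict (Ioo 0 T)), ∃ h : H, ∀ x : S.adjGen.domain,
      inner 𝕜 (F x) u = inner 𝕜 (x : H) h := by
    intro u
    obtain ⟨φ, -, hφ⟩ := hB T hT u (Lp.memLp u)
    refine ⟨φ T, fun x => ?_⟩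
    have h1 := hφ T ⟨hT.le, le_rfl⟩ x
    rw [pivot_apply, intervalIntegral.integral_of_le hT.le, integral_Ioc_eq_integral_Ioo] at h1
    rw [h1, L2.inner_def]
    refine integral_congr_ae ?_
    filter_upwards [(hmem x).coeFn_toLp] with s hs
    rw [hs, B.inner_star]
  -- The functionals `F x / ‖x‖` on `L²` are bounded at each `u` by the norm of the representing
  -- vector, hence uniformly bounded.
  obtain ⟨C, hC⟩ := banach_steinhaus
    (g := fun x : S.adjGen.domain => ((‖(x : H)‖⁻¹ : ℝ) : 𝕜) • innerSL 𝕜 (F x)) fun u => by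
      obtain ⟨h, hh⟩ := key u
      refine ⟨‖h‖, fun x => ?_⟩
      rw [_root_.smul_apply, innerSL_apply_apply, hh x, norm_smul, RCLike.norm_ofReal,
        abs_of_nonneg (by positivity)]
      calc ‖(x : H)‖⁻¹ * ‖inner 𝕜 (x : H) h‖ ≤ ‖(x : H)‖⁻¹ * (‖(x : H)‖ * ‖h‖) := by
            gcongr
            exact norm_inner_le_norm _ _
        _ = (‖(x : H)‖⁻¹ * ‖(x : H)‖) * ‖h‖ := by ring
        _ ≤ 1 * ‖h‖ := by
            gcongr
            exact inv_mul_le_one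
        _ = ‖h‖ := one_mul _
  have hbound : ∀ x, ‖F x‖ ≤ C * ‖(x : H)‖ := by
    intro x
    by_cases hx : (x : H) = 0
    · obtain ⟨h, hh⟩ := key (F x)
      have h1 := hh x
      rw [hx, inner_zero_left, inner_self_eq_zero] at h1
      rw [h1, hx]; simp
    · have h1 := hC x
      have hx' : 0 < ‖(x : H)‖ := norm_pos_iff.2 hx
      rw [norm_smul, RCLike.norm_ofReal, abs_of_nonneg (by positivity), innerSL_apply_norm] at h1
      rwa [inv_mul_le_iff₀ hx', mul_comm] at h1
  refine ⟨C, fun x => ?_⟩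
  have h1 := hbound x
  rw [hF, Lp.norm_toLp] at h1
  exact (ENNReal.le_ofReal_iff_toReal_le (hmem x).eLpNorm_ne_top
    ((ENNReal.toReal_nonneg).trans h1)).2 h1

/-- Admissibility observes the orbit `S(T - t)* x`, whereas the flow of `-A*` requires `S(-t)* x`.
Replacing `x` by `S(-T)* x`, which is possible in a group, converts one into the other. -/
theorem ControlOp.IsAdmissible.exists_lintegral_le {S : C0Group 𝕜 H} {B : ControlOp S U}
    (hB : B.IsAdmissible) {T : ℝ} (hT : 0 < T) : ∃ K : ℝ≥0, ∀ x : S.adjGen.domain,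
      ∫⁻ t in Ioo 0 T, ‖B.star (S.adjMap (-t) x)‖ₑ ^ 2 ≤ K * ‖(x : H)‖ₑ ^ 2 := by
  obtain ⟨C, hC⟩ := hB.exists_eLpNorm_le hT
  set L := ContinuousLinearMap.adjoint (S.toFun (-T)) with hL
  refine ⟨(Real.toNNReal (|C| * ‖L‖)) ^ 2, fun x => ?_⟩
  have h1 : ∀ t, B.star (S.adjMap (-t) x) = B.star (S.adjMap (T - t) (S.adjMap (-T) x)) := by
    intro t
    rw [← S.adjMap_add]
    congr 2; ring
  simp only [h1]
  rw [← eLpNorm_two_sq (volume.restrict (Ioo 0 T))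
    (fun t => B.star (S.adjMap (T - t) (S.adjMap (-T) x)))]
  rw [ENNReal.coe_pow, ← mul_pow]
  refine pow_le_pow_left' ((hC _).trans ?_) 2
  rw [← ofReal_norm, ← ENNReal.ofReal, ← ENNReal.ofReal_mul (by positivity)]
  refine ENNReal.ofReal_le_ofReal ?_
  have h2 : ‖((S.adjMap (-T) x : S.adjGen.domain) : H)‖ ≤ ‖L‖ * ‖(x : H)‖ :=
    ContinuousLinearMap.le_opNorm _ _
  calc C * ‖((S.adjMap (-T) x : S.adjGen.domain) : H)‖
      ≤ |C| * ‖((S.adjMap (-T) x : S.adjGen.domain) : H)‖ := by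
        gcongr
        exact le_abs_self C
    _ ≤ |C| * (‖L‖ * ‖(x : H)‖) := by gcongr
    _ = |C| * ‖L‖ * ‖(x : H)‖ := by ring

end Observability

/-! ### Construction of the observation of a mild solution -/

section Observation

variable {𝕜 : Type*} [RCLike 𝕜]
variable {H : Type*} [NormedAddCommGroup H] [InnerProductSpace 𝕜 H] [CompleteSpace H]
variable {U : Type*} [NormedAddCommGroup U] [InnerProductSpace 𝕜 U] [CompleteSpace U]
variable [NormedSpace ℝ H]

/-- The curve given by Duhamel's formula. -/
def C0Group.duhamel (S : C0Group 𝕜 H) (x : H) (g : ℝ → H) (t : ℝ) : H :=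
  S.toFun t (x + ∫ s in (0 : ℝ)..t, S.toFun (-s) (g s))

theorem C0Group.continuous_duhamel (S : C0Group 𝕜 H) (x : H) {g : ℝ → H} (hg : Continuous g) :
    Continuous (S.duhamel x g) := by
  have hgc : Continuous fun s => S.toFun (-s) (g s) := S.continuous_comp continuous_neg hg
  exact S.continuous_comp continuous_id (continuous_const.add
    (intervalIntegral.continuous_primitive (fun a b => hgc.intervalIntegrable a b) 0))

variable [IsScalarTower ℝ 𝕜 H]

theorem C0Group.mean_duhamel (S : C0Group 𝕜 H) (x : H) {g : ℝ → H} (hg : Continuous g)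
    (ε t : ℝ) : S.mean ε (S.duhamel x g t) = S.duhamel (S.mean ε x) (fun s => S.mean ε (g s)) t := by
  have hgc : Continuous fun s => S.toFun (-s) (g s) := S.continuous_comp continuous_neg hg
  rw [C0Group.duhamel, C0Group.duhamel, S.mean_comm, _root_.map_add (S.mean ε),
    ← ContinuousLinearMap.intervalIntegral_comp_comm _ (hgc.intervalIntegrable _ _)]
  simp only [S.mean_comm]

/-- The mean of the adjoint group, as a map into `D(A*)`. -/
def C0Group.adjMean (S : C0Group 𝕜 H) (ε : ℝ) (x : H) : S.adjGen.domain :=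
  ⟨S.adjGroup.mean ε x, (S.adjGen_of_hasGenerator (S.adjGroup.hasGenerator_mean ε x)).1⟩

theorem C0Group.coe_adjMean (S : C0Group 𝕜 H) (ε : ℝ) (x : H) :
    (S.adjMean ε x : H) = S.adjGroup.mean ε x := rfl

theorem C0Group.adjGen_adjMean (S : C0Group 𝕜 H) (ε : ℝ) (x : H) :
    S.adjGen (S.adjMean ε x) = -(ε⁻¹ • (S.adjGroup.toFun ε x - x)) :=
  (S.adjGen_of_hasGenerator (S.adjGroup.hasGenerator_mean ε x)).2

/-- The mean of the adjoint group, as a bounded operator into `D(A*)` with its graph norm. -/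
def C0Group.meanGraph (S : C0Group 𝕜 H) (ε : ℝ) : H →L[𝕜] graphSpace S.adjGen :=
  (((WithLp.prodContinuousLinearEquiv 2 𝕜 H H).symm : H × H →L[𝕜] WithLp 2 (H × H)).comp
    ((S.adjGroup.mean ε).prod
      (-(((ε⁻¹ : ℝ) : 𝕜) • (S.adjGroup.toFun ε - ContinuousLinearMap.id 𝕜 H))))).codRestrict
    (graphSpace S.adjGen) fun x => by
      refine (LinearPMap.mem_graph_iff _).2 ⟨S.adjMean ε x, rfl, ?_⟩
      rw [S.adjGen_adjMean, RCLike.real_smul_eq_coe_smul (K := 𝕜)]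
      rfl

theorem C0Group.meanGraph_apply (S : C0Group 𝕜 H) (ε : ℝ) (x : H) :
    S.meanGraph ε x = toGraph S.adjGen (S.adjMean ε x) := by
  refine Subtype.ext ?_
  simp only [toGraph, S.adjGen_adjMean, RCLike.real_smul_eq_coe_smul (K := 𝕜)]
  rfl

/-- The observation `B*` composed with a mean of the adjoint group. -/
def ControlOp.starMean {S : C0Group 𝕜 H} (B : ControlOp S U) (ε : ℝ) : H →L[𝕜] U :=
  B.starCLM.comp (S.meanGraph ε)

theorem ControlOp.starMean_apply {S : C0Group 𝕜 H} (B : ControlOp S U) (ε : ℝ) (x : H) :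
    B.starMean ε x = B.star (S.adjMean ε x) := by
  rw [← B.starCLM_toGraph, ← S.meanGraph_apply]; rfl

theorem C0Group.adjMean_adjGroup (S : C0Group 𝕜 H) (ε t : ℝ) (x : H) :
    S.adjMean ε (S.adjGroup.toFun t x) = S.adjMap (-t) (S.adjMean ε x) := by
  refine Subtype.ext ?_
  rw [S.coe_adjMean, S.adjGroup.mean_comm]
  rfl

/-- Means commute with the group, so observing their difference along the orbit of `x` is observing
the orbit of a difference of means of `x`, which lies in `D(A*)`. The bound involves only the norm
of `H` and is uniform in `ε` and `δ`. -/
theorem ControlOp.IsAdmissible.exists_lintegral_starMean_le {S : C0Group 𝕜 H} {B : ControlOp S U}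
    (hB : B.IsAdmissible) {T : ℝ} (hT : 0 < T) : ∃ K : ℝ≥0, ∀ (ε δ : ℝ) (x : H),
      ∫⁻ t in Ioo 0 T, ‖(B.starMean ε - B.starMean δ) (S.adjGroup.toFun t x)‖ₑ ^ 2 ≤
        K * ‖S.adjGroup.mean ε x - S.adjGroup.mean δ x‖ₑ ^ 2 := by
  obtain ⟨K, hK⟩ := hB.exists_lintegral_le hT
  refine ⟨K, fun ε δ x => ?_⟩
  have h := hK (S.adjMean ε x - S.adjMean δ x)
  simp only [S.adjMap_sub, B.star_sub, ← S.adjMean_adjGroup, ← B.starMean_apply] at h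
  exact h

/-- A sequence in `L²` whose distances are controlled by a null sequence converges. -/
theorem exists_tendsto_eLpNorm_two {μ : Measure ℝ} {f : ℕ → ℝ → U} (hf : ∀ n, MemLp (f n) 2 μ)
    {b : ℕ → ℝ≥0∞} (hb : Tendsto b atTop (𝓝 0))
    (h : ∀ n m, eLpNorm (f n - f m) 2 μ ^ 2 ≤ b n + b m) :
    ∃ v, MemLp v 2 μ ∧ Tendsto (fun n => eLpNorm (f n - v) 2 μ) atTop (𝓝 0) := by
  have hcs : CauchySeq fun n => (hf n).toLp := by
    rw [EMetric.cauchySeq_iff]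
    intro ε hε
    obtain ⟨ε', hε', hlt⟩ := exists_between hε
    have hpos : 0 < ε' ^ 2 / 2 := ENNReal.div_pos (by positivity) (by simp)
    obtain ⟨N, hN⟩ := eventually_atTop.1 (hb.eventually (gt_mem_nhds hpos))
    refine ⟨N, fun m hm n hn => ?_⟩
    rw [Lp.edist_toLp_toLp]
    refine lt_of_le_of_lt ?_ hlt
    have h1 : eLpNorm (f m - f n) 2 μ ^ 2 ≤ ε' ^ 2 := by
      refine (h m n).trans ?_
      calc b m + b n ≤ ε' ^ 2 / 2 + ε' ^ 2 / 2 := add_le_add (hN m hm).le (hN n hn).le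
        _ = ε' ^ 2 := ENNReal.add_halves _
    exact le_of_not_gt fun hcon => absurd h1 (not_le.2 (ENNReal.pow_lt_pow_left two_ne_zero hcon))
  obtain ⟨v, hv⟩ := cauchySeq_tendsto_of_complete hcs
  refine ⟨v, Lp.memLp v, ?_⟩
  rw [← Lp.tendsto_Lp_iff_tendsto_eLpNorm'' f hf v (Lp.memLp v), Lp.toLp_coeFn]
  exact hv

variable [NormedSpace ℝ U]

theorem enorm_add_sq_le {E : Type*} [NormedAddCommGroup E] (a b : E) :
    ‖a + b‖ₑ ^ 2 ≤ 2 * ‖a‖ₑ ^ 2 + 2 * ‖b‖ₑ ^ 2 := by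
  have h1 : ‖a + b‖₊ ^ 2 ≤ 2 * ‖a‖₊ ^ 2 + 2 * ‖b‖₊ ^ 2 := by
    rw [← NNReal.coe_le_coe]
    push_cast
    nlinarith [norm_add_le a b, norm_nonneg (a + b), sq_nonneg (‖a‖ - ‖b‖), norm_nonneg a,
      norm_nonneg b]
  simp only [enorm_eq_nnnorm]
  exact_mod_cast h1

theorem enorm_sub_sq_le {E : Type*} [NormedAddCommGroup E] (a b : E) :
    ‖a - b‖ₑ ^ 2 ≤ 2 * ‖a‖ₑ ^ 2 + 2 * ‖b‖ₑ ^ 2 := by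
  rw [sub_eq_add_neg, ← enorm_neg b]
  exact enorm_add_sq_le a (-b)

/-- A convolution estimate. -/
theorem lintegral_convolution_le {h : ℝ → ℝ → ℝ≥0∞} (hm : Measurable (Function.uncurry h)) (T : ℝ) :
    ∫⁻ t in Ioo 0 T, ∫⁻ s in Ioc 0 t, h (t - s) s ≤
      ∫⁻ s in Ioo 0 T, ∫⁻ r in Ioo 0 T, h r s := by
  -- The cut-off in `r = t - s` records the constraint `r < T`, so that the `t`-integral may be
  -- enlarged to the whole line before exchanging and translating.
  set h' : ℝ → ℝ → ℝ≥0∞ := fun r s => (Ioo 0 T).indicator (fun r => h r s) r with hh'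
  have hm' : Measurable (Function.uncurry h') := by
    have : Function.uncurry h' = (Prod.fst ⁻¹' Ioo 0 T).indicator (Function.uncurry h) := by
      funext p
      change (Ioo 0 T).indicator (fun r => h r p.2) p.1 = _
      by_cases hp : p.1 ∈ Ioo 0 T
      · rw [indicator_of_mem (show p ∈ Prod.fst ⁻¹' Ioo 0 T from hp)]
        exact indicator_of_mem hp _
      · rw [indicator_of_notMem (show p ∉ Prod.fst ⁻¹' Ioo 0 T from hp)]
        exact indicator_of_notMem hp _
    rw [this]
    exact hm.indicator (measurable_fst measurableSet_Ioo)
  have h1 : ∀ t ∈ Ioo 0 T, ∫⁻ s in Ioc 0 t, h (t - s) s ≤ ∫⁻ s in Ioo 0 T, h' (t - s) s := by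
    intro t ht
    rw [← setLIntegral_congr Ioo_ae_eq_Ioc]
    calc ∫⁻ s in Ioo 0 t, h (t - s) s = ∫⁻ s in Ioo 0 t, h' (t - s) s := by
          refine setLIntegral_congr_fun measurableSet_Ioo fun s hs => ?_
          simp only [hh']
          rw [indicator_of_mem]
          exact ⟨by linarith [hs.2], by linarith [hs.1, ht.2]⟩
      _ ≤ _ := lintegral_mono_set (Ioo_subset_Ioo_right ht.2.le)
  have hm2 : Measurable (Function.uncurry fun t s : ℝ => h' (t - s) s) :=
    hm'.comp ((measurable_fst.sub measurable_snd).prodMk measurable_snd)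
  calc ∫⁻ t in Ioo 0 T, ∫⁻ s in Ioc 0 t, h (t - s) s
      ≤ ∫⁻ t in Ioo 0 T, ∫⁻ s in Ioo 0 T, h' (t - s) s :=
        setLIntegral_mono' measurableSet_Ioo h1
    _ ≤ ∫⁻ t, ∫⁻ s in Ioo 0 T, h' (t - s) s := setLIntegral_le_lintegral _ _
    _ = ∫⁻ s in Ioo 0 T, ∫⁻ t, h' (t - s) s := lintegral_lintegral_swap hm2.aemeasurable
    _ = ∫⁻ s in Ioo 0 T, ∫⁻ r in Ioo 0 T, h r s := by
        refine lintegral_congr fun s => ?_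
        rw [lintegral_sub_right_eq_self (fun r => h' r s) s, hh',
          lintegral_indicator measurableSet_Ioo]

/-- Duhamel's formula is observed term by term. The initial value is handled by `hK`; for the
source, Cauchy–Schwarz in `s` produces the factor `T`, and the convolution estimate reduces it to
`hK` at each `g s`. -/
theorem ControlOp.lintegral_starMean_duhamel_le {S : C0Group 𝕜 H} (B : ControlOp S U) {T : ℝ}
    {K : ℝ≥0} {ε δ : ℝ}
    (hK : ∀ x : H, ∫⁻ t in Ioo 0 T,
      ‖(B.starMean ε - B.starMean δ) (S.adjGroup.toFun t x)‖ₑ ^ 2 ≤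
        K * ‖S.adjGroup.mean ε x - S.adjGroup.mean δ x‖ₑ ^ 2)
    (x : H) {g : ℝ → H} (hg : Continuous g) :
    ∫⁻ t in Ioo 0 T, ‖(B.starMean ε - B.starMean δ) (S.adjGroup.duhamel x g t)‖ₑ ^ 2 ≤
      2 * (K * ‖S.adjGroup.mean ε x - S.adjGroup.mean δ x‖ₑ ^ 2) + 2 * (ENNReal.ofReal T *
        ∫⁻ s in Ioo 0 T, K * ‖S.adjGroup.mean ε (g s) - S.adjGroup.mean δ (g s)‖ₑ ^ 2) := by
  set D := B.starMean ε - B.starMean δ with hD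
  set h : ℝ → ℝ → ℝ≥0∞ := fun r s => ‖D (S.adjGroup.toFun r (g s))‖ₑ ^ 2 with hh
  have hcont : Continuous fun p : ℝ × ℝ => D (S.adjGroup.toFun p.1 (g p.2)) :=
    D.continuous.comp (S.adjGroup.continuous_comp continuous_fst (hg.comp continuous_snd))
  have hm : Measurable (Function.uncurry h) := by
    have := (ENNReal.continuous_pow 2).comp hcont.enorm
    exact this.measurable
  have hgc : Continuous fun s => S.adjGroup.toFun (-s) (g s) :=
    S.adjGroup.continuous_comp continuous_neg hg
  have hdec : ∀ t, D (S.adjGroup.duhamel x g t) = D (S.adjGroup.toFun t x) +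
      ∫ s in (0 : ℝ)..t, D (S.adjGroup.toFun (t - s) (g s)) := by
    intro t
    rw [C0Group.duhamel, _root_.map_add, _root_.map_add,
      ← ContinuousLinearMap.intervalIntegral_comp_comm _ (hgc.intervalIntegrable _ _)]
    simp only [← S.adjGroup.apply_add, ← sub_eq_add_neg]
    rw [ContinuousLinearMap.intervalIntegral_comp_comm]
    refine Continuous.intervalIntegrable ?_ _ _
    exact S.adjGroup.continuous_comp (continuous_const.sub continuous_id) hg
  have hsq : ∀ t ∈ Ioo 0 T, ‖∫ s in (0 : ℝ)..t, D (S.adjGroup.toFun (t - s) (g s))‖ₑ ^ 2 ≤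
      ENNReal.ofReal T * ∫⁻ s in Ioc 0 t, h (t - s) s := by
    intro t ht
    rw [intervalIntegral.integral_of_le ht.1.le]
    refine (pow_le_pow_left' (enorm_integral_le_lintegral_enorm _) 2).trans ?_
    have hcm : Continuous fun s => ‖D (S.adjGroup.toFun (t - s) (g s))‖ₑ :=
      (hcont.comp ((continuous_const.sub continuous_id).prodMk continuous_id)).enorm
    refine (lintegral_sq_le _ hcm.aemeasurable).trans ?_
    refine mul_le_mul' ?_ le_rfl
    rw [Measure.restrict_apply_univ, Real.volume_Ioc, sub_zero]
    exact ENNReal.ofReal_le_ofReal ht.2.le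
  have hm1 : Measurable fun t => 2 * ‖D (S.adjGroup.toFun t x)‖ₑ ^ 2 := by
    have := (ENNReal.continuous_pow 2).comp
      (D.continuous.comp (S.adjGroup.continuous_orbit x)).enorm
    exact this.measurable.const_mul 2
  calc ∫⁻ t in Ioo 0 T, ‖D (S.adjGroup.duhamel x g t)‖ₑ ^ 2
      ≤ ∫⁻ t in Ioo 0 T, (2 * ‖D (S.adjGroup.toFun t x)‖ₑ ^ 2 +
          2 * (ENNReal.ofReal T * ∫⁻ s in Ioc 0 t, h (t - s) s)) := by
        refine setLIntegral_mono' measurableSet_Ioo fun t ht => ?_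
        rw [hdec]
        refine (enorm_add_sq_le _ _).trans ?_
        gcongr
        exact hsq t ht
    _ = 2 * (∫⁻ t in Ioo 0 T, ‖D (S.adjGroup.toFun t x)‖ₑ ^ 2) +
          2 * (ENNReal.ofReal T * ∫⁻ t in Ioo 0 T, ∫⁻ s in Ioc 0 t, h (t - s) s) := by
        rw [lintegral_add_left hm1, lintegral_const_mul' _ _ (by simp),
          lintegral_const_mul' _ _ (by simp), lintegral_const_mul' _ _ (by simp)]
    _ ≤ _ := add_le_add (mul_le_mul' le_rfl (hK x)) (mul_le_mul' le_rfl (mul_le_mul' le_rfl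
        ((lintegral_convolution_le hm T).trans (lintegral_mono fun s => hK (g s)))))

theorem C0Group.tendsto_mean_one_div (S : C0Group 𝕜 H) (x : H) :
    Tendsto (fun n : ℕ => S.mean (1 / ((n : ℝ) + 1)) x) atTop (𝓝 x) := by
  refine (S.tendsto_mean x).comp (tendsto_nhdsWithin_iff.2
    ⟨tendsto_one_div_add_atTop_nhds_zero_nat, Eventually.of_forall fun n => ?_⟩)
  have : (0 : ℝ) < 1 / ((n : ℝ) + 1) := by positivity
  exact this.ne'

theorem C0Group.tendsto_lintegral_mean_sub (S : C0Group 𝕜 H) {g : ℝ → H} (hg : Continuous g)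
    (T : ℝ) {k : ℕ} (hk : k ≠ 0) :
    Tendsto (fun n : ℕ => ∫⁻ s in Ioo 0 T, ‖S.mean (1 / ((n : ℝ) + 1)) (g s) - g s‖ₑ ^ k) atTop
      (𝓝 0) := by
  obtain ⟨M, hM, hb⟩ := S.exists_bound 1
  have h1 : ∀ (n : ℕ) (s : ℝ), ‖S.mean (1 / ((n : ℝ) + 1)) (g s) - g s‖ ≤ (M + 1) * ‖g s‖ := by
    intro n s
    refine (norm_sub_le _ _).trans ?_
    have h2 : 1 / ((n : ℝ) + 1) ≤ 1 := by
      rw [div_le_one (by positivity)]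
      have : (0 : ℝ) ≤ n := n.cast_nonneg
      linarith
    have := S.norm_mean_le hb (show (0 : ℝ) < 1 / ((n : ℝ) + 1) by positivity) h2 (g s)
    linarith
  have hbc : Continuous fun s => (Real.toNNReal ((M + 1) * ‖g s‖)) ^ k :=
    (continuous_real_toNNReal.comp (continuous_const.mul hg.norm)).pow k
  have h := tendsto_lintegral_of_dominated_convergence (μ := volume.restrict (Ioo 0 T))
    (F := fun (n : ℕ) s => ‖S.mean (1 / ((n : ℝ) + 1)) (g s) - g s‖ₑ ^ k) (f := fun _ => 0)
    (fun s => (((Real.toNNReal ((M + 1) * ‖g s‖)) ^ k : ℝ≥0) : ℝ≥0∞)) ?_ ?_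
    (lintegral_Ioo_lt_top_of_continuous hbc T).ne ?_
  · simpa using h
  · intro n
    have hc : Continuous fun s => S.mean (1 / ((n : ℝ) + 1)) (g s) - g s :=
      ((S.mean _).continuous.comp hg).sub hg
    exact ((ENNReal.continuous_pow k).comp hc.enorm).measurable
  · intro n
    refine Eventually.of_forall fun s => ?_
    simp only [ENNReal.coe_pow]
    refine pow_le_pow_left' ?_ k
    rw [← ofReal_norm]
    exact ENNReal.ofReal_le_ofReal (h1 n s)
  · refine Eventually.of_forall fun s => ?_
    have h3 : Tendsto (fun n : ℕ => S.mean (1 / ((n : ℝ) + 1)) (g s) - g s) atTop (𝓝 0) := by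
      simpa using (S.tendsto_mean_one_div (g s)).sub_const (g s)
    have h4 := (((ENNReal.continuous_pow k).comp continuous_enorm).tendsto (0 : H)).comp h3
    simpa [Function.comp_def, hk] using h4

/-- Admissibility yields the observation of a solution given by Duhamel's formula. -/
theorem ControlOp.IsAdmissible.exists_isObservation {S : C0Group 𝕜 H} {B : ControlOp S U}
    (hB : B.IsAdmissible) {T : ℝ} (hT : 0 < T) (x : H) {g : ℝ → H} (hg : Continuous g) :
    ∃ v, IsObservation B T (S.adjGroup.duhamel x g) g v := by
  obtain ⟨K, hK⟩ := hB.exists_lintegral_starMean_le hT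
  set e : ℕ → ℝ := fun n => 1 / ((n : ℝ) + 1) with he
  set z := S.adjGroup.duhamel x g with hz
  have hzc : Continuous z := S.adjGroup.continuous_duhamel x hg
  set f : ℕ → ℝ → U := fun n t => B.starMean (e n) (z t) with hf
  have hfm : ∀ n, MemLp (f n) 2 (volume.restrict (Ioo 0 T)) := fun n =>
    memLp_of_continuous ((B.starMean (e n)).continuous.comp hzc) 2 T
  -- This sequence results from comparing two means through the identity, `M_n y - M_m y = (M_n y -
  -- y) - (M_m y - y)`, which causes the inner factors `2`; the outer ones separate initial value
  -- and source.
  set a : ℕ → ℝ≥0∞ := fun n => 2 * (K * (2 * ‖S.adjGroup.mean (e n) x - x‖ₑ ^ 2)) +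
    2 * (ENNReal.ofReal T * (K * (2 * ∫⁻ s in Ioo 0 T,
      ‖S.adjGroup.mean (e n) (g s) - g s‖ₑ ^ 2))) with ha
  have ha0 : Tendsto a atTop (𝓝 0) := by
    have h1 : Tendsto (fun n => ‖S.adjGroup.mean (e n) x - x‖ₑ ^ 2) atTop (𝓝 0) := by
      have h3 := (S.adjGroup.tendsto_mean_one_div x).sub_const x
      rw [sub_self] at h3
      have h4 := (((ENNReal.continuous_pow 2).comp continuous_enorm).tendsto (0 : H)).comp h3
      simpa [Function.comp_def, he] using h4
    have h2 := S.adjGroup.tendsto_lintegral_mean_sub hg T (k := 2) (by norm_num)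
    have hmul : ∀ {u : ℕ → ℝ≥0∞} (c : ℝ≥0∞), c ≠ ∞ → Tendsto u atTop (𝓝 0) →
        Tendsto (fun n => c * u n) atTop (𝓝 0) := by
      intro u c hc hu
      simpa using ENNReal.Tendsto.const_mul hu (Or.inr hc)
    have h5 := (hmul 2 (by simp) (hmul K (by simp) (hmul 2 (by simp) h1))).add
      (hmul 2 (by simp) (hmul (ENNReal.ofReal T) (by simp) (hmul K (by simp)
        (hmul 2 (by simp) h2))))
    simp only [add_zero] at h5
    exact h5
  have hsplit : ∀ (n m : ℕ) (y : H), ‖S.adjGroup.mean (e n) y - S.adjGroup.mean (e m) y‖ₑ ^ 2 ≤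
      2 * ‖S.adjGroup.mean (e n) y - y‖ₑ ^ 2 + 2 * ‖S.adjGroup.mean (e m) y - y‖ₑ ^ 2 := by
    intro n m y
    rw [← sub_sub_sub_cancel_right _ _ y]
    exact enorm_sub_sq_le _ _
  have hbound : ∀ n m, eLpNorm (f n - f m) 2 (volume.restrict (Ioo 0 T)) ^ 2 ≤ a n + a m := by
    intro n m
    rw [eLpNorm_two_sq]
    have h1 := B.lintegral_starMean_duhamel_le (hK (e n) (e m)) x hg
    refine h1.trans ?_
    have hmeas : Measurable fun s => 2 * ‖S.adjGroup.mean (e n) (g s) - g s‖ₑ ^ 2 := by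
      have hc : Continuous fun s => S.adjGroup.mean (e n) (g s) - g s :=
        ((S.adjGroup.mean _).continuous.comp hg).sub hg
      exact ((ENNReal.continuous_pow 2).comp hc.enorm).measurable.const_mul 2
    have h2 : ∫⁻ s in Ioo 0 T, K * ‖S.adjGroup.mean (e n) (g s) - S.adjGroup.mean (e m) (g s)‖ₑ ^ 2
        ≤ K * (2 * (∫⁻ s in Ioo 0 T, ‖S.adjGroup.mean (e n) (g s) - g s‖ₑ ^ 2) +
          2 * ∫⁻ s in Ioo 0 T, ‖S.adjGroup.mean (e m) (g s) - g s‖ₑ ^ 2) := by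
      rw [lintegral_const_mul' _ _ (by simp)]
      gcongr
      refine (lintegral_mono fun s => hsplit n m (g s)).trans ?_
      rw [lintegral_add_left hmeas, lintegral_const_mul' _ _ (by simp),
        lintegral_const_mul' _ _ (by simp)]
    calc _ ≤ 2 * (K * (2 * ‖S.adjGroup.mean (e n) x - x‖ₑ ^ 2 +
          2 * ‖S.adjGroup.mean (e m) x - x‖ₑ ^ 2)) + 2 * (ENNReal.ofReal T *
          (K * (2 * (∫⁻ s in Ioo 0 T, ‖S.adjGroup.mean (e n) (g s) - g s‖ₑ ^ 2) +
          2 * ∫⁻ s in Ioo 0 T, ‖S.adjGroup.mean (e m) (g s) - g s‖ₑ ^ 2))) := by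
          gcongr
          exact hsplit n m x
      _ = a n + a m := by
          simp only [ha]; ring
  obtain ⟨v, hv, hlim⟩ := exists_tendsto_eLpNorm_two hfm ha0 hbound
  -- The regular approximations are the means of the solution and of the source: a mean commutes
  -- with Duhamel's formula, so the former solves the equation with the latter.
  refine ⟨v, hv, fun n t => S.adjMean (e n) (z t), fun n t => S.adjMean (e n) (g t),
    fun n => ?_, fun n => ?_, fun n => ⟨?_, fun φ => ?_⟩, S.adjGroup.tendsto_mean_one_div _, ?_, ?_⟩
  · simp only [← S.meanGraph_apply]
    exact ((S.meanGraph _).continuous.comp hzc).continuousOn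
  · simp only [← S.meanGraph_apply]
    exact ((S.meanGraph _).continuous.comp hg).continuousOn
  · exact ((S.adjGroup.mean _).continuous.comp hzc).continuousOn
  · have hmg : Continuous fun s => S.adjGroup.mean (e n) (g s) :=
      (S.adjGroup.mean _).continuous.comp hg
    have hmz : Continuous fun s => S.adjGroup.mean (e n) (z s) :=
      (S.adjGroup.mean _).continuous.comp hzc
    refine distribDeriv_of_hasDerivAt (fun t _ => ?_) ?_
    · have hφ : S.adjGroup.adjGroup.toC0Semigroup.HasGenerator (φ : H) (S.generator φ) := by
        rw [S.adjGroup_adjGroup]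
        exact S.hasGenerator_generator φ
      have := S.adjGroup.weak_of_duhamel hmg (S.adjGroup.mean (e n) x) hφ t
      simp only [S.coe_adjMean, hz, S.adjGroup.mean_duhamel x hg]
      exact this
    · exact ((continuous_const.inner hmz).neg.add (continuous_const.inner hmg)).continuousOn
  · have h := S.adjGroup.tendsto_lintegral_mean_sub hg T (k := 1) (by norm_num)
    simp only [pow_one] at h
    simp only [eLpNorm_one_eq_lintegral_enorm]
    exact h
  · refine hlim.congr fun n => ?_
    simp only [← B.starMean_apply]
    rfl

end Observation

/-! ### Passage to the limit and the equation satisfied by `Q z` -/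

section Limits

variable {𝕜 : Type*} [RCLike 𝕜]

theorem integrableOn_of_memLp {E : Type*} [NormedAddCommGroup E] {f : ℝ → E} {T : ℝ} {p : ℝ≥0∞}
    (hp : 1 ≤ p) (hf : MemLp f p (volume.restrict (Ioo 0 T))) : IntegrableOn f (Ioo 0 T) :=
  memLp_one_iff_integrable.1 (hf.mono_exponent hp)

/-- Distributional derivatives are stable under convergence in `L¹`. -/
theorem DistribDeriv.of_tendsto {T : ℝ} {F G : ℕ → ℝ → 𝕜} {f g : ℝ → 𝕜}
    (h : ∀ n, DistribDeriv T (F n) (G n)) (hf : IntegrableOn f (Ioo 0 T))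
    (hg : IntegrableOn g (Ioo 0 T))
    (hF : Tendsto (fun n => eLpNorm (F n - f) 1 (volume.restrict (Ioo 0 T))) atTop (𝓝 0))
    (hG : Tendsto (fun n => eLpNorm (G n - g) 1 (volume.restrict (Ioo 0 T))) atTop (𝓝 0)) :
    DistribDeriv T f g := by
  have hfl := hf.locallyIntegrableOn
  have hgl := hg.locallyIntegrableOn
  refine ⟨hfl, hgl, fun η hη hs hT => ?_⟩
  have hdη : Continuous (deriv η) := hη.continuous_deriv (by simp)
  have hdT : tsupport (deriv η) ⊆ Ioo 0 T := (tsupport_deriv_subset).trans hT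
  have key : ∀ (ζ : ℝ → ℝ), Continuous ζ → HasCompactSupport ζ → tsupport ζ ⊆ Ioo 0 T →
      ∀ (E : ℕ → ℝ → 𝕜) (e : ℝ → 𝕜), (∀ n, LocallyIntegrableOn (E n) (Ioo 0 T)) →
      LocallyIntegrableOn e (Ioo 0 T) →
      Tendsto (fun n => eLpNorm (E n - e) 1 (volume.restrict (Ioo 0 T))) atTop (𝓝 0) →
      Tendsto (fun n => ∫ t in Ioo 0 T, ((ζ t : ℝ) : 𝕜) * E n t) atTop
        (𝓝 (∫ t in Ioo 0 T, ((ζ t : ℝ) : 𝕜) * e t)) := by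
    intro ζ hc hs hT E e hE he hlim
    obtain ⟨C, hC⟩ := hc.bounded_above_of_compact_support hs
    refine tendsto_integral_of_L1' _ (integrableOn_testFunction_mul hc hs hT he).1
      (Eventually.of_forall fun n => integrableOn_testFunction_mul hc hs hT (hE n)) ?_
    have h1 : Tendsto (fun n => ENNReal.ofReal C *
        eLpNorm (E n - e) 1 (volume.restrict (Ioo 0 T))) atTop (𝓝 0) := by
      simpa using ENNReal.Tendsto.const_mul hlim (Or.inr (ENNReal.ofReal_ne_top (r := C)))
    refine tendsto_of_tendsto_of_tendsto_of_le_of_le tendsto_const_nhds h1 (fun _ => zero_le)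
      fun n => eLpNorm_le_mul_eLpNorm_of_ae_le_mul (Eventually.of_forall fun t => ?_) 1
    simp only [Pi.sub_apply]
    rw [← mul_sub, norm_mul, RCLike.norm_ofReal]
    exact mul_le_mul_of_nonneg_right (hC t) (norm_nonneg _)
  have h1 := key (deriv η) hdη hs.deriv hdT F f (fun n => (h n).1) hfl hF
  have h2 := key η hη.continuous hs hT G g (fun n => (h n).2.1) hgl hG
  have h3 : ∀ n, ∫ t in Ioo 0 T, ((deriv η t : ℝ) : 𝕜) * F n t =
      -∫ t in Ioo 0 T, ((η t : ℝ) : 𝕜) * G n t := fun n => (h n).2.2 η hη hs hT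
  simp only [h3] at h1
  exact tendsto_nhds_unique h1 h2.neg

variable {H : Type*} [NormedAddCommGroup H] [InnerProductSpace 𝕜 H]

/-- The bounded part `-2λ - R Q` of the closed-loop adjoint equation. -/
def perturbation (Q R : H →L[𝕜] H) (lam : ℝ) : H →L[𝕜] H :=
  -((2 * (lam : 𝕜)) • ContinuousLinearMap.id 𝕜 H) - R.comp Q

theorem perturbation_apply (Q R : H →L[𝕜] H) (lam : ℝ) (x : H) :
    perturbation Q R lam x = -((2 * (lam : 𝕜)) • x) - R (Q x) := rfl

variable [CompleteSpace H]
variable {U : Type*} [NormedAddCommGroup U] [InnerProductSpace 𝕜 U] [CompleteSpace U]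
theorem continuousOn_adjGen_of_toGraph {S : C0Group 𝕜 H} {s : Set ℝ} {z : ℝ → S.adjGen.domain}
    (hz : ContinuousOn (fun t => toGraph S.adjGen (z t)) s) :
    ContinuousOn (fun t => S.adjGen (z t)) s :=
  ((WithLp.prod_continuous_ofLp 2 H H).snd.comp continuous_subtype_val).comp_continuousOn hz

theorem continuousOn_coe_of_toGraph {S : C0Group 𝕜 H} {s : Set ℝ} {z : ℝ → S.adjGen.domain}
    (hz : ContinuousOn (fun t => toGraph S.adjGen (z t)) s) :
    ContinuousOn (fun t => (z t : H)) s :=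
  (graphInclusion S.adjGen).continuous.comp_continuousOn hz

variable [NormedSpace ℝ H] [IsScalarTower ℝ 𝕜 H]

/-- A weak solution with continuous source term is given by Duhamel's formula. -/
theorem IsWeakSolAdj.eq_duhamel {S : C0Group 𝕜 H} {T : ℝ} {z g : ℝ → H}
    (h : IsWeakSolAdj S T z g) (hg : ContinuousOn g (Icc 0 T)) {t : ℝ} (ht : t ∈ Icc 0 T) :
    z t = S.adjGroup.duhamel (z 0) g t := by
  refine S.adjGroup.duhamel_of_weak h.1 hg (fun φ ψ hφ s hs => ?_) ht
  rw [S.adjGroup_adjGroup] at hφ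
  have h1 := h.2 ⟨φ, hφ.mem⟩
  have h2 : S.generator ⟨φ, hφ.mem⟩ = ψ := hφ.generator_eq _
  rw [h2] at h1
  have hz' := h.1.mono Ioo_subset_Icc_self
  have hg' := hg.mono Ioo_subset_Icc_self
  exact h1.hasDerivAt (continuousOn_const.inner hz')
    ((continuousOn_const.inner hz').neg.add (continuousOn_const.inner hg')) hs

theorem C0Group.inner_adjGen (S : C0Group 𝕜 H) {φ ψ : H}
    (h : S.toC0Semigroup.HasGenerator φ ψ) (x : S.adjGen.domain) :
    inner 𝕜 ψ (x : H) = inner 𝕜 φ (S.adjGen x) := by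
  rw [(S.hasGenerator_adjGroup_iff _ _).1 (S.hasGenerator_adjGen x) φ ψ h, inner_neg_right,
    neg_neg]

/-- A weak solution with values in `D(A*)` is a strong solution. -/
theorem IsWeakSolAdj.hasDerivAt {S : C0Group 𝕜 H} {T : ℝ} {z g : ℝ → S.adjGen.domain}
    (h : IsWeakSolAdj S T (fun t => (z t : H)) (fun t => (g t : H)))
    (hz : ContinuousOn (fun t => toGraph S.adjGen (z t)) (Icc 0 T))
    (hg : ContinuousOn (fun t => (g t : H)) (Icc 0 T)) {t : ℝ} (ht : t ∈ Ioo 0 T) :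
    HasDerivAt (fun t => (z t : H)) (-S.adjGen (z t) + (g t : H)) t := by
  have hT : 0 < T := ht.1.trans ht.2
  have hc : T / 2 ∈ Ioo 0 T := ⟨by linarith, by linarith⟩
  set w : ℝ → H := fun t => -S.adjGen (z t) + (g t : H) with hw
  have hzc := (continuousOn_coe_of_toGraph hz).mono Ioo_subset_Icc_self
  have hgc := hg.mono Ioo_subset_Icc_self
  have hwc : ContinuousOn w (Ioo 0 T) :=
    ((continuousOn_adjGen_of_toGraph hz).mono Ioo_subset_Icc_self).neg.add hgc
  set I : ℝ → H := fun s => ∫ r in (T / 2)..s, w r with hI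
  have hId : ∀ s ∈ Ioo 0 T, HasDerivAt I (w s) s := by
    intro s hs
    have hsub : uIcc (T / 2) s ⊆ Ioo 0 T := ordConnected_Ioo.uIcc_subset hc hs
    exact intervalIntegral.integral_hasDerivAt_right (hwc.mono hsub).intervalIntegrable
      (hwc.stronglyMeasurableAtFilter isOpen_Ioo s hs) (hwc.continuousAt (Ioo_mem_nhds hs.1 hs.2))
  -- Paired with any `χ ∈ D(A)`, the difference between `z` and the primitive of the expected
  -- derivative has derivative zero, because `A` can be moved onto `z` as `A*`. Density of `D(A)`
  -- then makes it constant.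
  have hconst : ∀ s ∈ Ioo 0 T, (z s : H) - I s = (z t : H) - I t := by
    intro s hs
    refine S.dense_domain.eq_of_inner_right 𝕜 fun χ hχ => ?_
    obtain ⟨ψ, hψ⟩ := hχ
    have hd : ∀ r ∈ Ioo 0 T, HasDerivAt (fun r => inner 𝕜 χ ((z r : H) - I r)) 0 r := by
      intro r hr
      have h1 := h.2 ⟨χ, hψ.mem⟩
      have h2 : S.generator ⟨χ, hψ.mem⟩ = ψ := hψ.generator_eq _
      rw [h2] at h1
      have h3 := h1.hasDerivAt (continuousOn_const.inner hzc)
        ((continuousOn_const.inner hzc).neg.add (continuousOn_const.inner hgc)) hr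
      have h4 := HasDerivAt.inner 𝕜 (hasDerivAt_const r χ) (hId r hr)
      simp only [inner_zero_left, add_zero] at h4
      have h5 := h3.fun_sub h4
      simp only [← inner_sub_right] at h5
      have h6 : -inner 𝕜 ψ (z r : H) + inner 𝕜 χ (g r : H) - inner 𝕜 χ (w r) = 0 := by
        simp only [hw]
        rw [S.inner_adjGen hψ, inner_add_right, inner_neg_right]
        ring
      rwa [h6] at h5
    exact isOpen_Ioo.is_const_of_deriv_eq_zero isPreconnected_Ioo
      (fun r hr => (hd r hr).differentiableAt.differentiableWithinAt) (fun r hr => (hd r hr).deriv)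
      hs ht
  refine ((hId t ht).const_add ((z t : H) - I t)).congr_of_eventuallyEq ?_
  filter_upwards [Ioo_mem_nhds ht.1 ht.2] with s hs
  rw [← hconst s hs]; abel

/-- Weak solutions depend continuously on the initial value and the source term. -/
theorem IsWeakSolAdj.tendsto {S : C0Group 𝕜 H} {T : ℝ} {z g : ℝ → H} {zn gn : ℕ → ℝ → H}
    (h : IsWeakSolAdj S T z g) (hg : ContinuousOn g (Icc 0 T))
    (hn : ∀ n, IsWeakSolAdj S T (zn n) (gn n)) (hgn : ∀ n, ContinuousOn (gn n) (Icc 0 T))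
    (h0 : Tendsto (fun n => zn n 0) atTop (𝓝 (z 0)))
    (hlim : Tendsto (fun n => eLpNorm (fun t => gn n t - g t) 1 (volume.restrict (Ioo 0 T)))
      atTop (𝓝 0)) :
    Tendsto (fun n => eLpNorm (fun t => zn n t - z t) 1 (volume.restrict (Ioo 0 T)))
      atTop (𝓝 0) := by
  obtain ⟨M, hM, hb⟩ := S.adjGroup.exists_bound T
  have hop : ∀ t ∈ Icc (-T) T, ∀ x, ‖S.adjGroup.toFun t x‖ₑ ≤ ENNReal.ofReal M * ‖x‖ₑ := by
    intro t ht x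
    refine (ContinuousLinearMap.le_opENorm _ _).trans (mul_le_mul' ?_ le_rfl)
    rw [← ofReal_norm]
    exact ENNReal.ofReal_le_ofReal (hb t ht)
  have hint : ∀ {f : ℝ → H}, ContinuousOn f (Icc 0 T) → ∀ {t}, t ∈ Ioo 0 T →
      IntervalIntegrable (fun s => S.adjGroup.toFun (-s) (f s)) volume 0 t := by
    intro f hf t ht
    refine ContinuousOn.intervalIntegrable ?_
    rw [uIcc_of_le ht.1.le]
    exact S.adjGroup.continuousOn_comp continuous_neg.continuousOn
      (hf.mono (Icc_subset_Icc_right ht.2.le))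
  -- This is a bound for the difference of the two Duhamel formulas that is uniform in time: the
  -- outer `M` bounds the group at `t`, the inner one at `-s` under the integral.
  set c : ℕ → ℝ≥0∞ := fun n => ENNReal.ofReal M * (‖zn n 0 - z 0‖ₑ + ENNReal.ofReal M *
    eLpNorm (fun t => gn n t - g t) 1 (volume.restrict (Ioo 0 T))) with hcdef
  have hc : Tendsto c atTop (𝓝 0) := by
    have h1 : Tendsto (fun n => ‖zn n 0 - z 0‖ₑ) atTop (𝓝 0) := by
      have h3 := h0.sub_const (z 0)
      rw [sub_self] at h3
      have h4 := (continuous_enorm.tendsto (0 : H)).comp h3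
      simpa [Function.comp_def] using h4
    have h2 : Tendsto (fun n => ENNReal.ofReal M *
        eLpNorm (fun t => gn n t - g t) 1 (volume.restrict (Ioo 0 T))) atTop (𝓝 0) := by
      simpa using ENNReal.Tendsto.const_mul hlim (Or.inr (ENNReal.ofReal_ne_top (r := M)))
    have h5 := ENNReal.Tendsto.const_mul (h1.add h2) (Or.inr (ENNReal.ofReal_ne_top (r := M)))
    simpa using h5
  have hbound : ∀ n, ∀ t ∈ Ioo 0 T, ‖zn n t - z t‖ₑ ≤ c n := by
    intro n t ht
    have htI := Ioo_subset_Icc_self ht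
    rw [(hn n).eq_duhamel (hgn n) htI, h.eq_duhamel hg htI, C0Group.duhamel, C0Group.duhamel,
      ← map_sub, add_sub_add_comm, ← intervalIntegral.integral_sub (hint (hgn n) ht) (hint hg ht)]
    refine (hop t ⟨by linarith [ht.1, ht.2], ht.2.le⟩ _).trans (mul_le_mul' le_rfl ?_)
    refine (enorm_add_le _ _).trans (add_le_add le_rfl ?_)
    rw [intervalIntegral.integral_of_le ht.1.le, eLpNorm_one_eq_lintegral_enorm,
      integral_Ioc_eq_integral_Ioo]
    refine (enorm_integral_le_lintegral_enorm _).trans ?_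
    rw [← lintegral_const_mul' _ _ ENNReal.ofReal_ne_top]
    refine (setLIntegral_mono' measurableSet_Ioo fun s hs => ?_).trans
      (lintegral_mono_set (Ioo_subset_Ioo_right ht.2.le))
    rw [← map_sub]
    exact hop _ ⟨by linarith [hs.2, ht.2], by linarith [hs.1, ht.1, ht.2]⟩ _
  have h6 : Tendsto (fun n => c n * volume (Ioo 0 T)) atTop (𝓝 0) := by
    have hv : volume (Ioo 0 T) ≠ ∞ := by simp
    simpa using ENNReal.Tendsto.mul_const hc (Or.inr hv)
  refine tendsto_of_tendsto_of_tendsto_of_le_of_le tendsto_const_nhds h6 (fun _ => zero_le)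
    fun n => ?_
  rw [eLpNorm_one_eq_lintegral_enorm, ← setLIntegral_const]
  exact setLIntegral_mono' measurableSet_Ioo (hbound n)

theorem tendsto_eLpNorm_inner {E : Type*} [NormedAddCommGroup E] [InnerProductSpace 𝕜 E]
    {μ : Measure ℝ} {f : ℕ → ℝ → E} {p : ℝ≥0∞} (a : E)
    (h : Tendsto (fun n => eLpNorm (f n) p μ) atTop (𝓝 0)) :
    Tendsto (fun n => eLpNorm (fun t => inner 𝕜 a (f n t)) p μ) atTop (𝓝 0) := by
  have h1 : Tendsto (fun n => ENNReal.ofReal ‖a‖ * eLpNorm (f n) p μ) atTop (𝓝 0) := by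
    simpa using ENNReal.Tendsto.const_mul h (Or.inr (ENNReal.ofReal_ne_top (r := ‖a‖)))
  exact tendsto_of_tendsto_of_tendsto_of_le_of_le tendsto_const_nhds h1 (fun _ => zero_le)
    fun n => eLpNorm_le_mul_eLpNorm_of_ae_le_mul
      (Eventually.of_forall fun t => norm_inner_le_norm a (f n t)) p

theorem tendsto_eLpNorm_apply {E F : Type*} [NormedAddCommGroup E] [NormedSpace 𝕜 E]
    [NormedAddCommGroup F] [NormedSpace 𝕜 F] {μ : Measure ℝ} {f : ℕ → ℝ → E} {p : ℝ≥0∞}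
    (L : E →L[𝕜] F) (h : Tendsto (fun n => eLpNorm (f n) p μ) atTop (𝓝 0)) :
    Tendsto (fun n => eLpNorm (fun t => L (f n t)) p μ) atTop (𝓝 0) := by
  have h1 : Tendsto (fun n => ENNReal.ofReal ‖L‖ * eLpNorm (f n) p μ) atTop (𝓝 0) := by
    simpa using ENNReal.Tendsto.const_mul h (Or.inr (ENNReal.ofReal_ne_top (r := ‖L‖)))
  exact tendsto_of_tendsto_of_tendsto_of_le_of_le tendsto_const_nhds h1 (fun _ => zero_le)
    fun n => eLpNorm_le_mul_eLpNorm_of_ae_le_mul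
      (Eventually.of_forall fun t => L.le_opNorm (f n t)) p

theorem tendsto_eLpNorm_one_of_two {E : Type*} [NormedAddCommGroup E] {T : ℝ} {f : ℕ → ℝ → E}
    (hf : ∀ n, AEStronglyMeasurable (f n) (volume.restrict (Ioo 0 T)))
    (h : Tendsto (fun n => eLpNorm (f n) 2 (volume.restrict (Ioo 0 T))) atTop (𝓝 0)) :
    Tendsto (fun n => eLpNorm (f n) 1 (volume.restrict (Ioo 0 T))) atTop (𝓝 0) := by
  set κ : ℝ≥0∞ := (volume.restrict (Ioo 0 T)) univ ^
    (1 / (1 : ℝ≥0∞).toReal - 1 / (2 : ℝ≥0∞).toReal) with hκ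
  have hκt : κ ≠ ∞ := ENNReal.rpow_ne_top_of_nonneg (by norm_num) (by simp)
  have h1 : Tendsto (fun n => eLpNorm (f n) 2 (volume.restrict (Ioo 0 T)) * κ) atTop (𝓝 0) := by
    simpa using ENNReal.Tendsto.mul_const h (Or.inr hκt)
  exact tendsto_of_tendsto_of_tendsto_of_le_of_le tendsto_const_nhds h1 (fun _ => zero_le)
    fun n => eLpNorm_le_eLpNorm_mul_rpow_measure_univ (by norm_num) (hf n)

/-- If `z` solves the adjoint equation and `v` is its observation, then `Q z` solves the controlled
equation. -/
theorem IsObservation.distribDeriv {S : C0Group 𝕜 H} {B : ControlOp S U} {Q R : H →L[𝕜] H}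
    {W : U →L[𝕜] U} {lam : ℝ} (hQ : Q.toLinearMap.IsSymmetric) (hid : RiccatiIdentity B Q R W lam)
    {T : ℝ} {z : ℝ → H} {v : ℝ → U}
    (hz : IsWeakSolAdj S T z fun t => perturbation Q R lam (z t))
    (hv : IsObservation B T z (fun t => perturbation Q R lam (z t)) v) (φ : S.adjGen.domain) :
    DistribDeriv T (fun t => inner 𝕜 (φ : H) (Q (z t)))
      (fun t => inner 𝕜 (S.adjGen φ) (Q (z t)) - inner 𝕜 (B.star φ) (W (v t))) := by
  set P := perturbation Q R lam with hP
  obtain ⟨hvm, zn, gn, hznc, hgnc, hw, h0, hg1, hB2⟩ := hv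
  have hPz : ContinuousOn (fun t => P (z t)) (Icc 0 T) := P.continuous.comp_continuousOn hz.1
  have hgc : ∀ n, ContinuousOn (fun t => (gn n t : H)) (Icc 0 T) := fun n =>
    continuousOn_coe_of_toGraph (hgnc n)
  have hzc : ∀ n, ContinuousOn (fun t => (zn n t : H)) (Icc 0 T) := fun n =>
    continuousOn_coe_of_toGraph (hznc n)
  have hz1 := hz.tendsto hPz hw hgc h0 hg1
  have hBc : ∀ n, ContinuousOn (fun t => B.star (zn n t)) (Icc 0 T) := fun n =>
    B.starCLM.continuous.comp_continuousOn (hznc n)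
  have hB1 : Tendsto (fun n => eLpNorm (fun t => B.star (zn n t) - v t) 1
      (volume.restrict (Ioo 0 T))) atTop (𝓝 0) :=
    tendsto_eLpNorm_one_of_two (fun n => (((hBc n).mono Ioo_subset_Icc_self).aestronglyMeasurable
      measurableSet_Ioo).sub hvm.1) hB2
  have hsym : ∀ a b, inner 𝕜 (Q a) b = inner 𝕜 a (Q b) := hQ
  have hmeas : ∀ {f : ℝ → 𝕜}, ContinuousOn f (Icc 0 T) →
      AEStronglyMeasurable f (volume.restrict (Ioo 0 T)) := fun hf =>
    (hf.mono Ioo_subset_Icc_self).aestronglyMeasurable measurableSet_Ioo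
  -- For the approximations `zₙ`, which are strong solutions in `D(A*)`, the identity applies at
  -- each time. Because `gₙ` need not equal `P zₙ`, the defect `⟨gₙ - P zₙ, Q φ⟩` appears; it tends
  -- to zero in `L¹`.
  refine DistribDeriv.of_tendsto (F := fun n t => inner 𝕜 (φ : H) (Q (zn n t)))
    (G := fun n t => inner 𝕜 (S.adjGen φ) (Q (zn n t)) - inner 𝕜 (B.star φ) (W (B.star (zn n t))) +
      inner 𝕜 (Q φ) ((gn n t : H) - P (zn n t))) (fun n => ?_) ?_ ?_ ?_ ?_
  · refine distribDeriv_of_hasDerivAt (fun t ht => ?_) ?_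
    · have h1 := (hw n).hasDerivAt (hznc n) (hgc n) ht
      have h2 := HasDerivAt.inner 𝕜 (hasDerivAt_const t (Q φ)) h1
      simp only [inner_zero_left, add_zero, hsym] at h2
      refine h2.congr_deriv ?_
      have h3 := hid (zn n t) φ
      rw [← hsym, inner_add_right, inner_neg_right, inner_sub_right, hP, perturbation_apply,
        inner_sub_right, inner_neg_right, inner_smul_right]
      have h4 : inner 𝕜 (φ : H) (Q (zn n t)) = inner 𝕜 (Q φ) (zn n t : H) := (hsym _ _).symm
      rw [h4] at h3
      linear_combination -h3
    · have h1 := ((continuousOn_const (c := S.adjGen φ)).inner (𝕜 := 𝕜)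
        (Q.continuous.comp_continuousOn (hzc n))).sub
        ((continuousOn_const (c := B.star φ)).inner (𝕜 := 𝕜)
          (W.continuous.comp_continuousOn (hBc n)))
      have h2 := (continuousOn_const (c := Q φ)).inner (𝕜 := 𝕜)
        ((hgc n).sub (P.continuous.comp_continuousOn (hzc n)))
      exact (h1.add h2).mono Ioo_subset_Icc_self
  · have h1 : ContinuousOn (fun t => inner 𝕜 (φ : H) (Q (z t))) (Icc 0 T) :=
      continuousOn_const.inner (Q.continuous.comp_continuousOn hz.1)
    exact h1.integrableOn_Icc.mono_set Ioo_subset_Icc_self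
  · have h1 : ContinuousOn (fun t => inner 𝕜 (S.adjGen φ) (Q (z t))) (Icc 0 T) :=
      continuousOn_const.inner (Q.continuous.comp_continuousOn hz.1)
    have h2 : IntegrableOn v (Ioo 0 T) := integrableOn_of_memLp (by norm_num) hvm
    have h3 : IntegrableOn (fun t => inner 𝕜 (B.star φ) (W (v t))) (Ioo 0 T) :=
      ((innerSL 𝕜 (B.star φ)).comp W).integrable_comp h2
    exact (h1.integrableOn_Icc.mono_set Ioo_subset_Icc_self).sub h3
  · refine (tendsto_eLpNorm_inner (𝕜 := 𝕜) (φ : H) (tendsto_eLpNorm_apply Q hz1)).congr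
      fun n => ?_
    congr 1
    funext t
    simp only [Pi.sub_apply, map_sub, inner_sub_right]
  · have e1 := tendsto_eLpNorm_inner (𝕜 := 𝕜) (S.adjGen φ) (tendsto_eLpNorm_apply Q hz1)
    have e2 := tendsto_eLpNorm_inner (𝕜 := 𝕜) (B.star φ) (tendsto_eLpNorm_apply W hB1)
    have e3 := tendsto_eLpNorm_inner (𝕜 := 𝕜) (Q φ) hg1
    have e4 := tendsto_eLpNorm_inner (𝕜 := 𝕜) (Q φ) (tendsto_eLpNorm_apply P hz1)
    have e5 := ((e1.add e2).add e3).add e4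
    simp only [add_zero] at e5
    refine tendsto_of_tendsto_of_tendsto_of_le_of_le tendsto_const_nhds e5 (fun _ => zero_le)
      fun n => ?_
    have m1 : AEStronglyMeasurable (fun t => inner 𝕜 (S.adjGen φ) (Q ((zn n t : H) - z t)))
        (volume.restrict (Ioo 0 T)) :=
      hmeas (continuousOn_const.inner (Q.continuous.comp_continuousOn ((hzc n).sub hz.1)))
    have m2 : AEStronglyMeasurable (fun t => inner 𝕜 (B.star φ) (W (B.star (zn n t) - v t)))
        (volume.restrict (Ioo 0 T)) :=
      ((innerSL 𝕜 (B.star φ)).comp W).continuous.comp_aestronglyMeasurable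
        ((((hBc n).mono Ioo_subset_Icc_self).aestronglyMeasurable measurableSet_Ioo).sub hvm.1)
    have m3 : AEStronglyMeasurable (fun t => inner 𝕜 (Q φ) ((gn n t : H) - P (z t)))
        (volume.restrict (Ioo 0 T)) :=
      hmeas (continuousOn_const.inner ((hgc n).sub hPz))
    have m4 : AEStronglyMeasurable (fun t => inner 𝕜 (Q φ) (P ((zn n t : H) - z t)))
        (volume.restrict (Ioo 0 T)) :=
      hmeas (continuousOn_const.inner (P.continuous.comp_continuousOn ((hzc n).sub hz.1)))
    have hdecomp : ((fun t => inner 𝕜 (S.adjGen φ) (Q (zn n t)) -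
          inner 𝕜 (B.star φ) (W (B.star (zn n t))) + inner 𝕜 (Q φ) ((gn n t : H) - P (zn n t))) -
        fun t => inner 𝕜 (S.adjGen φ) (Q (z t)) - inner 𝕜 (B.star φ) (W (v t))) =
        (((fun t => inner 𝕜 (S.adjGen φ) (Q ((zn n t : H) - z t))) -
          fun t => inner 𝕜 (B.star φ) (W (B.star (zn n t) - v t))) +
          fun t => inner 𝕜 (Q φ) ((gn n t : H) - P (z t))) -
          fun t => inner 𝕜 (Q φ) (P ((zn n t : H) - z t)) := by
      funext t
      simp only [Pi.sub_apply, Pi.add_apply, map_sub, inner_sub_right]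
      ring
    rw [hdecomp]
    refine (eLpNorm_sub_le ((m1.sub m2).add m3) m4 le_rfl).trans (add_le_add ?_ le_rfl)
    refine (eLpNorm_add_le (m1.sub m2) m3 le_rfl).trans (add_le_add ?_ le_rfl)
    exact eLpNorm_sub_le m1 m2 le_rfl

end Limits

/-! ### The closed-loop semigroup: dissipation, uniqueness and generator -/

section ClosedLoop

variable {𝕜 : Type*} [RCLike 𝕜]
variable {H : Type*} [NormedAddCommGroup H] [InnerProductSpace 𝕜 H]

/-- The semigroup `Q V(t) Q⁻¹`. -/
def C0Semigroup.conj (V : C0Semigroup 𝕜 H) (Q : H ≃L[𝕜] H) : C0Semigroup 𝕜 H where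
  toFun t := (Q : H →L[𝕜] H).comp ((V.toFun t).comp (Q.symm : H →L[𝕜] H))
  map_zero := by
    ext x
    simp [V.map_zero]
  map_add s t := by
    ext x
    simp [V.map_add]
  tendsto_zero x := by
    have := (Q.continuous.tendsto _).comp (V.tendsto_zero (Q.symm x))
    simpa [Function.comp_def] using this

theorem C0Semigroup.conj_apply (V : C0Semigroup 𝕜 H) (Q : H ≃L[𝕜] H) (t : ℝ≥0) (x : H) :
    (V.conj Q).toFun t x = Q (V.toFun t (Q.symm x)) := rfl

theorem C0Semigroup.hasGenerator_conj (V : C0Semigroup 𝕜 H) (Q : H ≃L[𝕜] H) (z w : H) :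
    (V.conj Q).HasGenerator z w ↔ V.HasGenerator (Q.symm z) (Q.symm w) := by
  unfold C0Semigroup.HasGenerator
  constructor
  · intro h
    refine ((Q.symm.continuous.tendsto w).comp h).congr fun t => ?_
    simp [C0Semigroup.conj_apply]
  · intro h
    have h1 := (Q.continuous.tendsto (Q.symm w)).comp h
    rw [Q.apply_symm_apply] at h1
    refine h1.congr fun t => ?_
    simp [C0Semigroup.conj_apply]

variable [CompleteSpace H]
variable {U : Type*} [NormedAddCommGroup U] [InnerProductSpace 𝕜 U] [CompleteSpace U]

/-- The Riccati identity makes the quadratic form of `Q` dissipative. -/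
theorem two_mul_re_inner_le {S : C0Group 𝕜 H} {B : ControlOp S U} {Q : H ≃L[𝕜] H}
    {R : H →L[𝕜] H} {W : U →L[𝕜] U} {lam : ℝ}
    (hQ : (Q : H →L[𝕜] H).toLinearMap.IsSymmetric) (hR : R.IsPositive) (hW : W.IsPositive)
    (hid : RiccatiIdentity B (Q : H →L[𝕜] H) R W lam) (x : S.adjGen.domain) :
    2 * RCLike.re (inner 𝕜 (Q x) (-S.adjGen x + perturbation (Q : H →L[𝕜] H) R lam x)) ≤
      -(2 * lam) * RCLike.re (inner 𝕜 (Q x) (x : H)) := by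
  have hsym : ∀ a b : H, inner 𝕜 (Q a) b = inner 𝕜 a (Q b) := hQ
  -- On the diagonal the first two terms of the identity are conjugate, so its real part expresses
  -- `2 Re ⟨A* x, Q x⟩` through `W`, `R` and `λ`.
  have h := congrArg RCLike.re (hid x x)
  have e1 : RCLike.re (inner 𝕜 (S.adjGen x) (Q x)) = RCLike.re (inner 𝕜 (Q x) (S.adjGen x)) :=
    inner_re_symm _ _
  have e2 : (2 * (lam : 𝕜)) * inner 𝕜 (x : H) (Q x) =
      ((2 * lam : ℝ) : 𝕜) * inner 𝕜 (Q x) (x : H) := by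
    rw [hsym]; push_cast; ring
  simp only [ContinuousLinearEquiv.coe_coe] at h
  rw [e2] at h
  simp only [_root_.map_add, map_sub, RCLike.re_ofReal_mul, map_zero, e1] at h
  have hW1 : 0 ≤ RCLike.re (inner 𝕜 (B.star x) (W (B.star x))) := hW.re_inner_nonneg_right _
  have hR1 : 0 ≤ RCLike.re (inner 𝕜 (Q x) (R (Q x))) := hR.re_inner_nonneg_right _
  have e3 : inner 𝕜 (Q x) ((2 * (lam : 𝕜)) • (x : H)) =
      ((2 * lam : ℝ) : 𝕜) * inner 𝕜 (Q x) (x : H) := by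
    rw [inner_smul_right]; push_cast; ring
  rw [perturbation_apply, inner_add_right, inner_sub_right, inner_neg_right, inner_neg_right, e3]
  simp only [_root_.map_add, map_sub, map_neg, RCLike.re_ofReal_mul,
    ContinuousLinearEquiv.coe_coe]
  linarith

variable [NormedSpace ℝ H]

/-- `V` solves the Duhamel equation of the perturbation of the generator of `S` by `P`. -/
def C0Group.IsPerturbation (S : C0Group 𝕜 H) (P : H →L[𝕜] H) (V : C0Semigroup 𝕜 H) : Prop :=
  (∀ x, Continuous fun t : ℝ => V.toFun t.toNNReal x) ∧ ∀ (x : H) (t : ℝ), 0 ≤ t →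
    V.toFun t.toNNReal x = S.duhamel x (fun s => P (V.toFun s.toNNReal x)) t

variable [IsScalarTower ℝ 𝕜 H]

theorem C0Group.IsPerturbation.hasGenerator_iff {S : C0Group 𝕜 H} {P : H →L[𝕜] H}
    {V : C0Semigroup 𝕜 H} (hV : S.IsPerturbation P V) (x w : H) :
    V.HasGenerator x w ↔ S.toC0Semigroup.HasGenerator x (w - P x) := by
  have h := S.hasGenerator_of_duhamel V (x := x) (P.continuous.comp (hV.1 x)) (hV.2 x) w
  simpa [V.map_zero] using h

theorem C0Group.IsPerturbation.hasDerivAt_inner {S : C0Group 𝕜 H} {P : H →L[𝕜] H}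
    {V : C0Semigroup 𝕜 H} (hV : S.adjGroup.IsPerturbation P V) (x : H) {φ ψ : H}
    (hφ : S.toC0Semigroup.HasGenerator φ ψ) {t : ℝ} (ht : 0 < t) :
    HasDerivAt (fun t : ℝ => inner 𝕜 φ (V.toFun t.toNNReal x))
      (-inner 𝕜 ψ (V.toFun t.toNNReal x) + inner 𝕜 φ (P (V.toFun t.toNNReal x))) t := by
  have hφ' : S.adjGroup.adjGroup.toC0Semigroup.HasGenerator φ ψ := by
    rwa [S.adjGroup_adjGroup]
  have h := S.adjGroup.weak_of_duhamel (P.continuous.comp (hV.1 x)) x hφ' t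
  rw [hV.2 x t ht.le, ← hV.2 x t ht.le]
  have h1 := hV.2 x t ht.le
  rw [C0Group.duhamel] at h1
  simp only [Function.comp_apply] at h
  rw [← h1] at h
  refine h.congr_of_eventuallyEq ?_
  filter_upwards [lt_mem_nhds ht] with s hs
  rw [hV.2 x s hs.le]
  rfl

theorem C0Group.IsPerturbation.isWeakSolAdj {S : C0Group 𝕜 H} {P : H →L[𝕜] H}
    {V : C0Semigroup 𝕜 H} (hV : S.adjGroup.IsPerturbation P V) (x : H) (T : ℝ) :
    IsWeakSolAdj S T (fun t => V.toFun t.toNNReal x) (fun t => P (V.toFun t.toNNReal x)) := by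
  refine ⟨(hV.1 x).continuousOn, fun φ => distribDeriv_of_hasDerivAt (fun t ht =>
    hV.hasDerivAt_inner x (S.hasGenerator_generator φ) ht.1) ?_⟩
  exact ((continuous_const.inner (hV.1 x)).neg.add
    (continuous_const.inner (P.continuous.comp (hV.1 x)))).continuousOn

theorem C0Group.IsPerturbation.eqOn {S : C0Group 𝕜 H} {P : H →L[𝕜] H}
    {V : C0Semigroup 𝕜 H} (hV : S.adjGroup.IsPerturbation P V) {T : ℝ} {z : ℝ → H}
    (hz : IsWeakSolAdj S T z fun t => P (z t)) {t : ℝ} (ht : t ∈ Icc 0 T) :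
    z t = V.toFun t.toNNReal (z 0) := by
  have hPz : ContinuousOn (fun t => P (z t)) (Icc 0 T) := P.continuous.comp_continuousOn hz.1
  have h := S.adjGroup.volterra_eq_zero P (d := fun t => z t - V.toFun t.toNNReal (z 0))
    (hz.1.sub (hV.1 _).continuousOn) ?_ t ht
  · exact sub_eq_zero.1 h
  · intro r hr
    have i1 : IntervalIntegrable (fun s => S.adjGroup.toFun (-s) (P (z s))) volume 0 r := by
      refine ContinuousOn.intervalIntegrable ?_
      rw [uIcc_of_le hr.1]
      exact S.adjGroup.continuousOn_comp continuous_neg.continuousOn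
        (hPz.mono (Icc_subset_Icc_right hr.2))
    have i2 : IntervalIntegrable
        (fun s : ℝ => S.adjGroup.toFun (-s) (P (V.toFun s.toNNReal (z 0)))) volume 0 r :=
      (S.adjGroup.continuous_comp continuous_neg
        (P.continuous.comp (hV.1 (z 0)))).intervalIntegrable _ _
    rw [hz.eq_duhamel hPz hr, hV.2 (z 0) r hr.1, C0Group.duhamel, C0Group.duhamel, ← map_sub,
      add_sub_add_left_eq_sub, ← intervalIntegral.integral_sub i1 i2]
    simp only [map_sub]

/-- The integrated form of the perturbed adjoint equation. -/
theorem C0Group.IsPerturbation.hasGenerator_integral {S : C0Group 𝕜 H} {P : H →L[𝕜] H}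
    {V : C0Semigroup 𝕜 H} (hV : S.adjGroup.IsPerturbation P V) (x : H) {t : ℝ} (ht : 0 ≤ t) :
    V.HasGenerator (∫ s in (0 : ℝ)..t, V.toFun s.toNNReal x) (V.toFun t.toNNReal x - x) := by
  -- By duality it suffices to pair with `D(A)`, where the orbit satisfies a scalar differential
  -- equation that can be integrated over `[0, t]`.
  rw [hV.hasGenerator_iff, S.hasGenerator_adjGroup_iff]
  intro φ ψ hφ
  have hc := hV.1 x
  have hi := hc.intervalIntegrable (μ := volume) 0 t
  have hPi := (P.continuous.comp hc).intervalIntegrable (μ := volume) 0 t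
  have c1 : Continuous fun s : ℝ => inner 𝕜 ψ (V.toFun s.toNNReal x) := continuous_const.inner hc
  have c2 : Continuous fun s : ℝ => inner 𝕜 φ (P (V.toFun s.toNNReal x)) :=
    continuous_const.inner (P.continuous.comp hc)
  have h1 := intervalIntegral.integral_eq_sub_of_hasDerivAt_of_le ht
    (f := fun s : ℝ => inner 𝕜 φ (V.toFun s.toNNReal x))
    (continuous_const.inner hc).continuousOn
    (fun s hs => hV.hasDerivAt_inner x hφ hs.1) ((c1.fun_neg.add c2).intervalIntegrable _ _)
  rw [intervalIntegral.integral_add (c1.fun_neg.intervalIntegrable _ _) (c2.intervalIntegrable _ _),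
    intervalIntegral.integral_neg, intervalIntegral_inner ψ hi] at h1
  have h2 := intervalIntegral_inner (𝕜 := 𝕜) φ hPi
  simp only [Function.comp_def] at h2
  rw [h2, ContinuousLinearMap.intervalIntegral_comp_comm P hi, Real.toNNReal_zero, V.map_zero,
    ContinuousLinearMap.id_apply] at h1
  rw [inner_sub_right, inner_sub_right]
  linear_combination -h1

section Riccati

variable {S : C0Group 𝕜 H} {B : ControlOp S U} {Q : H ≃L[𝕜] H} {R : H →L[𝕜] H}
  {W : U →L[𝕜] U} {lam : ℝ} {V : C0Semigroup 𝕜 H}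

/-- The flow of the perturbed adjoint equation solves the closed-loop system. -/
theorem isClosedLoopSol_of_isPerturbation [NormedSpace ℝ U] (hB : B.IsAdmissible)
    (hQ : (Q : H →L[𝕜] H).toLinearMap.IsSymmetric)
    (hid : RiccatiIdentity B (Q : H →L[𝕜] H) R W lam)
    (hV : S.adjGroup.IsPerturbation (perturbation (Q : H →L[𝕜] H) R lam) V) (y₀ : H) :
    IsClosedLoopSol B Q R W lam y₀ (fun t => Q (V.toFun t.toNNReal (Q.symm y₀)))
      (fun t => V.toFun t.toNNReal (Q.symm y₀)) := by
  intro T hT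
  set P := perturbation (Q : H →L[𝕜] H) R lam with hP
  set x := Q.symm y₀ with hx
  have hw := hV.isWeakSolAdj x T
  obtain ⟨v, hv⟩ := hB.exists_isObservation hT x (P.continuous.comp (hV.1 x))
  have hv' : IsObservation B T (fun t => V.toFun t.toNNReal x)
      (fun t => P (V.toFun t.toNNReal x)) v := by
    obtain ⟨hm, zn, gn, h1, h2, h3, h4, h5, h6⟩ := hv
    refine ⟨hm, zn, gn, h1, h2, h3, ?_, h5, h6⟩
    simpa only [hV.2 x 0 le_rfl, Function.comp_def] using h4
  refine ⟨(Q.continuous.comp (hV.1 x)).continuousOn, ?_, ?_, hw, v, hv', fun φ => ?_⟩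
  · simp [V.map_zero, hx]
  · simp [V.map_zero]
  · exact hv'.distribDeriv hQ hid hw φ

/-- Every solution of the closed-loop system is given by the perturbed adjoint flow. -/
theorem IsWeakSolOn.eq_of_isPerturbation
    (hQ : (Q : H →L[𝕜] H).toLinearMap.IsSymmetric)
    (hid : RiccatiIdentity B (Q : H →L[𝕜] H) R W lam)
    (hV : S.adjGroup.IsPerturbation (perturbation (Q : H →L[𝕜] H) R lam) V) {y₀ : H} {T : ℝ}
    {y yt : ℝ → H} (h : IsWeakSolOn B (Q : H →L[𝕜] H) R W lam y₀ (Q.symm y₀) T y yt) {t : ℝ}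
    (ht : t ∈ Icc 0 T) :
    yt t = V.toFun t.toNNReal (Q.symm y₀) ∧ y t = Q (V.toFun t.toNNReal (Q.symm y₀)) := by
  obtain ⟨hyc, hy0, hyt0, hw, v, hv, hφ⟩ := h
  have hw' : IsWeakSolAdj S T yt fun t => perturbation (Q : H →L[𝕜] H) R lam (yt t) := hw
  have h1 := hV.eqOn hw' ht
  rw [hyt0] at h1
  refine ⟨h1, ?_⟩
  rw [← h1]
  have hQc : ContinuousOn (fun t => Q (yt t)) (Icc 0 T) := Q.continuous.comp_continuousOn hw.1
  have hdc : ContinuousOn (fun t => y t - Q (yt t)) (Icc 0 T) := hyc.sub hQc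
  have h2 := S.duhamel_of_weak (z := fun t => y t - Q (yt t)) (g := fun _ => 0) hdc
    continuousOn_const (fun φ ψ hφψ s hs => ?_) ht
  · simp only [hy0, hyt0, Q.apply_symm_apply, sub_self, map_zero,
      intervalIntegral.integral_zero, add_zero] at h2
    exact sub_eq_zero.1 h2
  · obtain ⟨hφm, hφv⟩ := S.adjGen_of_hasGenerator hφψ
    have h3 := (hφ ⟨φ, hφm⟩).sub (IsObservation.distribDeriv hQ hid hw' hv ⟨φ, hφm⟩)
    -- The control terms cancel because the same observation `v` enters the equations of `y` and of
    -- `Q ỹ`.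
    have h4 : DistribDeriv T (fun t => inner 𝕜 φ (y t - Q (yt t)))
        (fun t => -inner 𝕜 ψ (y t - Q (yt t)) + inner 𝕜 φ (0 : H)) := by
      convert h3 using 2 with t t
      · rw [inner_sub_right]; rfl
      · rw [hφv, inner_zero_right, inner_sub_right, inner_neg_left, inner_neg_left]
        simp only [ContinuousLinearEquiv.coe_coe]
        ring
    exact h4.hasDerivAt (continuousOn_const.inner (hdc.mono Ioo_subset_Icc_self))
      ((continuousOn_const.inner (hdc.mono Ioo_subset_Icc_self)).neg.add continuousOn_const) hs

/-- The generator of the closed-loop semigroup. -/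
theorem hasGenerator_conj_iff
    (hV : S.adjGroup.IsPerturbation (perturbation (Q : H →L[𝕜] H) R lam) V) (z w : H) :
    (V.conj Q).HasGenerator z w ↔ ∃ x : S.adjGen.domain, (x : H) = Q.symm z ∧
      w = -Q (S.adjGen x) - (2 * (lam : 𝕜)) • z - Q (R z) := by
  rw [V.hasGenerator_conj, hV.hasGenerator_iff]
  have hPz : perturbation (Q : H →L[𝕜] H) R lam (Q.symm z) =
      -((2 * (lam : 𝕜)) • Q.symm z) - R z := by
    rw [perturbation_apply]; simp
  rw [hPz]
  constructor
  · intro h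
    obtain ⟨hm, hval⟩ := S.adjGen_of_hasGenerator h
    refine ⟨⟨_, hm⟩, rfl, ?_⟩
    rw [hval]
    simp only [map_neg, map_sub, map_smul, Q.apply_symm_apply]
    abel
  · rintro ⟨x, hx, rfl⟩
    have h := S.hasGenerator_adjGen x
    rw [hx] at h
    convert h using 1
    simp only [map_neg, map_sub, map_smul, Q.symm_apply_apply]
    abel

/-- With `E(t) = ⟨Q V(t) x, V(t) x⟩`, dissipativity makes `exp (2λt) E(t)` non-increasing for `x ∈
D(A*)`. Comparing `E` with the squared norm through `c` and `‖Q‖` gives the constant `√(‖Q‖ / c)`,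
and density of `D(A*)` removes the restriction on `x`. -/
theorem exists_norm_perturbed_le (hQ : IsCoercivePositive (Q : H →L[𝕜] H)) (hR : R.IsPositive)
    (hW : W.IsPositive) (hid : RiccatiIdentity B (Q : H →L[𝕜] H) R W lam)
    (hV : S.adjGroup.IsPerturbation (perturbation (Q : H →L[𝕜] H) R lam) V) :
    ∃ C : ℝ, 0 ≤ C ∧ ∀ (t : ℝ≥0) (x : H), ‖V.toFun t x‖ ≤ C * Real.exp (-lam * t) * ‖x‖ := by
  obtain ⟨hsym, c, hc, hcoer⟩ := hQ
  have hsym' : ∀ a b : H, inner 𝕜 (Q a) b = inner 𝕜 a (Q b) := hsym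
  set q : ℝ := ‖(Q : H →L[𝕜] H)‖ with hq
  refine ⟨Real.sqrt (q / c), Real.sqrt_nonneg _, fun t x => ?_⟩
  have hclosed : IsClosed {x : H | ‖V.toFun t x‖ ≤ Real.sqrt (q / c) * Real.exp (-lam * t) * ‖x‖} :=
    isClosed_le (V.toFun t).continuous.norm (continuous_const.mul continuous_norm)
  suffices hsub : (S.adjGen.domain : Set H) ⊆
      {x : H | ‖V.toFun t x‖ ≤ Real.sqrt (q / c) * Real.exp (-lam * t) * ‖x‖} from
    hclosed.closure_subset_iff.2 hsub (S.dense_adjGen_domain x)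
  intro x hx
  set P := perturbation (Q : H →L[𝕜] H) R lam with hP
  set w : H := -S.adjGen ⟨x, hx⟩ + P x with hw
  have hgen : V.HasGenerator x w := by
    rw [hV.hasGenerator_iff, hw, add_sub_cancel_right]
    exact S.hasGenerator_adjGen ⟨x, hx⟩
  set z : ℝ → H := fun s => V.toFun s.toNNReal x with hz
  have hzc : Continuous z := hV.1 x
  have hzd : ∀ s, 0 ≤ s → HasDerivWithinAt z (V.toFun s.toNNReal w) (Ici s) s := fun s hs =>
    V.hasDerivWithinAt_orbit hgen hs
  set E : ℝ → ℝ := fun s => RCLike.re (inner 𝕜 (Q (z s)) (z s)) with hE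
  have hEd : ∀ s, 0 ≤ s → HasDerivWithinAt E
      (2 * RCLike.re (inner 𝕜 (Q (z s)) (V.toFun s.toNNReal w))) (Ici s) s := by
    intro s hs
    have h1 := hzd s hs
    have h2 : HasDerivWithinAt (fun s => Q (z s)) (Q (V.toFun s.toNNReal w)) (Ici s) s :=
      ((Q : H →L[𝕜] H).restrictScalars ℝ).hasFDerivAt.comp_hasDerivWithinAt s h1
    have h3 := h2.inner 𝕜 h1
    have h4 := (RCLike.reCLM (K := 𝕜)).hasFDerivAt.comp_hasDerivWithinAt s h3
    refine h4.congr_deriv ?_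
    rw [RCLike.reCLM_apply, _root_.map_add, hsym' (V.toFun s.toNNReal w),
      inner_re_symm (V.toFun s.toNNReal w)]
    ring
  have hEle : ∀ s, 0 ≤ s → 2 * RCLike.re (inner 𝕜 (Q (z s)) (V.toFun s.toNNReal w)) ≤
      -(2 * lam) * E s := by
    intro s hs
    have h1 := V.hasGenerator_map hgen s.toNNReal
    rw [hV.hasGenerator_iff] at h1
    obtain ⟨hm, hval⟩ := S.adjGen_of_hasGenerator h1
    have h2 := two_mul_re_inner_le hsym hR hW hid ⟨_, hm⟩
    rw [hval, neg_neg, sub_add_cancel] at h2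
    exact h2
  have hEc : Continuous E := RCLike.continuous_re.comp
    ((Q.continuous.comp hzc).inner hzc)
  -- Only right derivatives of the orbit have been established, so monotonicity comes from a
  -- comparison principle for right derivatives.
  have hdec : Real.exp (2 * lam * t) * E t ≤ E 0 := by
    have hexp : ∀ s, HasDerivAt (fun s => Real.exp (2 * lam * s))
        (Real.exp (2 * lam * s) * (2 * lam)) s := by
      intro s
      have := ((hasDerivAt_id' s).const_mul (2 * lam)).exp
      simpa using this
    have hce : Continuous fun s => Real.exp (2 * lam * s) * E s :=
      (Real.continuous_exp.comp (continuous_const.mul continuous_id)).mul hEc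
    have h1 := image_le_of_deriv_right_le_deriv_boundary (a := 0) (b := (t : ℝ))
      (f := fun s => Real.exp (2 * lam * s) * E s)
      (f' := fun s => Real.exp (2 * lam * s) * (2 * lam) * E s + Real.exp (2 * lam * s) *
        (2 * RCLike.re (inner 𝕜 (Q (z s)) (V.toFun s.toNNReal w))))
      hce.continuousOn (fun s hs => (hexp s).hasDerivWithinAt.mul (hEd s hs.1))
      (B := fun _ => E 0) (B' := fun _ => 0) (by simp) continuousOn_const
      (fun s _ => hasDerivWithinAt_const _ _ _) (fun s hs => ?_) (right_mem_Icc.2 t.2)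
    · exact h1
    · have h2 := mul_le_mul_of_nonneg_left (hEle s hs.1) (Real.exp_nonneg (2 * lam * s))
      calc _ ≤ Real.exp (2 * lam * s) * (2 * lam) * E s +
            Real.exp (2 * lam * s) * (-(2 * lam) * E s) := by gcongr
        _ = 0 := by ring
  have hzt : z t = V.toFun t x := by simp [hz]
  have h0 : E 0 ≤ q * ‖x‖ ^ 2 := by
    have hz0 : z 0 = x := by simp [hz, V.map_zero]
    simp only [hE, hz0]
    refine (RCLike.re_le_norm _).trans ((norm_inner_le_norm _ _).trans ?_)
    have : ‖Q x‖ ≤ q * ‖x‖ := (Q : H →L[𝕜] H).le_opNorm x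
    calc ‖Q x‖ * ‖x‖ ≤ q * ‖x‖ * ‖x‖ := by gcongr
      _ = q * ‖x‖ ^ 2 := by ring
  have h1 : c * ‖V.toFun t x‖ ^ 2 ≤ E t := by
    rw [← hzt]; exact hcoer (z t)
  have hee : Real.exp (-lam * t) ^ 2 * Real.exp (2 * lam * t) = 1 := by
    rw [← Real.exp_nat_mul, ← Real.exp_add, Real.exp_eq_one_iff]
    push_cast; ring
  have h2 : E t ≤ Real.exp (-lam * t) ^ 2 * (q * ‖x‖ ^ 2) := by
    calc E t = Real.exp (-lam * t) ^ 2 * (Real.exp (2 * lam * t) * E t) := by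
          rw [← mul_assoc, hee, one_mul]
      _ ≤ _ := mul_le_mul_of_nonneg_left (hdec.trans h0) (by positivity)
  have hqc : 0 ≤ q / c := div_nonneg (norm_nonneg _) hc.le
  change ‖V.toFun t x‖ ≤ Real.sqrt (q / c) * Real.exp (-lam * t) * ‖x‖
  refine le_of_sq_le_sq ?_ (by positivity)
  rw [mul_pow, mul_pow, Real.sq_sqrt hqc]
  have h3 := h1.trans h2
  rw [mul_comm, ← le_div_iff₀ hc] at h3
  refine h3.trans (le_of_eq ?_)
  ring

/-- The generator of `S` on `Q D(A*)`, where `B W B* x` is in `H`. -/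
theorem hasGenerator_of_gram (hQ : (Q : H →L[𝕜] H).toLinearMap.IsSymmetric)
    (hid : RiccatiIdentity B (Q : H →L[𝕜] H) R W lam) {x : S.adjGen.domain} {h : H}
    (hh : B.gram W x = pivot S.adjGen h) :
    S.toC0Semigroup.HasGenerator (Q x)
      (-Q (S.adjGen x) - (2 * (lam : 𝕜)) • Q x - Q (R (Q x)) + h) := by
  have hsym : ∀ a b : H, inner 𝕜 (Q a) b = inner 𝕜 a (Q b) := hQ
  -- Membership of `Q x` in `D(A)` is checked by duality with `D(A*)`, where the Riccati identity
  -- supplies exactly the required pairing.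
  refine S.hasGenerator_of_adjGroup fun φ ψ hφ => ?_
  obtain ⟨hm, hval⟩ := S.adjGen_of_hasGenerator hφ
  have h1 := hid x ⟨φ, hm⟩
  have h2 : inner 𝕜 (B.star ⟨φ, hm⟩) (W (B.star x)) = inner 𝕜 φ h := by
    rw [B.inner_star]
    exact DFunLike.congr_fun hh (toGraph S.adjGen ⟨φ, hm⟩)
  simp only [ContinuousLinearEquiv.coe_coe] at h1
  rw [hval, h2, hsym, hsym, inner_neg_left] at h1
  simp only [inner_add_right, inner_sub_right, inner_neg_right, inner_smul_right]
  linear_combination -h1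

/-- The curve `Q V(t) Q⁻¹ z` is shown to satisfy Duhamel's formula for `S` with the continuous
source `-K V(t) Q⁻¹ z`. Comparing right derivatives at zero then gives equality of domains in both
directions at once. -/
theorem hasGenerator_conj_iff_of_bounded (hQ : (Q : H →L[𝕜] H).toLinearMap.IsSymmetric)
    (hid : RiccatiIdentity B (Q : H →L[𝕜] H) R W lam)
    (hV : S.adjGroup.IsPerturbation (perturbation (Q : H →L[𝕜] H) R lam) V) {K : H →L[𝕜] H}
    (hK : ∀ x : S.adjGen.domain, B.gram W x = pivot S.adjGen (K x)) (z w : H) :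
    (V.conj Q).HasGenerator z w ↔ S.toC0Semigroup.HasGenerator z (w + K (Q.symm z)) := by
  set x := Q.symm z with hx
  set u : ℝ → H := fun t => V.toFun t.toNNReal x with hu
  have huc : Continuous u := hV.1 x
  have hgc : Continuous fun t => -K (u t) := (K.continuous.comp huc).neg
  have hweak : ∀ φ ψ : H, S.adjGroup.toC0Semigroup.HasGenerator φ ψ → ∀ t, 0 < t →
      HasDerivAt (fun t => inner 𝕜 φ (Q (u t)))
        (-inner 𝕜 ψ (Q (u t)) + inner 𝕜 φ (-K (u t))) t := by
    intro φ ψ hφ t ht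
    -- The orbit `u t` need not lie in `D(A*)`, but its integral does. The identity is used on `I`,
    -- and the resulting formula for `u` is differentiated afterwards.
    set I : ℝ → H := fun t => ∫ s in (0 : ℝ)..t, u s with hI
    have hId : HasDerivAt I (u t) t :=
      intervalIntegral.integral_hasDerivAt_right (huc.intervalIntegrable _ _)
        (huc.stronglyMeasurableAtFilter _ _) huc.continuousAt
    have hform : ∀ s, 0 ≤ s → inner 𝕜 φ (Q (u s)) =
        inner 𝕜 φ (Q x) - inner 𝕜 ψ (Q (I s)) - inner 𝕜 φ (K (I s)) := by
      intro s hs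
      have h1 := hV.hasGenerator_integral x hs
      have h2 : (V.conj Q).HasGenerator (Q (I s)) (Q (u s - x)) := by
        rw [V.hasGenerator_conj, Q.symm_apply_apply, Q.symm_apply_apply]
        exact h1
      obtain ⟨ξ, hξ, hξ'⟩ := (hasGenerator_conj_iff hV _ _).1 h2
      rw [Q.symm_apply_apply] at hξ
      have h3 := hasGenerator_of_gram hQ hid (hK ξ)
      rw [hξ, ← hξ'] at h3
      have h4 := (S.adjGroup.hasGenerator_adjGroup_iff (Q (I s)) (Q (u s - x) + K (I s))).1
        (by rwa [S.adjGroup_adjGroup]) φ ψ hφ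
      rw [map_sub, inner_add_right, inner_sub_right] at h4
      linear_combination h4
    have d1 : HasDerivAt (fun s => Q (I s)) (Q (u t)) t :=
      ((Q : H →L[𝕜] H).restrictScalars ℝ).hasFDerivAt.comp_hasDerivAt t hId
    have d2 : HasDerivAt (fun s => K (I s)) (K (u t)) t :=
      (K.restrictScalars ℝ).hasFDerivAt.comp_hasDerivAt t hId
    have d3 := HasDerivAt.inner 𝕜 (hasDerivAt_const t ψ) d1
    have d4 := HasDerivAt.inner 𝕜 (hasDerivAt_const t φ) d2
    simp only [inner_zero_left, add_zero] at d3 d4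
    have d5 := (d3.const_sub (inner 𝕜 φ (Q x))).fun_sub d4
    rw [inner_neg_right, ← sub_eq_add_neg]
    refine d5.congr_of_eventuallyEq ?_
    filter_upwards [lt_mem_nhds ht] with s hs
    exact hform s hs.le
  have hduh : ∀ t : ℝ, 0 ≤ t → (V.conj Q).toFun t.toNNReal z =
      S.toFun t (z + ∫ s in (0 : ℝ)..t, S.toFun (-s) (-K (u s))) := by
    intro t ht
    have h1 := S.duhamel_of_weak (T := t) (z := fun t => Q (u t))
      (Q.continuous.comp huc).continuousOn
      hgc.continuousOn (fun φ ψ hφ s hs => hweak φ ψ hφ s hs.1) (right_mem_Icc.2 ht)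
    have h2 : Q (u 0) = z := by simp [hu, V.map_zero, hx]
    rw [h2] at h1
    exact h1
  have h := S.hasGenerator_of_duhamel (V.conj Q) hgc hduh w
  have hu0 : u 0 = x := by simp [hu, V.map_zero]
  rwa [hu0, sub_neg_eq_add] at h

/-- Once `Q x ∈ D(A)`, every other term of the identity is a pairing of the test vector with an
element of `H`, so the remaining functional `B W B* x` is one too. -/
theorem gram_eq_pivot (hQ : (Q : H →L[𝕜] H).toLinearMap.IsSymmetric)
    (hid : RiccatiIdentity B (Q : H →L[𝕜] H) R W lam) {x : S.adjGen.domain} {a : H}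
    (ha : S.toC0Semigroup.HasGenerator (Q x) a) :
    B.gram W x = pivot S.adjGen
      (a + Q (S.adjGen x) + Q (R (Q x)) + (2 * (lam : 𝕜)) • Q x) := by
  have hsym : ∀ a b : H, inner 𝕜 (Q a) b = inner 𝕜 a (Q b) := hQ
  ext ξ
  obtain ⟨y, rfl⟩ := toGraph_surjective _ ξ
  have h1 := hid x y
  have h2 : inner 𝕜 (S.adjGen y) (Q x) = inner 𝕜 (y : H) a := by
    have h3 := congrArg (starRingEnd 𝕜) (S.inner_adjGen ha y)
    rw [inner_conj_symm, inner_conj_symm] at h3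
    exact h3.symm
  simp only [ContinuousLinearEquiv.coe_coe] at h1
  rw [B.inner_star, h2, hsym, hsym] at h1
  change B (W (B.star x)) (toGraph S.adjGen y) = _
  rw [pivot_apply]
  simp only [inner_add_right, inner_smul_right]
  linear_combination -h1

end Riccati

end ClosedLoop

end StaticFeedback

end

/-! ### The main theorem -/

theorem mainTheorem5 {𝕜 : Type*} [RCLike 𝕜]
    {H : Type*} [NormedAddCommGroup H] [InnerProductSpace 𝕜 H] [CompleteSpace H]
    {U : Type*} [NormedAddCommGroup U] [InnerProductSpace 𝕜 U] [CompleteSpace U]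
    (S : C0Group 𝕜 H) (B : ControlOp S U) (hB : B.IsAdmissible)
    (Q : H ≃L[𝕜] H) (R : H →L[𝕜] H) (W : U →L[𝕜] U) (lam : ℝ)
    (hQ : IsCoercivePositive (Q : H →L[𝕜] H)) (hR : R.IsPositive) (hW : W.IsPositive)
    (hid : RiccatiIdentity B (Q : H →L[𝕜] H) R W lam) :
    -- the closed-loop system is well posed
    (∀ y₀ : H, ∃ y yt : ℝ → H, IsClosedLoopSol B Q R W lam y₀ y yt ∧
      ∀ y' yt' : ℝ → H, IsClosedLoopSol B Q R W lam y₀ y' yt' →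
        Set.EqOn y' y (Set.Ici 0) ∧ Set.EqOn yt' yt (Set.Ici 0)) ∧
    -- its flow is a strongly continuous semigroup
    ∃ SQ : C0Semigroup 𝕜 H,
      (∀ (y₀ : H) (y yt : ℝ → H), IsClosedLoopSol B Q R W lam y₀ y yt →
        ∀ t : NNReal, SQ.toFun t y₀ = y t) ∧
      -- exponential decay
      (∃ C : ℝ, 0 < C ∧ ∀ t : NNReal, ‖SQ.toFun t‖ ≤ C * Real.exp (-lam * t)) ∧
      -- domain and action of the generator
      (SQ.generator.domain : Set H) = {z | ∃ x : S.adjGen.domain, z = Q x} ∧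
      (∀ z : SQ.generator.domain, ∃ x : S.adjGen.domain, (x : H) = Q.symm z ∧
        SQ.generator z = -Q (S.adjGen x) - (2 * (lam : 𝕜)) • (z : H) - Q (R z)) ∧
      -- the case of a bounded operator `B W B*`
      (∀ K : H →L[𝕜] H, (∀ x : S.adjGen.domain, B.gram W x = pivot S.adjGen (K x)) →
        SQ.generator.domain = S.generator.domain ∧
        ∀ (x : H) (hx : x ∈ SQ.generator.domain) (hx' : x ∈ S.generator.domain),
          SQ.generator ⟨x, hx⟩ = S.generator ⟨x, hx'⟩ - K (Q.symm x)) ∧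
      -- the case of equal domains
      (SQ.generator.domain = S.generator.domain →
        ∃ C : ℝ, 0 < C ∧ ∀ x : S.adjGen.domain,
          ∃ (hx : Q x ∈ S.generator.domain) (h : H), B.gram W x = pivot S.adjGen h ∧
            ‖h‖ ≤ ‖S.generator ⟨Q x, hx⟩‖ + C * (‖S.adjGen x‖ + ‖(x : H)‖)) := by
  -- Time derivatives and integrals need a real structure on `H`; it is obtained by restricting
  -- scalars, compatibly with `𝕜`.
  let : NormedSpace ℝ H := NormedSpace.restrictScalars ℝ 𝕜 H
  have : IsScalarTower ℝ 𝕜 H := ⟨fun r c x => by rw [Algebra.smul_def, mul_smul]; rfl⟩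
  let : NormedSpace ℝ U := NormedSpace.restrictScalars ℝ 𝕜 U
  obtain ⟨V, hV⟩ := S.adjGroup.exists_perturbation (perturbation (Q : H →L[𝕜] H) R lam)
  replace hV : S.adjGroup.IsPerturbation (perturbation (Q : H →L[𝕜] H) R lam) V := hV
  have hsol := isClosedLoopSol_of_isPerturbation hB hQ.1 hid hV
  have huniq : ∀ (y₀ : H) (y yt : ℝ → H), IsClosedLoopSol B Q R W lam y₀ y yt → ∀ t, 0 ≤ t →
      yt t = V.toFun t.toNNReal (Q.symm y₀) ∧ y t = Q (V.toFun t.toNNReal (Q.symm y₀)) :=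
    -- The horizon `t + 1` is positive even for `t = 0` and contains `t`.
    fun y₀ y yt h t ht => (h (t + 1) (by linarith)).eq_of_isPerturbation hQ.1 hid hV
      ⟨ht, by linarith⟩
  have hgen := hasGenerator_conj_iff (Q := Q) (R := R) (lam := lam) hV
  have hdom : ∀ x : S.adjGen.domain, (V.conj Q).HasGenerator (Q x)
      (-Q (S.adjGen x) - (2 * (lam : 𝕜)) • Q x - Q (R (Q x))) := fun x =>
    (hgen _ _).2 ⟨x, by simp, rfl⟩
  refine ⟨fun y₀ => ⟨_, _, hsol y₀, fun y' yt' h' => ⟨fun t ht => (huniq y₀ y' yt' h' t ht).2,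
    fun t ht => (huniq y₀ y' yt' h' t ht).1⟩⟩, V.conj Q, fun y₀ y yt h t => ?_, ?_, ?_,
    fun z => ?_, fun K hK => ⟨?_, fun x hx hx' => ?_⟩, fun heq => ?_⟩
  · rw [(huniq y₀ y yt h t t.2).2, Real.toNNReal_coe]
    rfl
  · obtain ⟨C, hC0, hC⟩ := exists_norm_perturbed_le hQ hR hW hid hV
    set q := ‖(Q : H →L[𝕜] H)‖
    set q' := ‖(Q.symm : H →L[𝕜] H)‖
    -- The factors `q` and `q'` pay for the conjugation by `Q`; the `1` makes the constant strictly
    -- positive.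
    refine ⟨q * C * q' + 1, by positivity, fun t => ?_⟩
    refine ContinuousLinearMap.opNorm_le_bound _ (by positivity) fun x => ?_
    rw [C0Semigroup.conj_apply]
    have h1 : ‖Q (V.toFun t (Q.symm x))‖ ≤ q * ‖V.toFun t (Q.symm x)‖ :=
      (Q : H →L[𝕜] H).le_opNorm _
    have h2 : ‖Q.symm x‖ ≤ q' * ‖x‖ := (Q.symm : H →L[𝕜] H).le_opNorm _
    calc ‖Q (V.toFun t (Q.symm x))‖
        ≤ q * (C * Real.exp (-lam * t) * (q' * ‖x‖)) := by
          refine h1.trans ?_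
          gcongr
          exact (hC t _).trans (by gcongr)
      _ = (q * C * q') * Real.exp (-lam * t) * ‖x‖ := by ring
      _ ≤ (q * C * q' + 1) * Real.exp (-lam * t) * ‖x‖ := by
          gcongr
          linarith
  · ext z
    constructor
    · rintro ⟨w, hw⟩
      obtain ⟨x, hx, -⟩ := (hgen _ _).1 hw
      exact ⟨x, by rw [hx, Q.apply_symm_apply]⟩
    · rintro ⟨x, rfl⟩
      exact (hdom x).mem
  · exact (hgen _ _).1 ((V.conj Q).generator_spec z)
  · ext z
    constructor
    · rintro ⟨w, hw⟩
      exact ((hasGenerator_conj_iff_of_bounded hQ.1 hid hV hK z w).1 hw).mem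
    · rintro ⟨w, hw⟩
      refine ⟨w - K (Q.symm z), (hasGenerator_conj_iff_of_bounded hQ.1 hid hV hK z _).2 ?_⟩
      rwa [sub_add_cancel]
  · have h1 := S.hasGenerator_generator ⟨x, hx'⟩
    refine C0Semigroup.HasGenerator.generator_eq
      ((hasGenerator_conj_iff_of_bounded hQ.1 hid hV hK x _).2 ?_) hx
    rwa [sub_add_cancel]
  · set q := ‖(Q : H →L[𝕜] H)‖
    -- The first three summands bound `Q A* x`, `Q R Q x` and `2λ Q x` in the formula for `B W B*
    -- x`; the `1` ensures positivity.
    refine ⟨q + q * ‖R‖ * q + 2 * |lam| * q + 1, by positivity, fun x => ?_⟩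
    have hx : Q x ∈ S.generator.domain := by
      rw [← heq]
      exact (hdom x).mem
    refine ⟨hx, _, gram_eq_pivot hQ.1 hid (S.hasGenerator_generator ⟨Q x, hx⟩), ?_⟩
    have hq : ∀ y : H, ‖Q y‖ ≤ q * ‖y‖ := (Q : H →L[𝕜] H).le_opNorm
    have h1 : ‖Q (R (Q x))‖ ≤ q * ‖R‖ * q * ‖(x : H)‖ := by
      calc ‖Q (R (Q x))‖ ≤ q * (‖R‖ * (q * ‖(x : H)‖)) := by
            refine (hq _).trans ?_
            gcongr
            refine (R.le_opNorm _).trans ?_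
            gcongr
            exact hq x
        _ = _ := by ring
    have h2 : ‖(2 * (lam : 𝕜)) • Q x‖ ≤ 2 * |lam| * q * ‖(x : H)‖ := by
      rw [norm_smul, norm_mul, RCLike.norm_ofReal, RCLike.norm_ofNat, mul_assoc (2 * |lam|)]
      gcongr
      exact hq x
    have h3 := hq (S.adjGen x)
    refine (norm_add_le _ _).trans ?_
    have h4 := norm_add_le (S.generator ⟨Q x, hx⟩ + Q (S.adjGen x)) (Q (R (Q x)))
    have h5 := norm_add_le (S.generator ⟨Q x, hx⟩) (Q (S.adjGen x))
    have h6 : 0 ≤ (q * ‖R‖ * q + 2 * |lam| * q + 1) * ‖S.adjGen x‖ := by positivity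
    have h7 : 0 ≤ (q + 1) * ‖(x : H)‖ := by positivity
    linarith
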